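/- A geometric tree is a plane straight-line embedding in $\mathbb{R}^2$ of a finite non-empty tree, viewed also as the set of points on its vertices and edges. Two geometric trees are non-crossing if no edge of one and edge of the other share a point interior to both edges (in particular, disjoint trees are non-crossing). For $A \subseteq \mathbb{R}^2$ let $\mathrm{Box}(A)$ be its axis-aligned bounding box, i.e. the smallest closed axis-aligned rectangle containing $A$. Given a finite set $T=\{T_1,\dots,T_m\}$ of pairwise non-crossing geometric trees, start with the collection $\mathcal{C}=\{\mathrm{Box}(T_i) : 1\le i\le m\}$ and, as long as the members of $\mathcal{C}$ are not pairwise disjoint, choose two arbitrary distinct members $C,C'$ with $C\cap C'\neq\emptyset$ and replace $\mathcal{C}$ by $(\mathcal{C}\setminus\{C,C'\})\cup\{\mathrm{Box}(C\cup C')\}$. The final collection does not depend on the choices; it is called the box-cover of $T$. **Theorem.** The box-cover of a set of pairwise non-crossing geometric trees with a total of $n$ vertices can be computed in $O(n\log^2 n)$ time. That is, there are a real RAM program and a constant $c$ such that, for every such set of trees, given by the coordinates of the vertices and the edges of each tree, the program halts after at most $c\,(n\log^2 n+1)$ steps and outputs the box-cover as a list, without repetition, of the corner coordinates of its boxes.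 -/

import Mathlib

/-! ### Covers of families of plane sets -/

/-- One merging step: two distinct members `A`, `B` of the collection `𝒞` that intersect are
replaced by `φ (A ∪ B)`. -/
def MergeStep (φ : Set (ℝ × ℝ) → Set (ℝ × ℝ)) (𝒞 𝒟 : Set (Set (ℝ × ℝ))) : Prop :=
  ∃ A ∈ 𝒞, ∃ B ∈ 𝒞, A ≠ B ∧ (A ∩ B).Nonempty ∧ 𝒟 = (𝒞 \ {A, B}) ∪ {φ (A ∪ B)}

/-- `𝒞` is a possible outcome of the merging process on the family `𝒯`: start with the sets `φ S`,
`S ∈ 𝒯`, perform merging steps with arbitrary choices, and stop when the members of the collection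
are pairwise disjoint. -/
def IsCover (φ : Set (ℝ × ℝ) → Set (ℝ × ℝ)) (𝒯 𝒞 : Set (Set (ℝ × ℝ))) : Prop :=
  Relation.ReflTransGen (MergeStep φ) (φ '' 𝒯) 𝒞 ∧ 𝒞.PairwiseDisjoint id

/-- The axis-aligned bounding box: the intersection of all closed axis-aligned rectangles
`Set.Icc a b = [a.1, b.1] × [a.2, b.2]` that contain `A`. -/
def boundingBox (A : Set (ℝ × ℝ)) : Set (ℝ × ℝ) :=
  ⋂₀ {R | ∃ a b : ℝ × ℝ, R = Set.Icc a b ∧ A ⊆ R}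

/-! ### Geometric trees -/

/-- A geometric tree: a plane straight-line embedding of a tree with `k` vertices, given by the
positions of the vertices and the list of the `k - 1` edges. -/
structure GeomTree where
  /-- number of vertices -/
  k : ℕ
  /-- position of each vertex -/
  pos : Fin k → ℝ × ℝ
  /-- the two endpoints of each edge -/
  edge : Fin (k - 1) → Fin k × Fin k
  isTree : (SimpleGraph.fromRel fun u v => ∃ e, edge e = (u, v)).IsTree
  pos_injective : Function.Injective pos
  /-- two different edges meet at most in a common endpoint -/
  plane : ∀ e f, e ≠ f →
    ∀ p ∈ segment ℝ (pos (edge e).1) (pos (edge e).2) ∩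
        segment ℝ (pos (edge f).1) (pos (edge f).2),
      ∃ v, p = pos v ∧ (v = (edge e).1 ∨ v = (edge e).2) ∧ (v = (edge f).1 ∨ v = (edge f).2)

/-- The set of points of the plane that is occupied by a geometric tree. -/
def GeomTree.carrier (S : GeomTree) : Set (ℝ × ℝ) :=
  Set.range S.pos ∪ ⋃ e, segment ℝ (S.pos (S.edge e).1) (S.pos (S.edge e).2)

/-- No edge of `S` and edge of `S'` have a point in common that is interior to both. In particular
trees that are disjoint as point sets are non-crossing. -/
def NonCrossing (S S' : GeomTree) : Prop :=
  ∀ e e', Disjoint (openSegment ℝ (S.pos (S.edge e).1) (S.pos (S.edge e).2))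
    (openSegment ℝ (S'.pos (S'.edge e').1) (S'.pos (S'.edge e').2))

/-- The total number of vertices. -/
def totalVertices (T : List GeomTree) : ℕ := (T.map GeomTree.k).sum

/-- The point sets of the trees in the list. -/
def carriers (T : List GeomTree) : Set (Set (ℝ × ℝ)) := {A | ∃ S ∈ T, A = S.carrier}

/-! ### The real RAM

A program uses finitely many unbounded arrays of natural numbers and finitely many unbounded arrays
of real numbers; the number of the array is fixed in the program text, the index in the array is
computed. A simple variable is an array of which only cell `0` is used. Each arithmetic operation,
constant, memory access, comparison, logical connective and assignment takes one unit of time.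
There is no conversion between natural and real numbers. -/

namespace RealRAM

/-- The contents of the memory: `nat a i` and `real a i` are the cells with index `i` of the arrays
with number `a`. -/
structure State where
  nat : ℕ → ℕ → ℕ
  real : ℕ → ℕ → ℝ

/-- Natural number expressions (truncated subtraction, halving rounded down). -/
inductive NExp where
  | const (c : ℕ)
  | load (a : ℕ) (i : NExp)
  | add (x y : NExp)
  | sub (x y : NExp)
  | half (x : NExp)

/-- Real number expressions, with rational constants only. -/
inductive RExp where
  | const (c : ℚ)
  | load (a : ℕ) (i : NExp)
  | add (x y : RExp)
  | sub (x y : RExp)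
  | mul (x y : RExp)
  | div (x y : RExp)

/-- Tests. -/
inductive Test where
  | natLe (x y : NExp)
  | realLe (x y : RExp)
  | not (b : Test)
  | and (b c : Test)

/-- Programs. -/
inductive Prog where
  | skip
  | setNat (a : ℕ) (i x : NExp)
  | setReal (a : ℕ) (i : NExp) (x : RExp)
  | seq (p q : Prog)
  | ite (b : Test) (p q : Prog)
  | while (b : Test) (p : Prog)

/-- Value of a natural number expression. -/
def NExp.eval (s : State) : NExp → ℕ
  | .const c => c
  | .load a i => s.nat a (i.eval s)
  | .add x y => x.eval s + y.eval s
  | .sub x y => x.eval s - y.eval s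
  | .half x => x.eval s / 2

/-- Time to evaluate a natural number expression. -/
def NExp.cost : NExp → ℕ
  | .const _ => 1
  | .load _ i => i.cost + 1
  | .add x y => x.cost + y.cost + 1
  | .sub x y => x.cost + y.cost + 1
  | .half x => x.cost + 1

/-- Value of a real number expression (a quotient with denominator `0` has the value `0`). -/
noncomputable def RExp.eval (s : State) : RExp → ℝ
  | .const c => (c : ℝ)
  | .load a i => s.real a (i.eval s)
  | .add x y => x.eval s + y.eval s
  | .sub x y => x.eval s - y.eval s
  | .mul x y => x.eval s * y.eval s
  | .div x y => x.eval s / y.eval s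

/-- Time to evaluate a real number expression. -/
def RExp.cost : RExp → ℕ
  | .const _ => 1
  | .load _ i => i.cost + 1
  | .add x y => x.cost + y.cost + 1
  | .sub x y => x.cost + y.cost + 1
  | .mul x y => x.cost + y.cost + 1
  | .div x y => x.cost + y.cost + 1

/-- Truth of a test. -/
def Test.holds (s : State) : Test → Prop
  | .natLe x y => x.eval s ≤ y.eval s
  | .realLe x y => x.eval s ≤ y.eval s
  | .not b => ¬ b.holds s
  | .and b c => b.holds s ∧ c.holds s

/-- Time to evaluate a test. -/
def Test.cost : Test → ℕ
  | .natLe x y => x.cost + y.cost + 1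
  | .realLe x y => x.cost + y.cost + 1
  | .not b => b.cost + 1
  | .and b c => b.cost + c.cost + 1

/-- Store `x` in cell `i` of the natural number array `a`. -/
def State.putNat (s : State) (a i x : ℕ) : State :=
  { s with nat := Function.update s.nat a (Function.update (s.nat a) i x) }

/-- Store `x` in cell `i` of the real array `a`. -/
def State.putReal (s : State) (a i : ℕ) (x : ℝ) : State :=
  { s with real := Function.update s.real a (Function.update (s.real a) i x) }

/-- `Exec p s t s'`: the program `p`, started in the state `s`, halts in the state `s'` after
exactly `t` units of time. -/
inductive Exec : Prog → State → ℕ → State → Prop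
  | skip (s : State) : Exec .skip s 1 s
  | setNat (s : State) (a : ℕ) (i x : NExp) :
      Exec (.setNat a i x) s (i.cost + x.cost + 1) (s.putNat a (i.eval s) (x.eval s))
  | setReal (s : State) (a : ℕ) (i : NExp) (x : RExp) :
      Exec (.setReal a i x) s (i.cost + x.cost + 1) (s.putReal a (i.eval s) (x.eval s))
  | seq {p q : Prog} {s s' s'' : State} {t t' : ℕ} :
      Exec p s t s' → Exec q s' t' s'' → Exec (.seq p q) s (t + t') s''
  | iteTrue {b : Test} {p q : Prog} {s s' : State} {t : ℕ} :
      b.holds s → Exec p s t s' → Exec (.ite b p q) s (b.cost + t) s'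
  | iteFalse {b : Test} {p q : Prog} {s s' : State} {t : ℕ} :
      ¬ b.holds s → Exec q s t s' → Exec (.ite b p q) s (b.cost + t) s'
  | whileTrue {b : Test} {p : Prog} {s s' s'' : State} {t t' : ℕ} :
      b.holds s → Exec p s t s' → Exec (.while b p) s' t' s'' →
        Exec (.while b p) s (b.cost + t + t') s''
  | whileFalse {b : Test} {p : Prog} {s : State} :
      ¬ b.holds s → Exec (.while b p) s b.cost s

/-- The initial memory for the list `T` of trees. Cell `0` of natural number array `0` holds the
number of trees and array `1` holds the numbers of vertices of the trees. The real arrays `0` and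
`1` hold the `x`- and `y`-coordinates of the vertices, tree after tree. The natural number arrays
`2` and `3` hold the first and second endpoints of the edges, tree after tree, as vertex numbers
within the tree. All other cells are `0`. -/
def input (T : List GeomTree) : State where
  nat a i :=
    match a with
    | 0 => if i = 0 then T.length else 0
    | 1 => (T.map GeomTree.k).getD i 0
    | 2 => (T.flatMap fun S => List.ofFn fun e => ((S.edge e).1 : ℕ)).getD i 0
    | 3 => (T.flatMap fun S => List.ofFn fun e => ((S.edge e).2 : ℕ)).getD i 0
    | _ => 0
  real a i :=
    match a with
    | 0 => (T.flatMap fun S => List.ofFn fun v => (S.pos v).1).getD i 0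
    | 1 => (T.flatMap fun S => List.ofFn fun v => (S.pos v).2).getD i 0
    | _ => 0

/-- The number of boxes that a final memory lists: cell `0` of natural number array `0`. -/
def outputCount (s : State) : ℕ := s.nat 0 0

/-- The box with number `j` in a final memory: real arrays `0`, `1`, `2`, `3` hold the smallest
`x`, the smallest `y`, the largest `x` and the largest `y`, respectively. -/
def outputBox (s : State) (j : ℕ) : Set (ℝ × ℝ) :=
  Set.Icc (s.real 0 j, s.real 1 j) (s.real 2 j, s.real 3 j)

/-- The final memory lists exactly the members of the collection `𝒞`, without repetition. -/
def Outputs (s : State) (𝒞 : Set (Set (ℝ × ℝ))) : Prop :=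
  Set.BijOn (outputBox s) (Set.Iio (outputCount s)) 𝒞

end RealRAM

/-! Correctness. Call a family of boxes a lower cover (`LowerCover`) if each initial box lies in one
of its members and each member lies in a single box of every disjoint cover. The initial boxes form
a lower cover. If two members meet, the boxes of a disjoint cover that contain them share a point,
so they coincide and contain the merged box; hence merging preserves lower covers
(`LowerCover.merge`). Two pairwise disjoint lower covers are equal (`LowerCover.unique`). So every
order of merges leads to the same result, and the algorithm may choose the order and need only end
with a disjoint family.

Algorithm. The boxes are processed by increasing left end. A store holds pairwise disjoint boxes.
The current box `x` absorbs stored boxes that it meets until there are none, and then enters the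
store (`Sweep.merge`, `Sweep.insert`). Stored boxes start no further right than the original left
end of `x`, so a stored box meets `x` exactly if the `y`-intervals meet and it extends to the right
at least to the left end of `x`. The ends of the `y`-intervals are replaced by their ranks among all
`2 * m` ends, lower ends first in case of ties (`IsSorting.ranking`); the ranks can serve as array
indices.

Search. If two intervals meet, one contains the lower end of the other. Stored boxes with lower end
in the interval of `x` are found with a tournament tree over the ranks that returns the largest
right end on each canonical node of the interval. Stored boxes whose interval contains the lower end
of `x` are found on the path from that leaf to the root: every stored box lies on the stacks of the
canonical nodes of its interval. When `x` is inserted, all stored boxes with overlapping interval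
end to the left of `x`, so the stacks are sorted by right ends (`Pushing.push`), and it suffices to
look at the top element.

Time. Removal only clears a leaf of the tournament tree; dead stack entries are popped when they
come to the top, which is paid for by a potential proportional to the total size of the stacks. An
insertion creates `O(log m)` entries, a successful search removes a stored box, and each box has one
unsuccessful search. Sorting uses the same tournament tree. Altogether `O(n log n)` steps suffice
(`runs_boxCover`), which is within the required bound. -/

/-! ### Reasoning about programs with a time budget -/

namespace RealRAM

/-- Disjunction of tests. -/
def Test.or (b c : Test) : Test := .not (.and (.not b) (.not c))

/-- Equality test for natural numbers. -/
def Test.natEq (x y : NExp) : Test := .and (.natLe x y) (.natLe y x)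

/-- Strict comparison of natural numbers. -/
def Test.natLt (x y : NExp) : Test := .natLe (.add x (.const 1)) y

/-- The value of the simple variable `a`. -/
def NExp.var (a : ℕ) : NExp := .load a (.const 0)

/-- Assignment to the simple variable `a`. -/
def Prog.set (a : ℕ) (x : NExp) : Prog := .setNat a (.const 0) x

/-- Sequential composition. -/
notation:60 p:61 ";;" q:60 => Prog.seq p q

attribute [simp] NExp.eval RExp.eval Test.holds NExp.cost RExp.cost Test.cost

@[simp] theorem NExp.eval_var (s : State) (a : ℕ) : (NExp.var a).eval s = s.nat a 0 := rfl

@[simp] theorem NExp.cost_var (a : ℕ) : (NExp.var a).cost = 2 := rfl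

@[simp] theorem Test.holds_or (s : State) (b c : Test) :
    (b.or c).holds s ↔ b.holds s ∨ c.holds s := by
  simp only [Test.or, Test.holds]; tauto

@[simp] theorem Test.holds_natEq (s : State) (x y : NExp) :
    (Test.natEq x y).holds s ↔ x.eval s = y.eval s := by
  simp only [Test.natEq, Test.holds]; omega

@[simp] theorem Test.holds_natLt (s : State) (x y : NExp) :
    (Test.natLt x y).holds s ↔ x.eval s < y.eval s := by
  simp only [Test.natLt, Test.holds, NExp.eval]; omega

@[simp] theorem Test.cost_or (b c : Test) : (b.or c).cost = b.cost + 1 + (c.cost + 1) + 1 + 1 := rfl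

@[simp] theorem Test.cost_natEq (x y : NExp) :
    (Test.natEq x y).cost = x.cost + y.cost + 1 + (y.cost + x.cost + 1) + 1 := rfl

@[simp] theorem Test.cost_natLt (x y : NExp) :
    (Test.natLt x y).cost = x.cost + 1 + 1 + y.cost + 1 := rfl

theorem Test.cost_pos (b : Test) : 0 < b.cost := by cases b <;> simp

@[simp] theorem State.putNat_nat (s : State) (a i x b : ℕ) :
    (s.putNat a i x).nat b = if b = a then Function.update (s.nat a) i x else s.nat b := by
  simp only [State.putNat, Function.update_apply]

@[simp] theorem State.putNat_real (s : State) (a i x : ℕ) : (s.putNat a i x).real = s.real := rfl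

@[simp] theorem State.putReal_real (s : State) (a i : ℕ) (x : ℝ) (b : ℕ) :
    (s.putReal a i x).real b = if b = a then Function.update (s.real a) i x else s.real b := by
  simp only [State.putReal, Function.update_apply]

@[simp] theorem State.putReal_nat (s : State) (a i : ℕ) (x : ℝ) : (s.putReal a i x).nat = s.nat :=
  rfl

/-! ### Loop-free programs -/

/-- The program contains no loop. -/
@[simp] def Prog.LoopFree : Prog → Prop
  | .skip | .setNat .. | .setReal .. => True
  | .seq p q => p.LoopFree ∧ q.LoopFree
  | .ite _ p q => p.LoopFree ∧ q.LoopFree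
  | .while .. => False

open Classical in
/-- The final state of a loop-free program. -/
@[simp] noncomputable def Prog.run : Prog → State → State
  | .skip, s => s
  | .setNat a i x, s => s.putNat a (i.eval s) (x.eval s)
  | .setReal a i x, s => s.putReal a (i.eval s) (x.eval s)
  | .seq p q, s => q.run (p.run s)
  | .ite b p q, s => if b.holds s then p.run s else q.run s
  | .while .., s => s

/-- A bound for the running time of a loop-free program. -/
@[simp] def Prog.time : Prog → ℕ
  | .skip => 1
  | .setNat _ i x => i.cost + x.cost + 1
  | .setReal _ i x => i.cost + x.cost + 1
  | .seq p q => p.time + q.time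
  | .ite b p q => b.cost + max p.time q.time
  | .while .. => 0

@[simp] theorem Prog.loopFree_set (a : ℕ) (x : NExp) : (Prog.set a x).LoopFree := trivial

@[simp] theorem Prog.run_set (a : ℕ) (x : NExp) (s : State) :
    (Prog.set a x).run s = s.putNat a 0 (x.eval s) := rfl

@[simp] theorem Prog.time_set (a : ℕ) (x : NExp) : (Prog.set a x).time = 1 + x.cost + 1 := rfl

theorem Prog.LoopFree.exec {p : Prog} (h : p.LoopFree) (s : State) :
    ∃ t ≤ p.time, Exec p s t (p.run s) := by
  induction p generalizing s with
  | skip => exact ⟨1, le_rfl, .skip s⟩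
  | setNat a i x => exact ⟨_, le_rfl, .setNat s a i x⟩
  | setReal a i x => exact ⟨_, le_rfl, .setReal s a i x⟩
  | seq p q ihp ihq =>
    obtain ⟨t, ht, h1⟩ := ihp h.1 s
    obtain ⟨t', ht', h2⟩ := ihq h.2 (p.run s)
    exact ⟨t + t', add_le_add ht ht', .seq h1 h2⟩
  | ite b p q ihp ihq =>
    by_cases hb : b.holds s
    · obtain ⟨t, ht, h1⟩ := ihp h.1 s
      refine ⟨b.cost + t, by simp only [Prog.time]; omega, ?_⟩
      simpa only [Prog.run, hb, if_true] using Exec.iteTrue hb h1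
    · obtain ⟨t, ht, h1⟩ := ihq h.2 s
      refine ⟨b.cost + t, by simp only [Prog.time]; omega, ?_⟩
      simpa only [Prog.run, hb, if_false] using Exec.iteFalse hb h1
  | _ => exact h.elim

/-! ### Frames: what a program leaves unchanged -/

/-- The natural number arrays to which the program writes. -/
@[simp] def Prog.natWrites : Prog → List ℕ
  | .skip | .setReal .. => []
  | .setNat a _ _ => [a]
  | .seq p q => p.natWrites ++ q.natWrites
  | .ite _ p q => p.natWrites ++ q.natWrites
  | .while _ p => p.natWrites

/-- The real arrays to which the program writes. -/
@[simp] def Prog.realWrites : Prog → List ℕ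
  | .skip | .setNat .. => []
  | .setReal a _ _ => [a]
  | .seq p q => p.realWrites ++ q.realWrites
  | .ite _ p q => p.realWrites ++ q.realWrites
  | .while _ p => p.realWrites

@[simp] theorem Prog.natWrites_set (a : ℕ) (x : NExp) : (Prog.set a x).natWrites = [a] := rfl

@[simp] theorem Prog.realWrites_set (a : ℕ) (x : NExp) : (Prog.set a x).realWrites = [] := rfl

/-- The states agree on all arrays to which the program does not write. -/
structure Frame (p : Prog) (s s' : State) : Prop where
  nat : ∀ a, a ∉ p.natWrites → s'.nat a = s.nat a
  real : ∀ a, a ∉ p.realWrites → s'.real a = s.real a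

theorem Frame.refl (p : Prog) (s : State) : Frame p s s := ⟨fun _ _ => rfl, fun _ _ => rfl⟩

theorem Frame.trans {p : Prog} {s s' s'' : State} (h : Frame p s s') (h' : Frame p s' s'') :
    Frame p s s'' :=
  ⟨fun a ha => (h'.nat a ha).trans (h.nat a ha), fun a ha => (h'.real a ha).trans (h.real a ha)⟩

theorem Frame.of_subset {p q : Prog} {s s' : State} (h : Frame p s s')
    (hn : p.natWrites ⊆ q.natWrites) (hr : p.realWrites ⊆ q.realWrites) : Frame q s s' :=
  ⟨fun a ha => h.nat a fun h => ha (hn h), fun a ha => h.real a fun h => ha (hr h)⟩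

theorem Exec.frame {p : Prog} {s s' : State} {t : ℕ} (h : Exec p s t s') : Frame p s s' := by
  induction h with
  | skip s => exact .refl _ _
  | setNat s a i x =>
    refine ⟨fun b hb => ?_, fun b hb => rfl⟩
    simp only [Prog.natWrites, List.mem_singleton] at hb
    simp [hb]
  | setReal s a i x =>
    refine ⟨fun b hb => rfl, fun b hb => ?_⟩
    simp only [Prog.realWrites, List.mem_singleton] at hb
    simp [hb]
  | seq _ _ ih ih' =>
    exact (ih.of_subset (by simp) (by simp)).trans (ih'.of_subset (by simp) (by simp))
  | iteTrue _ _ ih => exact ih.of_subset (by simp) (by simp)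
  | iteFalse _ _ ih => exact ih.of_subset (by simp) (by simp)
  | whileTrue _ _ _ ih ih' => exact (ih.of_subset (by simp) (by simp)).trans ih'
  | whileFalse _ => exact .refl _ _

/-! ### Rules for programs with a time budget -/

/-- Started in the state `s` with `n` units of time at its disposal, the program `p` halts in a
state `s'` with `k` units of time left such that `Q s' k`. -/
def Runs (p : Prog) (s : State) (n : ℕ) (Q : State → ℕ → Prop) : Prop :=
  ∃ t s' k, Exec p s t s' ∧ t + k ≤ n ∧ Q s' k

theorem Runs.imp {p : Prog} {s : State} {n : ℕ} {Q Q' : State → ℕ → Prop} (h : Runs p s n Q)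
    (hQ : ∀ s' k, Frame p s s' → Q s' k → Q' s' k) : Runs p s n Q' := by
  obtain ⟨t, s', k, h1, h2, h3⟩ := h
  exact ⟨t, s', k, h1, h2, hQ s' k h1.frame h3⟩

theorem Runs.mono {p : Prog} {s : State} {n n' : ℕ} {Q : State → ℕ → Prop} (h : Runs p s n Q)
    (hn : n ≤ n') : Runs p s n' Q := by
  obtain ⟨t, s', k, h1, h2, h3⟩ := h
  exact ⟨t, s', k, h1, h2.trans hn, h3⟩

/-- Time that is not needed is left over. -/
theorem Runs.left_over {p : Prog} {s : State} {n k : ℕ} {Q : State → Prop}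
    (h : Runs p s n fun s' _ => Q s') {Q' : State → ℕ → Prop}
    (hQ : ∀ s', Frame p s s' → Q s' → Q' s' k) : Runs p s (n + k) Q' := by
  obtain ⟨t, s', l, h1, h2, h3⟩ := h
  exact ⟨t, s', k, h1, by omega, hQ s' h1.frame h3⟩

/-- The time left over by `p` may depend on the state that it reaches, and is the budget of `q`.
This is how amortised bounds are passed along. -/
theorem Runs.seq {p q : Prog} {s : State} {n : ℕ} {Q R : State → ℕ → Prop} (h : Runs p s n R)
    (h' : ∀ s' k, Frame p s s' → R s' k → Runs q s' k Q) : Runs (p ;; q) s n Q := by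
  obtain ⟨t, s', k, h1, h2, h3⟩ := h
  obtain ⟨t', s'', k', h4, h5, h6⟩ := h' s' k h1.frame h3
  exact ⟨t + t', s'', k', .seq h1 h4, by omega, h6⟩

theorem Runs.ite {b : Test} {p q : Prog} {s : State} {n : ℕ} {Q : State → ℕ → Prop}
    (h : b.holds s → Runs p s n Q) (h' : ¬ b.holds s → Runs q s n Q) :
    Runs (.ite b p q) s (n + b.cost) Q := by
  by_cases hb : b.holds s
  · obtain ⟨t, s', k, h1, h2, h3⟩ := h hb
    exact ⟨_, s', k, .iteTrue hb h1, by omega, h3⟩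
  · obtain ⟨t, s', k, h1, h2, h3⟩ := h' hb
    exact ⟨_, s', k, .iteFalse hb h1, by omega, h3⟩

theorem Runs.loopFree {p : Prog} (hp : p.LoopFree) {s : State} {n k : ℕ} {Q : State → ℕ → Prop}
    (hn : p.time + k ≤ n) (hQ : Q (p.run s) k) : Runs p s n Q := by
  obtain ⟨t, ht, h⟩ := hp.exec s
  exact ⟨t, _, k, h, by omega, hQ⟩

/-- Sequential composition with a loop-free first part. -/
theorem Runs.step {p q : Prog} {s : State} {n k : ℕ} {Q : State → ℕ → Prop} (hp : p.LoopFree)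
    (hn : p.time + k ≤ n) (h : ∀ t, Frame p s t → t = p.run s → Runs q t k Q) :
    Runs (p ;; q) s n Q := by
  obtain ⟨t, ht, e⟩ := hp.exec s
  exact (Runs.loopFree hp hn (Q := fun s' k' => s' = p.run s ∧ k' = k) ⟨rfl, rfl⟩).seq
    fun s' k' hf hs => hs.2 ▸ h s' hf hs.1

/-- Sequential composition with a first part of bounded running time. -/
theorem Runs.call {p q : Prog} {s : State} {n n₁ k : ℕ} {R : State → Prop}
    {Q : State → ℕ → Prop} (h : Runs p s n₁ fun s' _ => R s') (hn : n₁ + k ≤ n)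
    (h' : ∀ t, Frame p s t → R t → Runs q t k Q) : Runs (p ;; q) s n Q :=
  ((h.left_over (k := k) (Q' := fun t k' => R t ∧ k' = k) fun _ _ h => ⟨h, rfl⟩).mono hn).seq
    fun t _ hf ht => ht.2 ▸ h' t hf ht.1

/-- The rule for loops. The invariant `I` speaks about the time that is left, so that it bounds the
number of iterations. -/
theorem Runs.while {b : Test} {p : Prog} {Q : State → ℕ → Prop} {s₀ : State} {n₀ : ℕ}
    (I : State → ℕ → Prop)
    (step : ∀ s n, Frame p s₀ s → I s n → ∃ k, k + b.cost ≤ n ∧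
      (b.holds s → Runs p s k I) ∧ (¬ b.holds s → Q s k)) (h : I s₀ n₀) :
    Runs (.while b p) s₀ n₀ Q := by
  suffices H : ∀ n s, Frame p s₀ s → I s n → Runs (.while b p) s n Q from H n₀ s₀ (.refl _ _) h
  intro n
  induction n using Nat.strong_induction_on with
  | _ n ih =>
    intro s hf hI
    obtain ⟨k, hk, h1, h2⟩ := step s n hf hI
    by_cases hb : b.holds s
    · obtain ⟨t, s', k', e, ht, hI'⟩ := h1 hb
      -- Evaluating the test takes at least one unit, so every round strictly decreases the time
      -- left, on which the induction runs.
      have := b.cost_pos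
      obtain ⟨t', s'', k'', e', ht', hQ⟩ := ih k' (by omega) s' (hf.trans e.frame) hI'
      exact ⟨_, s'', k'', .whileTrue hb e e', by omega, hQ⟩
    · exact ⟨_, s, k, .whileFalse hb, by omega, h2 hb⟩

end RealRAM


/-! ### Covers by boxes -/

/-- The nonempty closed axis-aligned rectangles. -/
def IsBox (A : Set (ℝ × ℝ)) : Prop := ∃ a b : ℝ × ℝ, a ≤ b ∧ A = Set.Icc a b

theorem IsBox.nonempty {A : Set (ℝ × ℝ)} (h : IsBox A) : A.Nonempty := by
  obtain ⟨a, b, hab, rfl⟩ := h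
  exact Set.nonempty_Icc.2 hab

theorem subset_boundingBox (A : Set (ℝ × ℝ)) : A ⊆ boundingBox A := by
  refine Set.subset_sInter ?_
  rintro R ⟨a, b, -, h⟩
  exact h

theorem boundingBox_subset {A D : Set (ℝ × ℝ)} (hD : IsBox D) (h : A ⊆ D) :
    boundingBox A ⊆ D := by
  obtain ⟨a, b, -, rfl⟩ := hD
  exact Set.sInter_subset_of_mem ⟨a, b, rfl, h⟩

theorem boundingBox_eq {A : Set (ℝ × ℝ)} {a b : ℝ × ℝ} (h : A ⊆ Set.Icc a b)
    (h' : ∀ c d, A ⊆ Set.Icc c d → c ≤ a ∧ b ≤ d) : boundingBox A = Set.Icc a b := by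
  refine Set.Subset.antisymm (Set.sInter_subset_of_mem ⟨a, b, rfl, h⟩) (Set.subset_sInter ?_)
  rintro R ⟨c, d, rfl, hR⟩
  exact Set.Icc_subset_Icc (h' c d hR).1 (h' c d hR).2

theorem boundingBox_union_Icc {a b c d : ℝ × ℝ} (hab : a ≤ b) (hcd : c ≤ d) :
    boundingBox (Set.Icc a b ∪ Set.Icc c d) = Set.Icc (a ⊓ c) (b ⊔ d) := by
  refine boundingBox_eq (Set.union_subset (Set.Icc_subset_Icc inf_le_left le_sup_left)
    (Set.Icc_subset_Icc inf_le_right le_sup_right)) fun e f h => ?_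
  have ha := h (Or.inl (Set.left_mem_Icc.2 hab))
  have hb := h (Or.inl (Set.right_mem_Icc.2 hab))
  have hc := h (Or.inr (Set.left_mem_Icc.2 hcd))
  have hd := h (Or.inr (Set.right_mem_Icc.2 hcd))
  exact ⟨le_inf ha.1 hc.1, sup_le hb.2 hd.2⟩

theorem isBox_boundingBox_union {A B : Set (ℝ × ℝ)} (hA : IsBox A) (hB : IsBox B) :
    IsBox (boundingBox (A ∪ B)) := by
  obtain ⟨a, b, hab, rfl⟩ := hA
  obtain ⟨c, d, hcd, rfl⟩ := hB
  exact ⟨_, _, (inf_le_left.trans hab).trans le_sup_left, boundingBox_union_Icc hab hcd⟩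

/-- A family of pairwise disjoint boxes that covers each member of `ℬ` by a single box. -/
structure DisjointCover (ℬ 𝒟 : Set (Set (ℝ × ℝ))) : Prop where
  isBox : ∀ D ∈ 𝒟, IsBox D
  covers : ∀ B ∈ ℬ, ∃ D ∈ 𝒟, B ⊆ D
  disjoint : 𝒟.PairwiseDisjoint id

/-- A family of boxes that covers each member of `ℬ` by a single box, and is finer than every
disjoint cover of `ℬ`. -/
structure LowerCover (ℬ 𝒞 : Set (Set (ℝ × ℝ))) : Prop where
  isBox : ∀ C ∈ 𝒞, IsBox C
  covers : ∀ B ∈ ℬ, ∃ C ∈ 𝒞, B ⊆ C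
  le : ∀ 𝒟, DisjointCover ℬ 𝒟 → ∀ C ∈ 𝒞, ∃ D ∈ 𝒟, C ⊆ D

theorem LowerCover.refl {ℬ : Set (Set (ℝ × ℝ))} (h : ∀ B ∈ ℬ, IsBox B) : LowerCover ℬ ℬ :=
  ⟨h, fun B hB => ⟨B, hB, subset_rfl⟩, fun _ h𝒟 => h𝒟.covers⟩

/-- Replacing two intersecting members of a lower cover by the bounding box of their union. -/
theorem LowerCover.merge {ℬ 𝒞 𝒞' : Set (Set (ℝ × ℝ))} {A B : Set (ℝ × ℝ)} (h : LowerCover ℬ 𝒞)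
    (hA : A ∈ 𝒞) (hB : B ∈ 𝒞) (hAB : (A ∩ B).Nonempty) (hU : boundingBox (A ∪ B) ∈ 𝒞')
    (h₁ : ∀ C ∈ 𝒞, C ∈ 𝒞' ∨ C = A ∨ C = B) (h₂ : ∀ C ∈ 𝒞', C ∈ 𝒞 ∨ C = boundingBox (A ∪ B)) :
    LowerCover ℬ 𝒞' := by
  refine ⟨fun C hC => ?_, fun D hD => ?_, fun 𝒟 h𝒟 C hC => ?_⟩
  · rcases h₂ C hC with h' | rfl
    · exact h.isBox C h'
    · exact isBox_boundingBox_union (h.isBox A hA) (h.isBox B hB)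
  · obtain ⟨C, hC, hDC⟩ := h.covers D hD
    rcases h₁ C hC with h' | rfl | rfl
    · exact ⟨C, h', hDC⟩
    · exact ⟨_, hU, hDC.trans (Set.subset_union_left.trans (subset_boundingBox _))⟩
    · exact ⟨_, hU, hDC.trans (Set.subset_union_right.trans (subset_boundingBox _))⟩
  · rcases h₂ C hC with h' | rfl
    · exact h.le 𝒟 h𝒟 C h'
    · obtain ⟨D, hD, hAD⟩ := h.le 𝒟 h𝒟 A hA
      obtain ⟨E, hE, hBE⟩ := h.le 𝒟 h𝒟 B hB
      obtain ⟨p, hpA, hpB⟩ := hAB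
      -- The common point of `A` and `B` lies in both `D` and `E`, and different members of `𝒟` are
      -- disjoint.
      obtain rfl : D = E := h𝒟.disjoint.elim_set hD hE p (hAD hpA) (hBE hpB)
      exact ⟨D, hD, boundingBox_subset (h𝒟.isBox D hD) (Set.union_subset hAD hBE)⟩

theorem LowerCover.disjointCover {ℬ 𝒞 : Set (Set (ℝ × ℝ))} (h : LowerCover ℬ 𝒞)
    (hd : 𝒞.PairwiseDisjoint id) : DisjointCover ℬ 𝒞 := ⟨h.isBox, h.covers, hd⟩

/-- Each family refines the other: `C ⊆ D ⊆ E` with `D` in `𝒞'` and `E` in `𝒞`. As `C` is nonempty,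
disjointness forces `C = E`, so both inclusions are equalities. -/
theorem LowerCover.subset {ℬ 𝒞 𝒞' : Set (Set (ℝ × ℝ))} (h : LowerCover ℬ 𝒞)
    (hd : 𝒞.PairwiseDisjoint id) (h' : LowerCover ℬ 𝒞') (hd' : 𝒞'.PairwiseDisjoint id) :
    𝒞 ⊆ 𝒞' := by
  intro C hC
  obtain ⟨D, hD, hCD⟩ := h.le _ (h'.disjointCover hd') C hC
  obtain ⟨E, hE, hDE⟩ := h'.le _ (h.disjointCover hd) D hD
  obtain ⟨p, hp⟩ := (h.isBox C hC).nonempty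
  obtain rfl : C = E := hd.elim_set hC hE p hp (hDE (hCD hp))
  rwa [hCD.antisymm hDE]

theorem LowerCover.unique {ℬ 𝒞 𝒞' : Set (Set (ℝ × ℝ))} (h : LowerCover ℬ 𝒞)
    (hd : 𝒞.PairwiseDisjoint id) (h' : LowerCover ℬ 𝒞') (hd' : 𝒞'.PairwiseDisjoint id) :
    𝒞 = 𝒞' := (h.subset hd h' hd').antisymm (h'.subset hd' h hd)

theorem MergeStep.lowerCover {ℬ 𝒞 𝒟 : Set (Set (ℝ × ℝ))} (h : LowerCover ℬ 𝒞)
    (hs : MergeStep boundingBox 𝒞 𝒟) : LowerCover ℬ 𝒟 := by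
  obtain ⟨A, hA, B, hB, -, hAB, rfl⟩ := hs
  refine h.merge hA hB hAB (Or.inr rfl) (fun C hC => ?_) fun C hC => ?_
  · by_cases h : C = A ∨ C = B
    · exact Or.inr h
    · exact Or.inl (Or.inl ⟨hC, h⟩)
  · exact hC.imp And.left id

theorem IsCover.lowerCover {𝒯 𝒞 : Set (Set (ℝ × ℝ))}
    (h𝒯 : ∀ B ∈ boundingBox '' 𝒯, IsBox B) (h : IsCover boundingBox 𝒯 𝒞) :
    LowerCover (boundingBox '' 𝒯) 𝒞 := by
  obtain ⟨h, -⟩ := h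
  induction h with
  | refl => exact .refl h𝒯
  | tail _ hs ih => exact hs.lowerCover ih

/-- A merge replaces two members by one, so the number of members drops and the process must stop,
whatever `φ` is. -/
theorem exists_reflTransGen_mergeStep (φ : Set (ℝ × ℝ) → Set (ℝ × ℝ)) {𝒞 : Set (Set (ℝ × ℝ))}
    (h𝒞 : 𝒞.Finite) :
    ∃ 𝒟, Relation.ReflTransGen (MergeStep φ) 𝒞 𝒟 ∧ 𝒟.PairwiseDisjoint id := by
  induction hn : 𝒞.ncard using Nat.strong_induction_on generalizing 𝒞 with
  | _ n ih =>
    by_cases hd : 𝒞.PairwiseDisjoint id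
    · exact ⟨𝒞, .refl, hd⟩
    · simp only [Set.PairwiseDisjoint, Set.Pairwise, not_forall, Function.onFun, id,
        Set.not_disjoint_iff_nonempty_inter] at hd
      obtain ⟨A, hA, B, hB, hAB, hne⟩ := hd
      have hsub : ({A, B} : Set (Set (ℝ × ℝ))) ⊆ 𝒞 := by
        rintro C (rfl | rfl) <;> assumption
      have hcard : (𝒞 \ {A, B} ∪ {φ (A ∪ B)}).ncard < n := by
        have h1 := Set.ncard_union_le (𝒞 \ {A, B}) {φ (A ∪ B)}
        have h2 := Set.ncard_sdiff hsub (Set.toFinite _)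
        have h3 := Set.ncard_le_ncard hsub h𝒞
        rw [Set.ncard_pair hAB] at h2 h3
        rw [Set.ncard_singleton] at h1
        omega
      obtain ⟨𝒟, h1, h2⟩ := ih _ hcard (h𝒞.sdiff.union (Set.finite_singleton _)) rfl
      exact ⟨𝒟, .head ⟨A, hA, B, hB, hAB, hne, rfl⟩ h1, h2⟩

/-- A disjoint lower cover is the only possible outcome of the merging process. -/
theorem LowerCover.isCover {𝒯 𝒞 : Set (Set (ℝ × ℝ))} (hfin : 𝒯.Finite)
    (h𝒯 : ∀ B ∈ boundingBox '' 𝒯, IsBox B) (h : LowerCover (boundingBox '' 𝒯) 𝒞)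
    (hd : 𝒞.PairwiseDisjoint id) :
    IsCover boundingBox 𝒯 𝒞 ∧ ∀ 𝒟, IsCover boundingBox 𝒯 𝒟 → 𝒟 = 𝒞 := by
  have huniq : ∀ 𝒟, IsCover boundingBox 𝒯 𝒟 → 𝒟 = 𝒞 := fun 𝒟 h𝒟 =>
    (h𝒟.lowerCover h𝒯).unique h𝒟.2 h hd
  obtain ⟨𝒟, h1, h2⟩ := exists_reflTransGen_mergeStep boundingBox (hfin.image boundingBox)
  obtain rfl := huniq 𝒟 ⟨h1, h2⟩
  exact ⟨⟨h1, h2⟩, huniq⟩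

/-! ### Point sets of geometric trees -/

/-- The point set of a tree is contained in a box as soon as its vertices are. -/
theorem GeomTree.carrier_subset_Icc {S : GeomTree} {a b : ℝ × ℝ} :
    S.carrier ⊆ Set.Icc a b ↔ ∀ v, S.pos v ∈ Set.Icc a b := by
  refine ⟨fun h v => h (Or.inl ⟨v, rfl⟩), fun h => Set.union_subset ?_ (Set.iUnion_subset ?_)⟩
  · rintro _ ⟨v, rfl⟩
    exact h v
  · exact fun e => (convex_Icc a b).segment_subset (h _) (h _)

theorem GeomTree.k_pos (S : GeomTree) : 0 < S.k := by
  have := S.isTree.connected.nonempty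
  exact Fin.pos_iff_nonempty.2 this


/-! ### Memory layout of the program -/

/-- input arrays: number of trees, numbers of vertices -/
notation "aTrees" => 0
notation "aSizes" => 1
/-- tournament tree -/
notation "aWin" => 4
/-- linked stacks: first cell, next cell, content -/
notation "aHead" => 5
notation "aNext" => 6
notation "aItem" => 7
/-- simple variables -/
notation "xLeaf" => 10
notation "xI" => 11
notation "xV" => 12
notation "xC" => 13
notation "xLo" => 14
notation "xHi" => 15
notation "xD" => 16
notation "xFresh" => 17
notation "xCur" => 18
notation "xOff" => 19
notation "xLim" => 20
notation "xCnt" => 21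
notation "xE" => 22
/-- results of sorting: keys by position, positions of keys -/
notation "aYKey" => 30
notation "aYPos" => 31
notation "aXKey" => 32
notation "aXPos" => 33
/-- real arrays: left ends, negated right ends, and lower ends followed by upper ends -/
notation "rLeft" => 4
notation "rRight" => 5
notation "rY" => 6

/-! ### Tournament trees -/

/-- The better one of two players, `0` meaning that there is no player: the one with the smaller
key, and of two players with the same key the one with the smaller number. -/
noncomputable def better (K : ℕ → ℝ) (a b : ℕ) : ℕ :=
  open Classical in if b = 0 ∨ (a ≠ 0 ∧ K a ≤ K b ∧ (a ≤ b ∨ ¬ K b ≤ K a)) then a else b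

/-- `w` is a tournament tree with root `1`; the players sit at the leaves `N, …, 2 * N - 1`. -/
def IsTournament (N : ℕ) (K : ℕ → ℝ) (w : ℕ → ℕ) : Prop :=
  ∀ v, 0 < v → v < N → w v = better K (w (2 * v)) (w (2 * v + 1))

/-- The lexicographic order by key and number. -/
def LexLE (K : ℕ → ℝ) (a b : ℕ) : Prop := K a < K b ∨ K a = K b ∧ a ≤ b

theorem LexLE.key_le {K : ℕ → ℝ} {a b : ℕ} (h : LexLE K a b) : K a ≤ K b :=
  h.elim le_of_lt fun h => h.1.le

theorem LexLE.refl (K : ℕ → ℝ) (a : ℕ) : LexLE K a a := Or.inr ⟨rfl, le_rfl⟩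

theorem LexLE.trans {K : ℕ → ℝ} {a b c : ℕ} (h : LexLE K a b) (h' : LexLE K b c) :
    LexLE K a c := by
  rcases h with h | ⟨h, h1⟩ <;> rcases h' with h' | ⟨h', h1'⟩
  · exact .inl (h.trans h')
  · exact .inl (h'.symm ▸ h)
  · exact .inl (h ▸ h')
  · exact .inr ⟨h.trans h', h1.trans h1'⟩

theorem better_eq_or (K : ℕ → ℝ) (a b : ℕ) : better K a b = a ∨ better K a b = b := by
  unfold better; split_ifs <;> simp

theorem better_eq_zero {K : ℕ → ℝ} {a b : ℕ} (h : better K a b = 0) : a = 0 ∧ b = 0 := by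
  unfold better at h
  split_ifs at h with h' <;> omega

theorem better_le_left {K : ℕ → ℝ} {a : ℕ} (b : ℕ) (ha : a ≠ 0) : LexLE K (better K a b) a := by
  unfold better
  split_ifs with h
  · exact .refl _ _
  · push Not at h
    obtain ⟨hb, h⟩ := h
    by_cases h1 : K a ≤ K b
    · have := h ha h1
      exact .inr ⟨le_antisymm this.2 h1, this.1.le⟩
    · exact .inl (not_le.1 h1)

theorem better_le_right {K : ℕ → ℝ} (a : ℕ) {b : ℕ} (hb : b ≠ 0) : LexLE K (better K a b) b := by
  unfold better
  split_ifs with h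
  · obtain ⟨ha, h1, h2⟩ := h.resolve_left hb
    by_cases h3 : K b ≤ K a
    · exact .inr ⟨le_antisymm h1 h3, h2.resolve_right (not_not.2 h3)⟩
    · exact .inl (not_le.1 h3)
  · exact .refl _ _

/-- The key of the absent player `0` never influences the outcome. -/
theorem better_congr {K K' : ℕ → ℝ} {a b : ℕ} (ha : a ≠ 0 → K a = K' a) (hb : b ≠ 0 → K b = K' b) :
    better K a b = better K' a b := by
  unfold better
  by_cases ha' : a = 0
  · simp [ha']
  by_cases hb' : b = 0
  · simp [hb']
  rw [ha ha', hb hb']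

theorem IsTournament.congr {N : ℕ} {K K' : ℕ → ℝ} {w : ℕ → ℕ} (h : IsTournament N K w)
    (hK : ∀ v, 0 < v → v < 2 * N → w v ≠ 0 → K (w v) = K' (w v)) : IsTournament N K' w :=
  fun v h1 h2 => (h v h1 h2).trans
    (better_congr (hK _ (by omega) (by omega)) (hK _ (by omega) (by omega)))

/-- A player is not better than the winner of a subtree to which it belongs. -/
theorem IsTournament.le {N : ℕ} {K : ℕ → ℝ} {w : ℕ → ℕ} (h : IsTournament N K w) {u : ℕ}
    (hu : u < 2 * N) (hw : w u ≠ 0) (k : ℕ) (hk : 0 < u / 2 ^ k) :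
    w (u / 2 ^ k) ≠ 0 ∧ LexLE K (w (u / 2 ^ k)) (w u) := by
  induction k with
  | zero => simpa using ⟨hw, LexLE.refl _ _⟩
  | succ k ih =>
    rw [pow_succ, ← Nat.div_div_eq_div_mul] at hk ⊢
    obtain ⟨h1, h2⟩ := ih (by omega)
    have hle : u / 2 ^ k ≤ u := Nat.div_le_self _ _
    have hv := h (u / 2 ^ k / 2) hk (by omega)
    rcases Nat.even_or_odd' (u / 2 ^ k) with ⟨c, hc | hc⟩
    · have hc2 : u / 2 ^ k / 2 = c := by omega
      rw [hc2] at hv ⊢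
      rw [hc] at h1 h2
      exact ⟨fun h0 => h1 (better_eq_zero (hv ▸ h0)).1, hv ▸ (better_le_left _ h1).trans h2⟩
    · have hc2 : u / 2 ^ k / 2 = c := by omega
      rw [hc2] at hv ⊢
      rw [hc] at h1 h2
      exact ⟨fun h0 => h1 (better_eq_zero (hv ▸ h0)).2, hv ▸ (better_le_right _ h1).trans h2⟩

/-- The winner of a subtree sits at one of its leaves. -/
theorem IsTournament.exists_leaf {N : ℕ} {K : ℕ → ℝ} {w : ℕ → ℕ} (h : IsTournament N K w) {v : ℕ}
    (hv : 0 < v) (hv' : v < 2 * N) (hw : w v ≠ 0) :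
    ∃ p < N, ∃ k, (N + p) / 2 ^ k = v ∧ w (N + p) = w v := by
  -- The children `2 * v` and `2 * v + 1` have larger numbers than `v`, so the induction descends
  -- towards the leaves.
  induction hn : 2 * N - v using Nat.strong_induction_on generalizing v with
  | _ n ih =>
    by_cases hvN : v < N
    · have hvw := h v hv hvN
      rcases better_eq_or K (w (2 * v)) (w (2 * v + 1)) with h1 | h1
      · rw [h1] at hvw
        obtain ⟨p, hp, k, hk, hpw⟩ := ih _ (by omega) (v := 2 * v) (by omega) (by omega)
          (by omega) rfl
        refine ⟨p, hp, k + 1, ?_, by omega⟩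
        rw [pow_succ, ← Nat.div_div_eq_div_mul, hk]
        omega
      · rw [h1] at hvw
        obtain ⟨p, hp, k, hk, hpw⟩ := ih _ (by omega) (v := 2 * v + 1) (by omega) (by omega)
          (by omega) rfl
        refine ⟨p, hp, k + 1, ?_, by omega⟩
        rw [pow_succ, ← Nat.div_div_eq_div_mul, hk]
        omega
    · exact ⟨v - N, by omega, 0, by simp; omega, by congr 1; omega⟩

/-! ### Changing a leaf of a tournament tree -/

namespace RealRAM

/-- Move the variable `xV` to its parent and play the match there. -/
def playParent (key : ℕ) : Prog :=
  .set xV (.half (.var xV)) ;;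
  .set xC (.load aWin (.add (.var xV) (.var xV))) ;;
  .set xE (.load aWin (.add (.add (.var xV) (.var xV)) (.const 1))) ;;
  .ite (.or (.natEq (.var xE) (.const 0)) (.and (.not (.natEq (.var xC) (.const 0)))
      (.and (.realLe (.load key (.var xC)) (.load key (.var xE)))
        (.or (.natLe (.var xC) (.var xE))
          (.not (.realLe (.load key (.var xE)) (.load key (.var xC))))))))
    (.setNat aWin (.var xV) (.var xC)) (.setNat aWin (.var xV) (.var xE))

theorem run_playParent (key : ℕ) (s : State) :
    ((playParent key).run s).nat xV 0 = s.nat xV 0 / 2 ∧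
    ((playParent key).run s).nat aWin = Function.update (s.nat aWin) (s.nat xV 0 / 2)
      (better (s.real key) (s.nat aWin (2 * (s.nat xV 0 / 2)))
        (s.nat aWin (2 * (s.nat xV 0 / 2) + 1))) := by
  simp only [playParent, better, two_mul]
  generalize hv : s.nat xV 0 / 2 = v
  generalize ha : s.nat aWin (v + v) = a
  generalize hb : s.nat aWin (v + v + 1) = b
  by_cases h : b = 0 ∨ (a ≠ 0 ∧ s.real key a ≤ s.real key b ∧
      (a ≤ b ∨ ¬ s.real key b ≤ s.real key a))
  · rw [if_pos h]
    simp only [Prog.run]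
    rw [if_pos (by simpa [hv, ha, hb] using h)]
    simp [hv, ha]
  · rw [if_neg h]
    simp only [Prog.run]
    rw [if_neg (by simpa [hv, ha, hb] using h)]
    simp [hv, hb]

/-- Put the player `xC` on the leaf `xV` of the tournament tree with keys in the real array `key`.
-/
def updateTree (key : ℕ) : Prog :=
  .setNat aWin (.var xV) (.var xC) ;;
  .while (.natLe (.const 2) (.var xV)) (playParent key)

@[simp] theorem natWrites_updateTree (key : ℕ) :
    (updateTree key).natWrites = [aWin, xV, xC, xE, aWin, aWin] := rfl

@[simp] theorem realWrites_updateTree (key : ℕ) : (updateTree key).realWrites = [] := rfl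

/-- During the walk to the root only the proper ancestors of the current node can have a wrong
winner. The leaf number is below `2 * N ≤ 2 ^ b` and is halved in each round, which bounds the
rounds by `b`; `N` need not be a power of two. -/
theorem runs_updateTree {key N b : ℕ} {s : State} (hT : IsTournament N (s.real key) (s.nat aWin))
    (hv : N ≤ s.nat xV 0) (hv' : s.nat xV 0 < 2 * N) (hb : 2 * N ≤ 2 ^ b) :
    Runs (updateTree key) s (200 * b + 20) fun s' _ =>
      IsTournament N (s.real key) (s'.nat aWin) ∧
      ∀ u, N ≤ u → s'.nat aWin u = Function.update (s.nat aWin) (s.nat xV 0) (s.nat xC 0) u := by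
  unfold updateTree
  refine Runs.seq (R := fun s' k => s' = s.putNat aWin (s.nat xV 0) (s.nat xC 0) ∧ k = 200 * b + 10)
    (.loopFree (k := 200 * b + 10) (by simp) (by simp; omega) (by simp)) ?_
  rintro s₁ _ - ⟨rfl, rfl⟩
  refine Runs.while
    (fun s' k => ∃ c, s'.nat xV 0 < 2 ^ c ∧ k = 200 * c + 10 ∧ s'.nat xV 0 < 2 * N ∧ 0 < s'.nat xV 0
    ∧
      (∀ u, 0 < u → u < N → (∀ i, u ≠ s'.nat xV 0 / 2 ^ (i + 1)) →
        s'.nat aWin u = better (s.real key) (s'.nat aWin (2 * u)) (s'.nat aWin (2 * u + 1))) ∧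
      ∀ u, N ≤ u → s'.nat aWin u = Function.update (s.nat aWin) (s.nat xV 0) (s.nat xC 0) u)
    ?_ ?_
  · rintro s' _ hf ⟨c, hc, rfl, hN, h0, hT, hL⟩
    have hkey : s'.real key = s.real key := (hf.real key (by simp [playParent])).trans rfl
    refine ⟨200 * c, by simp, fun hb => ?_, fun hb => ⟨fun v hv hvN => hT v hv hvN fun i hi => ?_,
        hL⟩⟩
    · simp only [Test.holds, NExp.eval, NExp.eval_var] at hb
      obtain ⟨c, rfl⟩ : ∃ d, c = d + 1 := by
        cases c with
        | zero => simp at hc; omega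
        | succ d => exact ⟨d, rfl⟩
      obtain ⟨hrV, hrW⟩ := run_playParent key s'
      refine .loopFree (k := 200 * c + 10) (by simp [playParent]) (by simp [playParent]; omega) ?_
      rw [hkey] at hrW
      set v := s'.nat xV 0 with hvdef
      refine ⟨c, ?_⟩
      rw [hrV, hrW]
      refine ⟨by rw [pow_succ] at hc; omega, rfl, by omega, by omega, fun u hu0 huN hu => ?_,
        fun u hu => ?_⟩
      · by_cases huv : u = v / 2
        · subst huv
          rw [Function.update_self, Function.update_of_ne (by omega), Function.update_of_ne
              (by omega)]
        -- By `h1` the node `u` is not the parent of `v / 2`, so the match at `v / 2` does not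
        -- change a child of `u`.
        · have h1 := hu 0
          rw [pow_one] at h1
          rw [Function.update_of_ne huv, Function.update_of_ne (by omega),
            Function.update_of_ne (by omega)]
          refine hT u hu0 huN fun i => ?_
          cases i with
          | zero => simpa using huv
          | succ i =>
            rw [pow_succ', ← Nat.div_div_eq_div_mul]
            exact hu i
      · rw [Function.update_of_ne (by omega)]
        exact hL u hu
    · simp only [Test.holds, NExp.eval, NExp.eval_var, not_le] at hb
      have h1 : s'.nat xV 0 = 1 := by omega
      -- At the root the exempted nodes `1 / 2 ^ (i + 1)` are all `0`, which is not a node of the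
      -- tree: no exception is left.
      rw [h1, Nat.div_eq_of_lt (Nat.one_lt_two_pow (by omega))] at hi
      omega
  · refine ⟨b, by simp; omega, rfl, by simpa using hv', by simp; omega, fun u hu0 huN hu => ?_,
      fun u hu => by simp⟩
    have h1 := hu 0
    simp only [State.putNat_nat] at h1 hu ⊢
    norm_num at h1 hu ⊢
    rw [Function.update_of_ne (by omega), Function.update_of_ne (by omega),
      Function.update_of_ne (by omega)]
    exact hT u hu0 huN

end RealRAM


/-! ### Sorting with a tournament tree -/

/-- `P` lists the numbers `1, …, c` in the order of their keys, and `J` gives the positions in this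
list. -/
structure IsSorting (K : ℕ → ℝ) (c : ℕ) (P J : ℕ → ℕ) : Prop where
  pos : ∀ x, 1 ≤ x → x ≤ c → J x < c ∧ P (J x) = x
  key : ∀ p < c, 1 ≤ P p ∧ P p ≤ c ∧ J (P p) = p
  lexLE : ∀ p q, p ≤ q → q < c → LexLE K (P p) (P q)

theorem exists_div_two_pow_eq_one {u : ℕ} (hu : 0 < u) : ∃ k, u / 2 ^ k = 1 := by
  refine ⟨Nat.log 2 u, Nat.div_eq_of_lt_le ?_ ?_⟩
  · simpa using Nat.pow_log_le_self 2 hu.ne'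
  · have := Nat.lt_pow_succ_log_self (b := 2) one_lt_two u
    rw [pow_succ] at this
    omega

/-- At most `c` different numbers have been listed. -/
theorem le_of_injection {i c : ℕ} {P J : ℕ → ℕ} (h : ∀ q < i, 1 ≤ P q ∧ P q ≤ c ∧ J (P q) = q) :
    i ≤ c := by
  have := Finset.card_le_card_of_injOn (s := Finset.range i) (t := Finset.Icc 1 c) P
    (fun q hq => by
      have := h q (by simpa using hq)
      simp; omega)
    (fun q hq r hr hqr => by
      rw [← (h q (by simpa using hq)).2.2, ← (h r (by simpa using hr)).2.2, hqr])
  simpa using this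

/-! ### The sorting program -/

namespace RealRAM

/-- Sort the numbers `1, …, xCnt` by their keys in the real array `key`. The result is stored in
the arrays `P` and `J`. -/
def sortKeys (key P J : ℕ) : Prog :=
  .set xI (.const 1) ;;
  .while (.natLe (.var xI) (.var xCnt))
    ((.set xV (.add (.var xLeaf) (.var xI)) ;; .set xC (.var xI)) ;; updateTree key ;;
      .set xI (.add (.var xI) (.const 1))) ;;
  .set xI (.const 0) ;;
  .while (.not (.natEq (.load aWin (.const 1)) (.const 0)))
    ((.set xD (.load aWin (.const 1)) ;; .setNat P (.var xI) (.var xD) ;;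
      .setNat J (.var xD) (.var xI) ;; .set xV (.add (.var xLeaf) (.var xD)) ;;
      .set xC (.const 0)) ;; updateTree key ;; .set xI (.add (.var xI) (.const 1)))

@[simp] theorem natWrites_sortKeys (key P J : ℕ) : (sortKeys key P J).natWrites =
    [xI, xV, xC, aWin, xV, xC, xE, aWin, aWin, xI, xI, xD, P, J, xV, xC, aWin, xV, xC, xE, aWin,
      aWin, xI] := rfl

@[simp] theorem realWrites_sortKeys (key P J : ℕ) : (sortKeys key P J).realWrites = [] := rfl

/-- The state of the array of leaves after the first `i - 1` numbers have been inserted. -/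
def LeavesBelow (N i : ℕ) (w : ℕ → ℕ) : Prop :=
  ∀ u, N ≤ u → w u = if u - N < i then u - N else 0

theorem runs_sortKeys_fill {key N b c : ℕ} {s : State} (hw : ∀ u, 0 < u → s.nat aWin u = 0)
    (hN : s.nat xLeaf 0 = N) (hc : s.nat xCnt 0 = c) (hcN : c < N) (hb : 2 * N ≤ 2 ^ b)
    (hI : s.nat xI 0 = 1) :
    Runs (.while (.natLe (.var xI) (.var xCnt))
      ((.set xV (.add (.var xLeaf) (.var xI)) ;; .set xC (.var xI)) ;; updateTree key ;;
        .set xI (.add (.var xI) (.const 1)))) s ((200 * b + 60) * c + 10) fun s' _ =>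
      IsTournament N (s.real key) (s'.nat aWin) ∧ LeavesBelow N (c + 1) (s'.nat aWin) := by
  refine Runs.while (fun s' k => ∃ i, s'.nat xI 0 = i + 1 ∧ i ≤ c ∧
    k = (200 * b + 60) * (c - i) + 10 ∧
    IsTournament N (s.real key) (s'.nat aWin) ∧ LeavesBelow N (i + 1) (s'.nat aWin)) ?_ ?_
  · rintro s' _ hf ⟨i, hi, hic, rfl, hT, hL⟩
    have hkey : s'.real key = s.real key := hf.real key (by simp)
    have hN' : s'.nat xLeaf 0 = N := by rw [hf.nat xLeaf (by simp), hN]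
    have hc' : s'.nat xCnt 0 = c := by rw [hf.nat xCnt (by simp), hc]
    refine ⟨(200 * b + 60) * (c - i), by simp, fun h => ?_, fun h => ?_⟩
    · simp only [Test.holds, NExp.eval_var, hi, hc'] at h
      obtain ⟨d, hd⟩ : ∃ d, c - i = d + 1 := ⟨c - i - 1, by omega⟩
      rw [hd]
      refine .step (by simp) (k := 200 * b + 20 + ((200 * b + 60) * d + 20))
        (by simp ; linarith) fun t₁ hf₁ ht₁ => ?_
      refine .call (runs_updateTree (N := N) (b := b) ?_ ?_ ?_ hb) le_rfl fun t₂ hf₂ ht₂ => ?_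
      · simpa [ht₁, hkey] using hT
      · simp [ht₁, hN']
      · simp [ht₁, hN', hi]; omega
      refine .loopFree (by simp) (k := (200 * b + 60) * d + 10) (by simp ; omega) ⟨i + 1, ?_⟩
      have hi₂ : t₂.nat xI 0 = i + 1 := by rw [hf₂.nat xI (by simp), hf₁.nat xI (by simp), hi]
      refine ⟨by simp [hi₂], by omega, by rw [show c - (i + 1) = d by omega], ?_, fun u hu => ?_⟩
      · simpa [ht₁, hkey] using ht₂.1
      · have h1 := ht₂.2 u hu
        have := hL u hu
        simp [ht₁, hi, hN', Function.update_apply] at this h1 ⊢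
        rw [h1]
        split_ifs at this ⊢ <;> omega
    · simp only [Test.holds, NExp.eval_var, hi, hc'] at h
      obtain rfl : i = c := by omega
      exact ⟨hT, hL⟩
  · refine ⟨0, hI, Nat.zero_le _, rfl, fun v hv _ => ?_, fun u hu => ?_⟩
    · rw [hw v hv, hw _ (by omega), hw _ (by omega)]; simp [better]
    · rw [hw u (by omega)]; split_ifs <;> omega

/-- The state of the sorting procedure after `i` numbers have been listed. -/
structure Extracted (K : ℕ → ℝ) (N c i : ℕ) (w P J : ℕ → ℕ) : Prop where
  tournament : IsTournament N K w
  leaf : ∀ u, N ≤ u → w u = 0 ∨ (w u = u - N ∧ 1 ≤ u - N ∧ u - N ≤ c)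
  listed : ∀ q < i, 1 ≤ P q ∧ P q ≤ c ∧ J (P q) = q
  gone : ∀ q < i, w (N + P q) = 0
  pos : ∀ x, 1 ≤ x → x ≤ c → w (N + x) = 0 → J x < i ∧ P (J x) = x
  lexLE : ∀ p q, p ≤ q → q < i → LexLE K (P p) (P q)
  lexLE' : ∀ q x, q < i → w (N + x) ≠ 0 → LexLE K (P q) x

/-- The overall winner comes from a leaf, and a nonempty leaf `N + y` can only hold `y`. Every other
remaining number is a leaf below the root, hence not smaller. -/
theorem Extracted.root {K : ℕ → ℝ} {N c i : ℕ} {w P J : ℕ → ℕ} (h : Extracted K N c i w P J)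
    (hcN : c < N) (hw : w 1 ≠ 0) : 1 ≤ w 1 ∧ w 1 ≤ c ∧ w (N + w 1) = w 1 ∧
      ∀ y, w (N + y) ≠ 0 → LexLE K (w 1) y := by
  obtain ⟨p, hp, k, -, hpw⟩ := h.tournament.exists_leaf one_pos (by omega) hw
  obtain ⟨h1, h2, h3⟩ := (h.leaf (N + p) (by omega)).resolve_left (by omega)
  rw [Nat.add_sub_cancel_left] at h1 h2 h3
  refine ⟨by omega, by omega, by rw [← hpw, h1, h1], fun y hy => ?_⟩
  obtain ⟨h4, h5, h6⟩ := (h.leaf (N + y) (by omega)).resolve_left hy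
  obtain ⟨k, hk⟩ := exists_div_two_pow_eq_one (u := N + y) (by omega)
  have := (h.tournament.le (u := N + y) (by omega) hy k (by omega)).2
  rw [hk, h4, Nat.add_sub_cancel_left] at this
  exact this

theorem Extracted.ne_root {K : ℕ → ℝ} {N c i : ℕ} {w P J : ℕ → ℕ} (h : Extracted K N c i w P J)
    (hcN : c < N) (hw : w 1 ≠ 0) : ∀ q < i, P q ≠ w 1 := fun q hq hqw => by
  obtain ⟨h1, h2, h3, h4⟩ := h.root hcN hw
  have := h.gone q hq
  rw [hqw] at this
  omega

theorem Extracted.listed_succ {K : ℕ → ℝ} {N c i : ℕ} {w P J : ℕ → ℕ}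
    (h : Extracted K N c i w P J) (hcN : c < N) (hw : w 1 ≠ 0) : ∀ q < i + 1,
      1 ≤ Function.update P i (w 1) q ∧ Function.update P i (w 1) q ≤ c ∧
      Function.update J (w 1) i (Function.update P i (w 1) q) = q := fun q hq => by
  obtain ⟨h1, h2, h3, h4⟩ := h.root hcN hw
  rcases Nat.lt_succ_iff_lt_or_eq.1 hq with hq | rfl
  · rw [Function.update_of_ne hq.ne, Function.update_of_ne (h.ne_root hcN hw q hq)]
    exact h.listed q hq
  · simp [h1, h2]

theorem Extracted.step {K : ℕ → ℝ} {N c i : ℕ} {w w' P J : ℕ → ℕ} (h : Extracted K N c i w P J)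
    (hcN : c < N) (hw : w 1 ≠ 0) (hT : IsTournament N K w')
    (hw' : ∀ u, N ≤ u → w' u = Function.update w (N + w 1) 0 u) :
    Extracted K N c (i + 1) w' (Function.update P i (w 1)) (Function.update J (w 1) i) := by
  obtain ⟨h1, h2, h3, h4⟩ := h.root hcN hw
  refine ⟨hT, fun u hu => ?_, h.listed_succ hcN hw, fun q hq => ?_, fun x hx hxc hxw => ?_,
    fun p q hpq hq => ?_, fun q x hq hx => ?_⟩
  · rw [hw' u hu, Function.update_apply]
    split_ifs
    · exact .inl rfl
    · exact h.leaf u hu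
  · rw [hw' _ (by omega), Function.update_apply]
    split_ifs with h5
    · rfl
    · rcases Nat.lt_succ_iff_lt_or_eq.1 hq with hq | rfl
      · rw [Function.update_of_ne hq.ne]
        exact h.gone q hq
      · simp at h5
  · by_cases hxw1 : x = w 1
    · subst hxw1; simp
    · rw [hw' _ (by omega), Function.update_of_ne (by omega)] at hxw
      obtain ⟨h5, h6⟩ := h.pos x hx hxc hxw
      rw [Function.update_of_ne hxw1, Function.update_of_ne h5.ne]
      exact ⟨by omega, h6⟩
  · rcases Nat.lt_succ_iff_lt_or_eq.1 hq with hq | rfl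
    · rw [Function.update_of_ne (by omega), Function.update_of_ne (by omega)]
      exact h.lexLE p q hpq hq
    · rw [Function.update_self]
      rcases hpq.lt_or_eq with hpq | rfl
      · rw [Function.update_of_ne hpq.ne]
        exact h.lexLE' p _ hpq (by omega)
      · rw [Function.update_self]; exact .refl _ _
  · rw [hw' _ (by omega), Function.update_apply] at hx
    split_ifs at hx
    · exact absurd rfl hx
    rcases Nat.lt_succ_iff_lt_or_eq.1 hq with hq | rfl
    · rw [Function.update_of_ne hq.ne]
      exact h.lexLE' q x hq hx
    · rw [Function.update_self]
      exact h4 x hx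

/-- If the root is empty, then so are all leaves, so every number from `1` to `c` has been listed.
Counting with the two mutually inverse maps gives `i = c`. -/
theorem Extracted.isSorting {K : ℕ → ℝ} {N c i : ℕ} {w P J : ℕ → ℕ} (h : Extracted K N c i w P J)
    (hcN : c < N) (hw : w 1 = 0) : (∀ u, 0 < u → w u = 0) ∧ IsSorting K c P J := by
  have h0 : ∀ u, N ≤ u → w u = 0 := fun u hu => by
    by_contra hne
    have := h.leaf u hu
    obtain ⟨k, hk⟩ := exists_div_two_pow_eq_one (u := u) (by omega)
    have := (h.tournament.le (u := u) (by omega) hne k (by omega)).1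
    rw [hk] at this
    exact this hw
  have hpos := fun x hx hxc => h.pos x hx hxc (h0 _ (by omega))
  -- Numbers start at `1` and positions at `0`, so both maps are shifted to fit `le_of_injection`
  -- with their roles exchanged.
  have hci : c ≤ i := le_of_injection (i := c) (c := i) (P := fun q => J (q + 1) + 1)
    (J := fun q => P (q - 1) - 1) fun q hq => by
      have := hpos (q + 1) (by omega) (by omega)
      simp; omega
  obtain rfl : i = c := (le_of_injection h.listed).antisymm hci
  refine ⟨fun u hu => ?_, hpos, h.listed, h.lexLE⟩
  by_cases huN : N ≤ u
  · exact h0 u huN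
  · by_contra hne
    obtain ⟨p, hp, k, -, hpw⟩ := h.tournament.exists_leaf hu (by omega) hne
    rw [h0 _ (by omega)] at hpw
    exact hne hpw.symm

/-- The first loop enters all numbers into an empty tournament tree, the second extracts the winner
until the tree is empty again. The same array can therefore be reused for the next sort and for the
sweep. The bounds `30 ≤ P` and `30 ≤ J` keep the results apart from the working memory. -/
theorem runs_sortKeys {key P J N b c : ℕ} {s : State} (hP : 30 ≤ P) (hJ : 30 ≤ J) (hPJ : P ≠ J)
    (hw : ∀ u, 0 < u → s.nat aWin u = 0)
    (hN : s.nat xLeaf 0 = N) (hc : s.nat xCnt 0 = c) (hcN : c < N) (hb : 2 * N ≤ 2 ^ b) :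
    Runs (sortKeys key P J) s ((400 * b + 160) * c + 40) fun s' _ =>
      (∀ u, 0 < u → s'.nat aWin u = 0) ∧
      IsSorting (s.real key) c (s'.nat P) (s'.nat J) := by
  unfold sortKeys
  refine .step (by simp) (k := (200 * b + 60) * c + 10 + ((200 * b + 100) * c + 25))
    (by simp ; linarith) fun s₁ hf₁ hs₁ => ?_
  refine .call (runs_sortKeys_fill (key := key) (N := N) (b := b) (c := c) (by simpa [hs₁] using hw)
    (by simpa [hs₁] using hN) (by simpa [hs₁] using hc) hcN hb (by simp [hs₁])) le_rfl
    fun s₂ hf₂ hs₂ => ?_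
  refine .step (by simp) (k := (200 * b + 100) * c + 22) (by simp ; omega) fun s₃ hf₃ hs₃ => ?_
  have hK : s₃.real key = s.real key := by
    rw [hf₃.real key (by simp), hf₂.real key (by simp), hf₁.real key (by simp)]
  have hN : s₃.nat xLeaf 0 = N := by
    rw [hf₃.nat xLeaf (by simp), hf₂.nat xLeaf (by simp), hf₁.nat xLeaf (by simp), hN]
  have hT : IsTournament N (s.real key) (s₃.nat aWin) := by simpa [hs₃, hs₁] using hs₂.1
  have hL : LeavesBelow N (c + 1) (s₃.nat aWin) := by simpa [hs₃, hs₁] using hs₂.2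
  refine Runs.while (fun t k => ∃ i, t.nat xI 0 = i ∧ k = (200 * b + 100) * (c - i) + 22 ∧
    Extracted (s.real key) N c i (t.nat aWin) (t.nat P) (t.nat J)) ?_ ?_
  · rintro t _ hf ⟨i, hi, rfl, hE⟩
    have hkey : t.real key = s.real key := by rw [hf.real key (by simp)]; simpa using hK
    have hN' : t.nat xLeaf 0 = N := by
      rw [hf.nat xLeaf (by simp; omega)]; simpa using hN
    refine ⟨(200 * b + 100) * (c - i) + 7, by simp, fun h => ?_, fun h => ?_⟩
    · simp only [Test.holds, Test.holds_natEq, NExp.eval] at h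
      obtain ⟨h1, h2, h3, h4⟩ := hE.root hcN h
      -- Together with the current winner, `i + 1` different numbers between `1` and `c` have been
      -- listed. This bounds the number of rounds.
      have hic : i < c := le_of_injection (hE.listed_succ hcN h)
      obtain ⟨d, hd⟩ : ∃ d, c - i = d + 1 := ⟨c - i - 1, by omega⟩
      rw [hd]
      refine .step (by simp) (k := 200 * b + 20 + ((200 * b + 100) * d + 30))
        (by simp ; linarith) fun t₁ hf₁ ht₁ => ?_
      refine .call (runs_updateTree (N := N) (b := b) ?_ ?_ ?_ hb) le_rfl fun t₂ hf₂ ht₂ => ?_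
      · rw [ht₁]
        simpa [hkey, Ne.symm, show ¬ 4 = P by omega, show ¬ 4 = J by omega] using hE.tournament
      · simp [ht₁, hN', show ¬ 10 = P by omega, show ¬ 10 = J by omega]
      · simp [ht₁, hN', show ¬ 10 = P by omega, show ¬ 10 = J by omega, show ¬ 16 = P by omega, show
          ¬ 16 = J by omega]
        omega
      refine .loopFree (by simp) (k := (200 * b + 100) * d + 22) (by simp ; omega) ⟨i + 1, ?_⟩
      have hi₂ : t₂.nat xI 0 = i := by
        rw [hf₂.nat xI (by simp), hf₁.nat xI (by simp; omega), hi]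
      refine ⟨by simp [hi₂], by rw [show c - (i + 1) = d by omega], ?_⟩
      convert hE.step (w' := t₂.nat aWin) hcN h ?_ fun u hu => ?_ using 1
      · simp
      · simp [show P ≠ 11 by omega, hf₂.nat P (by simp; omega), ht₁, hi, hPJ,
          show P ≠ 12 by omega, show P ≠ 13 by omega, show P ≠ 16 by omega]
      · simp [show J ≠ 11 by omega, hf₂.nat J (by simp; omega), ht₁, hi, hPJ.symm,
          show J ≠ 12 by omega, show J ≠ 13 by omega, show J ≠ 16 by omega]
        simp [show 11 ≠ P by omega, show 16 ≠ P by omega, hi]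
      · have := ht₂.1
        rw [ht₁] at this
        simpa [hkey] using this
      · rw [ht₂.2 u hu, ht₁]
        simp [hN', show ¬ 10 = P by omega, show ¬ 10 = J by omega, show ¬ 16 = P by omega,
          show ¬ 16 = J by omega, show ¬ 4 = P by omega, show ¬ 4 = J by omega]
    · simp only [Test.holds, Test.holds_natEq, NExp.eval, not_not] at h
      exact hE.isSorting hcN h
  · refine ⟨0, by simp [hs₃], rfl, hT, fun u hu => ?_, by simp, by simp, fun x hx hxc h => ?_,
      by simp, by simp⟩
    · have := hL u hu
      split_ifs at this <;> omega
    · have := hL (N + x) (by omega)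
      simp only [Nat.add_sub_cancel_left] at this
      split_ifs at this <;> omega

end RealRAM


/-! ### Canonical decomposition of intervals -/

/-- The canonical nodes of a binary tree that decompose the interval `lo, …, hi - 1` of leaves. -/
def canon (lo hi : ℕ) : List ℕ :=
  if lo < hi then
    (if lo % 2 = 1 then [lo] else []) ++ ((if hi % 2 = 1 then [hi - 1] else []) ++
      canon ((lo + 1) / 2) (hi / 2))
  else []
termination_by hi

/-- An odd `lo` is a right child whose sibling is outside the interval, and for odd `hi` the node
`hi - 1` is a left child whose sibling is outside; these two are canonical. The parent of any other
node of the interval lies in the halved interval. -/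
theorem exists_mem_canon {lo hi x : ℕ} (h : lo ≤ x) (h' : x < hi) : ∃ k, x / 2 ^ k ∈ canon lo hi :=
    by
  induction hi using Nat.strong_induction_on generalizing lo x with
  | _ hi ih =>
    rw [canon, if_pos (by omega)]
    by_cases h1 : lo % 2 = 1 ∧ x = lo
    · exact ⟨0, by simp [h1]⟩
    by_cases h2 : hi % 2 = 1 ∧ x = hi - 1
    · exact ⟨0, by simp [h2]⟩
    obtain ⟨k, hk⟩ := ih (hi / 2) (by omega) (lo := (lo + 1) / 2) (x := x / 2) (by omega) (by omega)
    refine ⟨k + 1, ?_⟩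
    rw [pow_succ', ← Nat.div_div_eq_div_mul]
    simp [hk]

/-- The node `v` lies above leaves from `lo, …, hi - 1` only, all at the same depth. -/
def Spans (lo hi v : ℕ) : Prop := ∃ k, lo ≤ v * 2 ^ k ∧ (v + 1) * 2 ^ k ≤ hi

theorem Spans.of_half {lo hi v : ℕ} (h : Spans ((lo + 1) / 2) (hi / 2) v) : Spans lo hi v := by
  obtain ⟨k, h1, h2⟩ := h
  exact ⟨k + 1, by rw [pow_succ, ← mul_assoc]; omega, by rw [pow_succ, ← mul_assoc]; omega⟩

theorem spans_of_mem_canon {lo hi v : ℕ} (h : v ∈ canon lo hi) : Spans lo hi v := by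
  induction hi using Nat.strong_induction_on generalizing lo with
  | _ hi ih =>
    rw [canon] at h
    split_ifs at h with h1 h2 h3 h3
    all_goals simp only [List.mem_append, List.mem_singleton, List.not_mem_nil, false_or] at h
    · rcases h with rfl | rfl | h
      · exact ⟨0, by omega, by omega⟩
      · exact ⟨0, by omega, by omega⟩
      · exact (ih _ (by omega) h).of_half
    · rcases h with rfl | h
      · exact ⟨0, by omega, by omega⟩
      · exact (ih _ (by omega) h).of_half
    · rcases h with rfl | h
      · exact ⟨0, by omega, by omega⟩
      · exact (ih _ (by omega) h).of_half
    · exact (ih _ (by omega) h).of_half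

/-- Each level contributes at most one node at either end. -/
theorem length_canon_le {lo hi k : ℕ} (h : hi < 2 ^ k) : (canon lo hi).length ≤ 2 * k := by
  induction k generalizing lo hi with
  | zero => rw [canon, if_neg (by simp at h; omega)]; simp
  | succ k ih =>
    rw [canon]
    split_ifs
    all_goals
      have := ih (lo := (lo + 1) / 2) (hi := hi / 2) (by rw [pow_succ] at h; omega)
      simp
      try omega

/-- Leaves may lie at two different depths, as `N` is not a power of two. But all of them have
numbers in `[N, 2 * N)`, an interval too short to contain descendants of `v` at two different depths
when all descendants at one of them are leaves. This forces `j = k`. -/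
theorem Spans.le_of_div {N a b q k v : ℕ} (h : Spans (N + a) (N + b + 1) v) (hb : b < N)
    (hq : q < N)
    (hv : (N + q) / 2 ^ k = v) : a ≤ q ∧ q ≤ b := by
  obtain ⟨j, h1, h2⟩ := h
  have h3 : v * 2 ^ k ≤ N + q := by rw [← hv]; exact Nat.div_mul_le_self _ _
  have h4 : N + q < (v + 1) * 2 ^ k := by
    rw [← hv, mul_comm]; exact Nat.lt_mul_div_succ _ (by positivity)
  rcases lt_trichotomy j k with hjk | rfl | hjk
  · have : v * 2 ^ (j + 1) ≤ v * 2 ^ k := by gcongr <;> omega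
    rw [pow_succ, ← mul_assoc] at this
    omega
  · omega
  · have : (v + 1) * 2 ^ (k + 1) ≤ (v + 1) * 2 ^ j := by gcongr <;> omega
    rw [pow_succ, ← mul_assoc] at this
    omega

theorem Spans.exists_leaf {N a b v : ℕ} (h : Spans (N + a) (N + b + 1) v) (hb : b < N) :
    ∃ q < N, ∃ k, (N + q) / 2 ^ k = v := by
  obtain ⟨j, h1, h2⟩ := h
  rw [add_mul, one_mul] at h2
  have : 0 < 2 ^ j := by positivity
  refine ⟨v * 2 ^ j - N, by omega, j, ?_⟩
  rw [show N + (v * 2 ^ j - N) = v * 2 ^ j by omega]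
  exact Nat.mul_div_cancel _ this

/-- A leaf below the common node belongs to both intervals. This is what makes boxes on the same
stack comparable. -/
theorem Spans.overlap {N a b c d v : ℕ} (h : Spans (N + a) (N + b + 1) v)
    (h' : Spans (N + c) (N + d + 1) v) (hb : b < N) (hd : d < N) : a ≤ d ∧ c ≤ b := by
  obtain ⟨q, hq, k, hk⟩ := h.exists_leaf hb
  have h1 := h.le_of_div hb hq hk
  have h2 := h'.le_of_div hd hq hk
  omega

theorem Spans.pos {N a b v : ℕ} (h : Spans (N + a) (N + b + 1) v) (hb : b < N) :
    0 < v ∧ v < 2 * N := by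
  obtain ⟨j, h1, h2⟩ := h
  rw [add_mul, one_mul] at h2
  have : 0 < 2 ^ j := by positivity
  have h3 : v ≤ v * 2 ^ j := Nat.le_mul_of_pos_right _ this
  refine ⟨Nat.pos_of_ne_zero ?_, by omega⟩
  rintro rfl
  omega

/-! ### Linked stacks -/

/-- The linked list that starts with the cell `c` has the given contents; `0` is the end, and all
cells up to `f` may be in use. -/
def IsStack (next item : ℕ → ℕ) (f : ℕ) : ℕ → List ℕ → Prop
  | c, [] => c = 0
  | c, d :: l => c ≠ 0 ∧ c ≤ f ∧ item c = d ∧ IsStack next item f (next c) l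

/-- The cell `f + 1` is not in use, so writing to it does not affect existing lists. -/
theorem IsStack.push {next item : ℕ → ℕ} {f c : ℕ} {l : List ℕ} (h : IsStack next item f c l)
    (a b : ℕ) : IsStack (Function.update next (f + 1) a) (Function.update item (f + 1) b) (f + 1) c
    l := by
  induction l generalizing c with
  | nil => exact h
  | cons d l ih =>
    obtain ⟨h1, h2, h3, h4⟩ := h
    refine ⟨h1, by omega, ?_, ?_⟩
    · rw [Function.update_of_ne (by omega), h3]
    · rw [Function.update_of_ne (by omega)]
      exact ih h4

/-! ### The store: a tournament tree with stacks at canonical nodes -/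

/-- Each node `v` has a stack `stk v` of intervals that contain the leaves below `v`; the intervals
in `A` are sorted by their keys `nr`. -/
structure StackInv (N : ℕ) (A : ℕ → Prop) (S E : ℕ → ℕ) (nr : ℕ → ℝ) (head next item : ℕ → ℕ)
    (f : ℕ) (stk : ℕ → List ℕ) : Prop where
  isStack : ∀ v, IsStack next item f (head v) (stk v)
  spans : ∀ v, ∀ d ∈ stk v, A d → Spans (N + S d) (N + E d + 1) v
  sorted : ∀ v, (stk v).Pairwise fun a b => A a → A b → nr a ≤ nr b

/-- `d` sits in the tournament tree `w`, at the leaf for the lower end of its interval. -/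
def Alive (N : ℕ) (S w : ℕ → ℕ) (d : ℕ) : Prop := d ≠ 0 ∧ S d < N ∧ w (N + S d) = d

/-- A tournament tree for the lower ends of intervals and stacks at the canonical nodes of the
intervals. Only numbers in `D` have been pushed on the stacks. -/
structure Store (N : ℕ) (D : ℕ → Prop) (S E : ℕ → ℕ) (nr : ℕ → ℝ) (w head next item : ℕ → ℕ)
    (f : ℕ) (stk : ℕ → List ℕ) : Prop where
  tournament : IsTournament N nr w
  leaf : ∀ p < N, w (N + p) ≠ 0 → S (w (N + p)) = p
  stack : StackInv N (Alive N S w) S E nr head next item f stk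
  mem_stack : ∀ d, Alive N S w d → ∀ v ∈ canon (N + S d) (N + E d + 1), d ∈ stk v
  mem : ∀ d, Alive N S w d → D d ∧ S d ≤ E d ∧ E d < N
  old : ∀ v, ∀ d ∈ stk v, D d

section Store

variable {N : ℕ} {D : ℕ → Prop} {S E : ℕ → ℕ} {nr : ℕ → ℝ} {w head next item : ℕ → ℕ}
  {f : ℕ} {stk : ℕ → List ℕ}

theorem Store.alive_leaf (h : Store N D S E nr w head next item f stk) {p : ℕ} (hp : p < N)
    (hw : w (N + p) ≠ 0) : Alive N S w (w (N + p)) := by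
  have := h.leaf p hp hw
  exact ⟨hw, by omega, by rw [this]⟩

theorem Store.alive_node (h : Store N D S E nr w head next item f stk) {v : ℕ} (hv : 0 < v)
    (hv' : v < 2 * N) (hw : w v ≠ 0) : Alive N S w (w v) := by
  obtain ⟨p, hp, k, -, hpw⟩ := h.tournament.exists_leaf hv hv' hw
  rw [← hpw]
  exact h.alive_leaf hp (by omega)

theorem Store.stab_sound (h : Store N D S E nr w head next item f stk) {d q k : ℕ} (hq : q < N)
    (hd : d ∈ stk ((N + q) / 2 ^ k)) (hA : Alive N S w d) : S d ≤ q ∧ q ≤ E d :=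
  (h.stack.spans _ d hd hA).le_of_div (h.mem d hA).2.2 hq rfl

/-- Some canonical node of the interval of `d` lies above the leaf `q`, hence on the path that a
stabbing query follows. -/
theorem Store.stab_complete (h : Store N D S E nr w head next item f stk) {d q : ℕ}
    (hA : Alive N S w d) (hq : S d ≤ q) (hq' : q ≤ E d) :
    ∃ k, d ∈ stk ((N + q) / 2 ^ k) ∧ 0 < (N + q) / 2 ^ k := by
  obtain ⟨k, hk⟩ := exists_mem_canon (lo := N + S d) (hi := N + E d + 1) (x := N + q) (by omega)
    (by omega)
  exact ⟨k, h.mem_stack d hA _ hk, ((spans_of_mem_canon hk).pos (h.mem d hA).2.2).1⟩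

theorem Store.range_sound (h : Store N D S E nr w head next item f stk) {a b v : ℕ} (hb : b < N)
    (hv : v ∈ canon (N + a) (N + b + 1)) (hw : w v ≠ 0) :
    Alive N S w (w v) ∧ a ≤ S (w v) ∧ S (w v) ≤ b := by
  have hs := spans_of_mem_canon hv
  obtain ⟨h1, h2⟩ := hs.pos hb
  obtain ⟨p, hp, k, hk, hpw⟩ := h.tournament.exists_leaf h1 h2 hw
  refine ⟨h.alive_node h1 h2 hw, ?_⟩
  rw [← hpw, h.leaf p hp (by omega)]
  exact hs.le_of_div hb hp hk

/-- The leaf of `d` lies below some canonical node of the range, and the winner there is at least as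
good as `d`. So it is enough to test the winners of the canonical nodes. -/
theorem Store.range_complete (h : Store N D S E nr w head next item f stk) {a b d : ℕ} (hb : b < N)
    (hA : Alive N S w d) (ha : a ≤ S d) (hd : S d ≤ b) :
    ∃ v ∈ canon (N + a) (N + b + 1), w v ≠ 0 ∧ nr (w v) ≤ nr d := by
  obtain ⟨k, hk⟩ := exists_mem_canon (lo := N + a) (hi := N + b + 1) (x := N + S d) (by omega)
    (by omega)
  obtain ⟨h1, h2⟩ := (spans_of_mem_canon hk).pos hb
  have := h.tournament.le (u := N + S d) (by omega) (by rw [hA.2.2]; exact hA.1) k h1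
  rw [hA.2.2] at this
  exact ⟨_, hk, this.1, this.2.key_le⟩

/-- Removing a number that is not alive from the top of a stack. -/
theorem Store.pop (h : Store N D S E nr w head next item f stk) {v d : ℕ} {l : List ℕ}
    (hv : stk v = d :: l) (hd : ¬ Alive N S w d) :
    Store N D S E nr w (Function.update head v (next (head v))) next item f
      (Function.update stk v l) := by
  have hsub : ∀ u, ∀ e ∈ Function.update stk v l u, e ∈ stk u := fun u e he => by
    by_cases huv : u = v
    · subst huv
      rw [Function.update_self] at he
      rw [hv]
      exact List.mem_cons_of_mem _ he
    · rwa [Function.update_of_ne huv] at he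
  refine ⟨h.tournament, h.leaf, ⟨fun u => ?_, fun u e he => h.stack.spans u e (hsub u e he),
    fun u => ?_⟩, fun e he u hu => ?_, h.mem, fun u e he => h.old u e (hsub u e he)⟩
  · by_cases huv : u = v
    · subst huv
      have := h.stack.isStack u
      rw [hv] at this
      simpa using this.2.2.2
    · simpa [huv] using h.stack.isStack u
  · by_cases huv : u = v
    · subst huv
      have := h.stack.sorted u
      rw [hv] at this
      simpa using this.of_cons
    · simpa [huv] using h.stack.sorted u
  · have := h.mem_stack e he u hu
    by_cases huv : u = v
    · subst huv
      rw [hv] at this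
      rw [Function.update_self]
      refine (List.mem_cons.1 this).resolve_left ?_
      rintro rfl
      exact hd he
    · rwa [Function.update_of_ne huv]

/-- The alive numbers after a change of a leaf. -/
theorem alive_erase_iff {w' : ℕ → ℕ} {d : ℕ} (hA : Alive N S w d)
    (hw : ∀ u, N ≤ u → w' u = Function.update w (N + S d) 0 u) (e : ℕ) :
    Alive N S w' e ↔ Alive N S w e ∧ e ≠ d := by
  unfold Alive at *
  rw [hw _ (by omega), Function.update_apply]
  constructor
  · rintro ⟨h1, h2, h3⟩
    split_ifs at h3 with h4
    · omega
    · exact ⟨⟨h1, h2, h3⟩, by rintro rfl; exact h4 rfl⟩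
  · rintro ⟨⟨h1, h2, h3⟩, h4⟩
    refine ⟨h1, h2, ?_⟩
    rw [if_neg, h3]
    intro h5
    rw [h5] at h3
    omega

/-- Removing a number from the tournament tree. -/
theorem Store.erase (h : Store N D S E nr w head next item f stk) {w' : ℕ → ℕ} {d : ℕ}
    (hA : Alive N S w d) (hT : IsTournament N nr w')
    (hw : ∀ u, N ≤ u → w' u = Function.update w (N + S d) 0 u) :
    Store N D S E nr w' head next item f stk := by
  have hsub := fun e he => ((alive_erase_iff hA hw e).1 he).1
  refine ⟨hT, fun p hp hpw => ?_, ⟨h.stack.isStack, fun v e he hA => h.stack.spans v e he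
      (hsub e hA),
    fun v => (h.stack.sorted v).imp fun hab ha hb => hab (hsub _ ha) (hsub _ hb)⟩,
    fun e he => h.mem_stack e (hsub e he), fun e he => h.mem e (hsub e he), h.old⟩
  rw [hw _ (by omega), Function.update_apply] at hpw ⊢
  split_ifs at hpw ⊢ with h1
  · exact absurd rfl hpw
  · exact h.leaf p hp hpw

/-- Only the data of numbers in `D` matter. -/
theorem Store.congr (h : Store N D S E nr w head next item f stk) {S' E' : ℕ → ℕ} {nr' : ℕ → ℝ}
    (hS : ∀ d, D d → S' d = S d) (hE : ∀ d, D d → E' d = E d) (hnr : ∀ d, D d → nr' d = nr d) :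
    (∀ d, Alive N S' w d ↔ Alive N S w d) ∧ Store N D S' E' nr' w head next item f stk := by
  have key : ∀ d, Alive N S' w d ↔ Alive N S w d := fun d => by
    refine ⟨fun hA => ?_, fun hA => ?_⟩
    · have h1 := h.alive_leaf hA.2.1 (by rw [hA.2.2]; exact hA.1)
      rwa [hA.2.2] at h1
    · have h1 := hS d (h.mem d hA).1
      exact ⟨hA.1, by rw [h1]; exact hA.2.1, by rw [h1]; exact hA.2.2⟩
  refine ⟨key, ?_, fun p hp hw => ?_, ⟨h.stack.isStack, fun v d hd hA => ?_, fun v => ?_⟩,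
    fun d hd => ?_, fun d hd => ?_, h.old⟩
  · refine h.tournament.congr fun v hv hv' hw => ?_
    rw [hnr _ (h.mem _ (h.alive_node hv hv' hw)).1]
  · rw [hS _ (h.mem _ (h.alive_leaf hp hw)).1]
    exact h.leaf p hp hw
  · rw [hS d (h.old v d hd), hE d (h.old v d hd)]
    exact h.stack.spans v d hd ((key d).1 hA)
  · refine (h.stack.sorted v).imp_of_mem fun {a b} ha hb hab hA hB => ?_
    rw [hnr a (h.old v a ha), hnr b (h.old v b hb)]
    exact hab ((key a).1 hA) ((key b).1 hB)
  · have hd := (key d).1 hd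
    rw [hS d (h.mem d hd).1, hE d (h.mem d hd).1]
    exact h.mem_stack d hd
  · have hd := (key d).1 hd
    rw [hS d (h.mem d hd).1, hE d (h.mem d hd).1]
    exact h.mem d hd

/-! ### Insertion into the store -/

/-- The invariant while `x` is pushed on the stacks of its canonical nodes; those in `r` remain. -/
structure Pushing (N : ℕ) (D : ℕ → Prop) (S E : ℕ → ℕ) (nr : ℕ → ℝ) (w : ℕ → ℕ) (x : ℕ)
    (head next item : ℕ → ℕ) (f : ℕ) (stk : ℕ → List ℕ) (r : List ℕ) : Prop where
  stack : StackInv N (fun d => Alive N S w d ∨ d = x) S E nr head next item f stk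
  mem_stack : ∀ d, Alive N S w d → ∀ v ∈ canon (N + S d) (N + E d + 1), d ∈ stk v
  old : ∀ v, ∀ d ∈ stk v, D d ∨ d = x
  rest : ∀ v ∈ r, Spans (N + S x) (N + E x + 1) v
  pushed : ∀ v ∈ canon (N + S x) (N + E x + 1), v ∈ r ∨ x ∈ stk v

theorem Store.pushing (h : Store N D S E nr w head next item f stk) {x : ℕ} (hx : ¬ D x) :
    Pushing N D S E nr w x head next item f stk (canon (N + S x) (N + E x + 1)) := by
  refine ⟨⟨h.stack.isStack, fun v d hd hA => ?_, fun v => ?_⟩, h.mem_stack,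
    fun v d hd => .inl (h.old v d hd), fun v hv => spans_of_mem_canon hv, fun v hv => .inl hv⟩
  · refine h.stack.spans v d hd (hA.resolve_right ?_)
    rintro rfl
    exact hx (h.old v d hd)
  · refine (h.stack.sorted v).imp_of_mem fun {a b} ha hb hab hA hB =>
      hab (hA.resolve_right ?_) (hB.resolve_right ?_)
    · rintro rfl
      exact hx (h.old v a ha)
    · rintro rfl
      exact hx (h.old v b hb)

/-- An alive `d` already on the stack of `v` has an interval that overlaps that of `x`, by
`Spans.overlap`; then `hnr` gives `nr x ≤ nr d`, and `x` may be put on top of the sorted stack. -/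
theorem Pushing.push {x v : ℕ} {r : List ℕ}
    (h : Pushing N D S E nr w x head next item f stk (v :: r)) (hE : ∀ d, Alive N S w d → E d < N)
    (hx : E x < N)
    (hnr : ∀ d, Alive N S w d → S d ≤ E x → S x ≤ E d → nr x ≤ nr d) :
    Pushing N D S E nr w x (Function.update head v (f + 1)) (Function.update next (f + 1) (head v))
      (Function.update item (f + 1) x) (f + 1) (Function.update stk v (x :: stk v)) r := by
  have hs := h.rest v (List.mem_cons_self ..)
  have hsub : ∀ u, ∀ d ∈ Function.update stk v (x :: stk v) u, d ∈ stk u ∨ (d = x ∧ u = v) := by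
    intro u d hd
    by_cases huv : u = v
    · subst huv
      simp only [Function.update_self, List.mem_cons] at hd
      tauto
    · rw [Function.update_of_ne huv] at hd
      exact .inl hd
  have hsup : ∀ u, ∀ d ∈ stk u, d ∈ Function.update stk v (x :: stk v) u := by
    intro u d hd
    by_cases huv : u = v
    · subst huv
      simp [hd]
    · rwa [Function.update_of_ne huv]
  refine ⟨⟨fun u => ?_, fun u d hd hA => ?_, fun u => ?_⟩,
    fun d hd u hu => hsup u d (h.mem_stack d hd u hu), fun u d hd => ?_,
    fun u hu => h.rest u (List.mem_cons_of_mem _ hu), fun u hu => ?_⟩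
  · by_cases huv : u = v
    · subst huv
      simp only [Function.update_self, IsStack]
      exact ⟨by omega, le_rfl, trivial, (h.stack.isStack u).push _ _⟩
    · rw [Function.update_of_ne huv, Function.update_of_ne huv]
      exact (h.stack.isStack u).push _ _
  · rcases hsub u d hd with hd | ⟨rfl, rfl⟩
    · exact h.stack.spans u d hd hA
    · exact hs
  · by_cases huv : u = v
    · subst huv
      rw [Function.update_self, List.pairwise_cons]
      refine ⟨fun d hd _ hA => ?_, h.stack.sorted u⟩
      rcases hA with hA | rfl
      · have := (h.stack.spans u d hd (.inl hA)).overlap hs (hE d hA) hx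
        exact hnr d hA this.1 this.2
      · exact le_rfl
    · rw [Function.update_of_ne huv]
      exact h.stack.sorted u
  · rcases hsub u d hd with hd | ⟨rfl, -⟩
    · exact h.old u d hd
    · exact .inr rfl
  · rcases h.pushed u hu with h1 | h1
    · rcases List.mem_cons.1 h1 with rfl | h1
      · simp
      · exact .inl h1
    · exact .inr (hsup u x h1)

/-- By `hS` no alive number occupies the leaf of `x`, so that nothing alive is overwritten. -/
theorem alive_insert_iff {w' : ℕ → ℕ} {x : ℕ} (hx : x ≠ 0) (hxN : S x < N)
    (hS : ∀ d, Alive N S w d → S d ≠ S x)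
    (hw : ∀ u, N ≤ u → w' u = Function.update w (N + S x) x u) (d : ℕ) :
    Alive N S w' d ↔ Alive N S w d ∨ d = x := by
  have h1 := hS d
  unfold Alive at *
  rw [hw _ (by omega), Function.update_apply]
  constructor
  · rintro ⟨h2, h3, h4⟩
    split_ifs at h4 with h5
    · exact .inr h4.symm
    · exact .inl ⟨h2, h3, h4⟩
  · rintro (h2 | rfl)
    · refine ⟨h2.1, h2.2.1, ?_⟩
      rw [if_neg, h2.2.2]
      have := h1 h2
      omega
    · exact ⟨hx, hxN, by simp⟩

/-- The last step of an insertion: `x` is put into the tournament tree. -/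
theorem Pushing.store {x : ℕ} (h : Pushing N D S E nr w x head next item f stk [])
    (hw : ∀ p < N, w (N + p) ≠ 0 → S (w (N + p)) = p)
    (hD : ∀ d, Alive N S w d → D d ∧ S d ≤ E d ∧ E d < N)
    {w' : ℕ → ℕ} (hx : x ≠ 0) (hxE : S x ≤ E x) (hxN : E x < N)
    (hS : ∀ d, Alive N S w d → S d ≠ S x) (hT : IsTournament N nr w')
    (hw' : ∀ u, N ≤ u → w' u = Function.update w (N + S x) x u) :
    Store N (fun d => D d ∨ d = x) S E nr w' head next item f stk := by
  have hA := alive_insert_iff hx (by omega) hS hw'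
  refine ⟨hT, fun p hp hpw => ?_, ⟨h.stack.isStack, fun v e he hA' => h.stack.spans v e he
      ((hA e).1 hA'),
    fun v => (h.stack.sorted v).imp fun hab ha hb => hab ((hA _).1 ha) ((hA _).1 hb)⟩,
    fun e he v hv => ?_, fun e he => ?_, h.old⟩
  · rw [hw' _ (by omega), Function.update_apply] at hpw ⊢
    split_ifs at hpw ⊢ with h1
    · omega
    · exact hw p hp hpw
  · rcases (hA e).1 he with he | rfl
    · exact h.mem_stack e he v hv
    · exact (h.pushed v hv).resolve_left (by simp)
  · rcases (hA e).1 he with he | rfl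
    · exact ⟨.inl (hD e he).1, (hD e he).2⟩
    · exact ⟨.inr rfl, hxE, hxN⟩

end Store


namespace RealRAM

/-! ### Queries and insertions -/

/-- The test that a number is odd. -/
def Test.odd (x : NExp) : Test := .natLt (.add (.half x) (.half x)) x

@[simp] theorem Test.holds_odd (s : State) (x : NExp) :
    (Test.odd x).holds s ↔ x.eval s % 2 = 1 := by
  simp only [Test.odd, Test.holds_natLt, NExp.eval]; omega

@[simp] theorem Test.cost_odd (x : NExp) : (Test.odd x).cost = 3 * x.cost + 6 := by
  simp only [Test.odd, Test.cost_natLt, NExp.cost]; ring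

/-- Run `body` with `xV` set to the canonical nodes of the interval from `xLo` to `xHi`. -/
def canonLoop (body : Prog) : Prog :=
  .while (.natLt (.var xLo) (.var xHi))
    (.ite (.odd (.var xLo)) (.set xV (.var xLo) ;; body) .skip ;;
     .ite (.odd (.var xHi)) (.set xV (.sub (.var xHi) (.const 1)) ;; body) .skip ;;
     .set xLo (.half (.add (.var xLo) (.const 1))) ;; .set xHi (.half (.var xHi)))

theorem Prog.run_ite_pos {b : Test} {p q : Prog} {s : State} (h : b.holds s) :
    (Prog.ite b p q).run s = p.run s := by simp only [Prog.run, h, if_true]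

theorem Prog.run_ite_neg {b : Test} {p q : Prog} {s : State} (h : ¬ b.holds s) :
    (Prog.ite b p q).run s = q.run s := by simp only [Prog.run, h, if_false]

theorem Prog.LoopFree.frame_run {p : Prog} (hp : p.LoopFree) (s : State) : Frame p s (p.run s) := by
  obtain ⟨t, -, h⟩ := hp.exec s
  exact h.frame

/-- The loop unrolls the recursion of `canon`; the invariant `I` is indexed by the list of canonical
nodes still to be visited. The interval ends are halved in each round, and `body` runs at most twice
per round. -/
theorem runs_canonLoop {body : Prog} {s₀ : State} (hb : body.LoopFree)
    (hlo : xLo ∉ body.natWrites) (hhi : xHi ∉ body.natWrites) (I : List ℕ → State → Prop)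
    (hI : ∀ l s a y, a = xLo ∨ a = xHi ∨ a = xV → I l s → I l (s.putNat a 0 y))
    (step : ∀ v l s, I (v :: l) s → s.nat xV 0 = v → I l (body.run s))
    (h : I (canon (s₀.nat xLo 0) (s₀.nat xHi 0)) s₀) {k : ℕ} (hk : s₀.nat xHi 0 < 2 ^ k) :
    Runs (canonLoop body) s₀ ((2 * body.time + 150) * k + 20) fun s _ => I [] s := by
  have opt : ∀ (x e : NExp) (s : State) (l : List ℕ),
      I ((if x.eval s % 2 = 1 then [e.eval s] else []) ++ l) s →
      I l ((Prog.ite (.odd x) (.set xV e ;; body) .skip).run s) := by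
    intro x e s l h
    simp only [Prog.run, Test.holds_odd]
    split_ifs at h ⊢
    · exact step _ _ _ (hI _ _ _ _ (by simp) h) (by simp)
    · simpa using h
  have scal : ∀ (x e : NExp) (s : State) (a : ℕ), a = xLo ∨ a = xHi →
      ((Prog.ite (.odd x) (.set xV e ;; body) .skip).run s).nat a = s.nat a := by
    intro x e s a ha
    refine (Prog.LoopFree.frame_run (by simp [hb]) s).nat a ?_
    rcases ha with rfl | rfl
    · simpa using hlo
    · simpa using hhi
  refine Runs.while (fun s n => ∃ k, s.nat xHi 0 < 2 ^ k ∧ n = (2 * body.time + 150) * k + 20 ∧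
    I (canon (s.nat xLo 0) (s.nat xHi 0)) s) ?_ ⟨k, hk, rfl, h⟩
  rintro s _ - ⟨k, hk, rfl, h⟩
  refine ⟨(2 * body.time + 150) * k + 10, by simp, fun hlt => ?_, fun hlt => ?_⟩
  · simp only [Test.holds_natLt, NExp.eval_var] at hlt
    obtain ⟨c, rfl⟩ : ∃ c, k = c + 1 := by
      cases k with
      | zero => simp at hk; omega
      | succ c => exact ⟨c, rfl⟩
    rw [canon, if_pos hlt] at h
    have h1 := opt (.var xLo) (.var xLo) s _ h
    refine .step (by simp [hb]) (k := (2 * body.time + 150) * c + body.time + 110)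
      (by simp; rw [max_eq_left (by omega)]; linarith) fun s₁ _ hs₁ => ?_
    rw [← hs₁] at h1
    have hl₁ : s₁.nat xLo = s.nat xLo := by rw [hs₁]; exact scal _ _ _ _ (by simp)
    have hh₁ : s₁.nat xHi = s.nat xHi := by rw [hs₁]; exact scal _ _ _ _ (by simp)
    have h2 := opt (.var xHi) (.sub (.var xHi) (.const 1)) s₁ _
      (by simp only [NExp.eval, NExp.eval_var, hh₁]; exact h1)
    refine .step (by simp [hb]) (k := (2 * body.time + 150) * c + 50)
      (by simp; rw [max_eq_left (by omega)]; linarith) fun s₂ _ hs₂ => ?_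
    rw [← hs₂] at h2
    have hl₂ : s₂.nat xLo = s.nat xLo := by rw [hs₂, ← hl₁]; exact scal _ _ _ _ (by simp)
    have hh₂ : s₂.nat xHi = s.nat xHi := by rw [hs₂, ← hh₁]; exact scal _ _ _ _ (by simp)
    refine .loopFree (by simp) (k := (2 * body.time + 150) * c + 20) (by simp; omega) ⟨c, ?_⟩
    refine ⟨?_, rfl, ?_⟩
    · simp [hh₂]
      rw [pow_succ] at hk; omega
    · simp [hl₂, hh₂]
      exact hI _ _ _ _ (by simp) (hI _ _ _ _ (by simp) h2)
  · simp only [Test.holds_natLt, NExp.eval_var] at hlt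
    rwa [canon, if_neg hlt] at h

/-! ### The store in the memory -/

/-- The lower and the upper end of the `y`-interval of `x` as leaves. -/
def NExp.low (x : NExp) : NExp := .load aYPos x
def NExp.high (x : NExp) : NExp := .load aYPos (.add (.load aTrees (.const 0)) x)

@[simp] theorem NExp.eval_low (s : State) (x : NExp) : x.low.eval s = s.nat aYPos (x.eval s) := rfl

@[simp] theorem NExp.eval_high (s : State) (x : NExp) :
    x.high.eval s = s.nat aYPos (s.nat aTrees 0 + x.eval s) := rfl

@[simp] theorem NExp.cost_low (x : NExp) : x.low.cost = x.cost + 1 := rfl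

@[simp] theorem NExp.cost_high (x : NExp) : x.high.cost = 2 + x.cost + 1 + 1 := rfl

/-- The test that the number `x` is alive. -/
def Test.alive (x : NExp) : Test := .natEq (.load aWin (.add (.var xLeaf) x.low)) x

/-- The test that the box `d` extends to the right up to the left end of the box `xCur`. -/
def Test.reaches (d : NExp) : Test :=
  .realLe (.add (.load rRight d) (.load rLeft (.var xCur))) (.const 0)

/-- The store in the memory. -/
def State.Stores (s : State) (N : ℕ) (D : ℕ → Prop) (stk : ℕ → List ℕ) : Prop :=
  Store N D (s.nat aYPos) (fun d => s.nat aYPos (s.nat aTrees 0 + d)) (s.real rRight) (s.nat aWin)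
    (s.nat aHead) (s.nat aNext) (s.nat aItem) (s.nat xFresh 0) stk

/-- The number `d` is alive. -/
def State.IsAlive (s : State) (N d : ℕ) : Prop := Alive N (s.nat aYPos) (s.nat aWin) d

/-! ### Lazy deletion from the stacks -/

/-- Remove numbers that are not alive from the top of the stack of `xV`. -/
def cleanTop : Prog :=
  .while (.and (.not (.natEq (.load aHead (.var xV)) (.const 0)))
      (.not (.alive (.load aItem (.load aHead (.var xV))))))
    (.setNat aHead (.var xV) (.load aNext (.load aHead (.var xV))))

/-- A state that differs only in the array of stack heads. -/
structure SameStore (s s' : State) : Prop where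
  trees : s'.nat aTrees = s.nat aTrees
  leaf : s'.nat xLeaf = s.nat xLeaf
  cur : s'.nat xCur = s.nat xCur
  yPos : s'.nat aYPos = s.nat aYPos
  win : s'.nat aWin = s.nat aWin
  next : s'.nat aNext = s.nat aNext
  item : s'.nat aItem = s.nat aItem
  fresh : s'.nat xFresh = s.nat xFresh
  real : s'.real = s.real

theorem SameStore.refl (s : State) : SameStore s s := ⟨rfl, rfl, rfl, rfl, rfl, rfl, rfl, rfl, rfl⟩

theorem SameStore.trans {s s' s'' : State} (h : SameStore s s') (h' : SameStore s' s'') :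
    SameStore s s'' :=
  ⟨h'.trees.trans h.trees, h'.leaf.trans h.leaf, h'.cur.trans h.cur, h'.yPos.trans h.yPos,
    h'.win.trans h.win, h'.next.trans h.next, h'.item.trans h.item, h'.fresh.trans h.fresh,
    h'.real.trans h.real⟩

theorem Frame.sameStore {p : Prog} {s s' : State} (h : Frame p s s')
    (hp : ∀ a ∈ p.natWrites, a ∉ [aTrees, xLeaf, xCur, aYPos, aWin, aNext, aItem, xFresh])
    (hr : p.realWrites = []) : SameStore s s' := by
  have key : ∀ a ∈ [aTrees, xLeaf, xCur, aYPos, aWin, aNext, aItem, xFresh], s'.nat a = s.nat a :=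
    fun a ha => h.nat a fun h' => hp a h' ha
  simp only [List.forall_mem_cons] at key
  obtain ⟨h1, h2, h3, h4, h5, h6, h7, h8, -⟩ := key
  exact ⟨h1, h2, h3, h4, h5, h6, h7, h8, funext fun a => h.real a (by simp [hr])⟩

theorem SameStore.stores {s s' : State} (h : SameStore s s') {N : ℕ} {D : ℕ → Prop}
    {stk : ℕ → List ℕ} (hS : s'.Stores N D stk) :
    Store N D (s.nat aYPos) (fun d => s.nat aYPos (s.nat aTrees 0 + d)) (s.real rRight)
      (s.nat aWin) (s'.nat aHead) (s.nat aNext) (s.nat aItem) (s.nat xFresh 0) stk := by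
  unfold State.Stores at hS
  rwa [h.yPos, h.trees, h.real, h.win, h.next, h.item, h.fresh] at hS

theorem SameStore.stores' {s s' : State} (h : SameStore s s') {N : ℕ} {D : ℕ → Prop}
    {stk : ℕ → List ℕ} (hh : s'.nat aHead = s.nat aHead) (hS : s.Stores N D stk) :
    s'.Stores N D stk := by
  unfold State.Stores
  rwa [h.yPos, h.trees, h.real, h.win, h.next, h.item, h.fresh, hh]

/-- Each stack entry carries `60` units of time, which pay for popping it. The entries that remain
keep theirs, so `60 * l.length` is still available afterwards. -/
theorem runs_cleanTop {s₀ : State} {N v r : ℕ} {D : ℕ → Prop} {stk : ℕ → List ℕ}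
    (hN : s₀.nat xLeaf 0 = N) (hv : s₀.nat xV 0 = v) (hD : ∀ d, D d → d ≠ 0 ∧ s₀.nat aYPos d < N)
    (h : s₀.Stores N D stk) :
    Runs cleanTop s₀ (60 * (stk v).length + (r + 50)) fun s k => ∃ l, 60 * l.length + r ≤ k ∧ l <:+
    stk v ∧
      s.Stores N D (Function.update stk v l) ∧ ∀ d ∈ l.head?, s₀.IsAlive N d := by
  refine Runs.while (fun s k => ∃ l, k = 60 * l.length + (r + 50) ∧
    l <:+ stk v ∧ s.Stores N D (Function.update stk v l)) ?_ ⟨stk v, rfl, List.suffix_rfl, by rwa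
    [Function.update_eq_self]⟩
  rintro s _ hf ⟨l, rfl, hl, hS⟩
  have hsame : SameStore s₀ s := hf.sameStore (by simp) rfl
  have hv' : s.nat xV 0 = v := by rw [hf.nat xV (by simp), hv]
  have hN' : s.nat xLeaf 0 = N := by rw [hsame.leaf, hN]
  have hst := hS.stack.isStack v
  rw [Function.update_self] at hst
  refine ⟨60 * l.length + (r + 7), by simp [Test.alive]; omega, fun hb => ?_, fun hb => ?_⟩
  · simp only [Test.holds, Test.alive, Test.holds_natEq, NExp.eval, NExp.eval_var, NExp.eval_low,
      hv', hN'] at hb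
    obtain ⟨hb1, hb2⟩ := hb
    cases l with
    | nil => exact absurd hst hb1
    | cons d l =>
      obtain ⟨h1, h2, h3, h4⟩ := hst
      rw [h3] at hb2
      have hpop := hS.pop (v := v) (d := d) (l := l) (by simp) fun hA => hb2 hA.2.2
      refine .loopFree (by simp) (k := 60 * l.length + (r + 50)) (by simp; omega)
        ⟨l, rfl, (List.suffix_cons d l).trans hl, ?_⟩
      simpa [State.Stores, hv', Function.update_idem] using hpop
  · simp only [Test.holds, Test.alive, Test.holds_natEq, NExp.eval, NExp.eval_var, NExp.eval_low,
      hv', hN'] at hb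
    refine ⟨l, by omega, hl, hS, fun d hd => ?_⟩
    cases l with
    | nil => simp at hd
    | cons e l =>
      obtain rfl : e = d := by simpa using hd
      obtain ⟨h1, h2, h3, h4⟩ := hst
      rw [h3] at hb
      simp only [h1, not_false_eq_true, true_and, not_not] at hb
      have hDe := hD e (hS.old v e (by simp))
      refine ⟨hDe.1, hDe.2, ?_⟩
      rwa [hsame.win, hsame.yPos] at hb

/-- The total size of the stacks. -/
def stackSize (N : ℕ) (stk : ℕ → List ℕ) : ℕ := ∑ v ∈ Finset.range (2 * N), (stk v).length

theorem stackSize_update {N v : ℕ} (hv : v < 2 * N) (stk : ℕ → List ℕ) (l : List ℕ) :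
    stackSize N (Function.update stk v l) + (stk v).length = stackSize N stk + l.length := by
  unfold stackSize
  have hv' : v ∈ Finset.range (2 * N) := Finset.mem_range.2 hv
  rw [← Finset.add_sum_erase _ _ hv', ← Finset.add_sum_erase (Finset.range (2 * N)) _ hv',
    Function.update_self]
  rw [Finset.sum_congr rfl fun u hu => by rw [Function.update_of_ne (Finset.ne_of_mem_erase hu)]]
  omega

/-- The box `d` is alive and meets the box `x`, provided that it does not start to the right of the
box `x`. -/
structure State.Hits (s : State) (N x d : ℕ) : Prop where
  alive : s.IsAlive N d
  low_le : s.nat aYPos d ≤ s.nat aYPos (s.nat aTrees 0 + x)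
  le_high : s.nat aYPos x ≤ s.nat aYPos (s.nat aTrees 0 + d)
  reaches : s.real rRight d + s.real rLeft x ≤ 0

/-- The test that the box on top of the stack of `xV` extends far enough to the right. -/
def Test.stab : Test :=
  .and (.not (.natEq (.load aHead (.var xV)) (.const 0)))
    (.reaches (.load aItem (.load aHead (.var xV))))

/-! ### Stabbing queries -/

/-- Look for a box whose `y`-interval contains the lower end of the box `xCur`. -/
def stab : Prog :=
  (.set xD (.const 0) ;; .set xV (.add (.var xLeaf) (.low (.var xCur)))) ;;
  .while (.natLe (.const 1) (.var xV))
    (cleanTop ;;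
     .ite .stab (.set xD (.load aItem (.load aHead (.var xV)))) .skip ;; .set xV (.half (.var xV)))

@[simp] theorem natWrites_stab : stab.natWrites = [xD, xV, aHead, xD, xV] := rfl

@[simp] theorem realWrites_stab : stab.realWrites = [] := rfl

/-- The walk from the leaf `q` to the root sees a stack for every alive interval that contains `q`.
If it finds nothing, a box that is still hit cannot have its lower end at or below `q`. Pops are
paid for by the potential `60 * stackSize`, the rest costs `O(b)`. -/
theorem runs_stab {s₀ : State} {N b x r : ℕ} {D : ℕ → Prop} {stk : ℕ → List ℕ}
    (hN : s₀.nat xLeaf 0 = N) (hx : s₀.nat xCur 0 = x) (hb : 2 * N ≤ 2 ^ b)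
    (hD : ∀ d, D d → d ≠ 0 ∧ s₀.nat aYPos d < N) (h : s₀.Stores N D stk)
    (hxE : s₀.nat aYPos x ≤ s₀.nat aYPos (s₀.nat aTrees 0 + x)) (hxN : s₀.nat aYPos x < N) :
    Runs stab s₀ (60 * stackSize N stk + 200 * b + 30 + r) fun s k => ∃ stk',
      60 * stackSize N stk' + r ≤ k ∧ s.Stores N D stk' ∧
      (s.nat xD 0 ≠ 0 → s₀.Hits N x (s.nat xD 0)) ∧
      (s.nat xD 0 = 0 → ∀ d, s₀.Hits N x d → s₀.nat aYPos x < s₀.nat aYPos d) := by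
  set q := s₀.nat aYPos x with hq
  refine .step (by simp) (k := 60 * stackSize N stk + 200 * b + 10 + r) (by simp; omega)
    fun s₁ hf₁ hs₁ => ?_
  have hsame₁ : SameStore s₀ s₁ := hf₁.sameStore (by simp) rfl
  refine Runs.while (fun s k => ∃ stk' j c, s.nat xV 0 = (N + q) / 2 ^ j ∧ s.nat xV 0 < 2 ^ c ∧
    60 * stackSize N stk' + 200 * c + 10 + r ≤ k ∧ s.Stores N D stk' ∧
    (s.nat xD 0 ≠ 0 → s₀.Hits N x (s.nat xD 0)) ∧
    (s.nat xD 0 = 0 → ∀ d, s₀.Hits N x d → ∀ i < j, d ∉ stk' ((N + q) / 2 ^ i))) ?_ ?_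
  · rintro s n hf ⟨stk, j, c, hj, hc, hn, hS, hF, hF'⟩
    have hsame : SameStore s₀ s := hsame₁.trans (hf.sameStore (by simp [cleanTop]) rfl)
    refine ⟨60 * stackSize N stk + 200 * c + r, by simp; omega, fun hb => ?_, fun hb => ?_⟩
    · simp only [Test.holds, NExp.eval, NExp.eval_var] at hb
      obtain ⟨c, rfl⟩ : ∃ e, c = e + 1 := by
        cases c with
        | zero => simp at hc; omega
        | succ e => exact ⟨e, rfl⟩
      have hvN : s.nat xV 0 < 2 * N := by
        rw [hj]
        have := Nat.div_le_self (N + q) (2 ^ j)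
        omega
      set v := s.nat xV 0 with hv
      have hΦ := fun l => stackSize_update hvN stk l
      have hlen : (stk v).length ≤ stackSize N stk :=
        Finset.single_le_sum (f := fun u => (stk u).length) (fun _ _ => Nat.zero_le _)
          (Finset.mem_range.2 hvN)
      -- The number `m` counts the entries of all other stacks; their share of the potential is
      -- handed through the cleaning of this one.
      obtain ⟨m, hm⟩ := Nat.exists_eq_add_of_le hlen
      refine .seq ((runs_cleanTop (r := 60 * m + 200 * c + 150 + r) (by rw [hsame.leaf, hN]) hv.symm
        (by rw [hsame.yPos]; exact hD) hS).mono (by rw [hm]; linarith)) ?_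
      rintro s₂ k₂ hf₂ ⟨l, hk₂, hsuf, hS₂, hl⟩
      have hΦl := hΦ l
      have hsame₂ : SameStore s₀ s₂ := hsame.trans (hf₂.sameStore (by simp [cleanTop]) rfl)
      have hv₂ : s₂.nat xV 0 = v := by rw [hf₂.nat xV (by simp [cleanTop])]
      have hd₂ : s₂.nat xD = s.nat xD := by rw [hf₂.nat xD (by simp [cleanTop])]
      have hS₂' := hsame₂.stores hS₂
      have hst := hS₂'.stack.isStack v
      have hso := hS₂'.stack.sorted v
      rw [Function.update_self] at hst hso
      have hsub : ∀ u d, d ∈ Function.update stk v l u → d ∈ stk u := fun u d hd => by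
        by_cases huv : u = v
        · subst huv
          rw [Function.update_self] at hd
          exact hsuf.subset hd
        · rwa [Function.update_of_ne huv] at hd
      refine .loopFree (by simp)
        (k := 60 * stackSize N (Function.update stk v l) + 200 * c + 10 + r)
        (by simp [Test.stab, Test.reaches]; omega) ?_
      refine ⟨Function.update stk v l, j + 1, c, ?_, ?_, le_rfl, ?_⟩
      · simp only [Prog.run]
        split_ifs <;> simp [hv₂, hj, pow_succ, Nat.div_div_eq_div_mul]
      · simp only [Prog.run]
        split_ifs <;> simp [hv₂] <;> rw [pow_succ] at hc <;> omega
      refine ⟨?_, ?_⟩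
      · simp only [Prog.run]
        split_ifs
        · exact (SameStore.mk (by simp) (by simp) (by simp) (by simp) (by simp) (by simp) (by simp)
            (by simp) (by simp)).stores' (by simp) hS₂
        · exact (SameStore.mk (by simp) (by simp) (by simp) (by simp) (by simp) (by simp) (by simp)
            (by simp) (by simp)).stores' (by simp) hS₂
      cases l with
      | nil =>
        have hst : s₂.nat aHead v = 0 := hst
        have htest : ¬ Test.stab.holds s₂ := by simp [Test.stab, hv₂, hst]
        rw [Prog.run, Prog.run_ite_neg htest]
        simp only [Prog.run, Prog.run_set, State.putNat_nat, hd₂]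
        refine ⟨hF, fun h0 d hd i hi hdi => ?_⟩
        rcases Nat.lt_succ_iff_lt_or_eq.1 hi with hi | rfl
        · exact hF' h0 d hd i hi (hsub _ d hdi)
        · rw [← hj, Function.update_self] at hdi
          simp at hdi
      | cons t l =>
        obtain ⟨h1, -, h3, -⟩ := hst
        have hat := hl t (by simp)
        simp only [State.IsAlive, hsame.win, hsame.yPos] at hat
        have htv : t ∈ Function.update stk v (t :: l) ((N + q) / 2 ^ j) := by
          rw [← hj, Function.update_self]; simp
        obtain ⟨h4, h5⟩ := hS₂'.stab_sound hxN htv hat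
        have htest : Test.stab.holds s₂ ↔ s₀.real rRight t + s₀.real rLeft x ≤ 0 := by
          simp [Test.stab, Test.reaches, hv₂, h1, hsame₂.item, hsame₂.real, hsame₂.cur, h3, hx]
        by_cases ht : s₀.real rRight t + s₀.real rLeft x ≤ 0
        · rw [Prog.run, Prog.run_ite_pos (htest.2 ht)]
          simp only [Prog.run_set, NExp.eval, NExp.eval_var, State.putNat_nat]
          simp only [hsame₂.item, hv₂, h3]
          refine ⟨fun _ => ?_, fun h0 => ?_⟩
          · simpa using ⟨hat, h4.trans hxE, h5, ht⟩
          · simp at h0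
            exact absurd h0 hat.1
        · rw [Prog.run, Prog.run_ite_neg (htest.not.2 ht)]
          simp only [Prog.run, Prog.run_set, State.putNat_nat, hd₂]
          refine ⟨hF, fun h0 d hd i hi hdi => ?_⟩
          rcases Nat.lt_succ_iff_lt_or_eq.1 hi with hi | rfl
          · exact hF' h0 d hd i hi (hsub _ d hdi)
          · rw [← hj, Function.update_self] at hdi
            -- The keys are negated right ends, increasing down the stack among alive boxes: if the
            -- top one does not reach `x`, then neither does any alive box below it.
            refine ht (le_trans ?_ hd.reaches)
            rcases List.mem_cons.1 hdi with rfl | hdi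
            · exact le_rfl
            · have := (List.pairwise_cons.1 hso).1 d hdi hat hd.alive
              linarith
    · simp only [Test.holds, NExp.eval, NExp.eval_var] at hb
      refine ⟨stk, by omega, hS, hF, fun h0 d hd => ?_⟩
      by_contra hlt
      have hS' := hsame.stores hS
      obtain ⟨k, hk, hk0⟩ := hS'.stab_complete hd.alive (not_lt.1 hlt) hd.le_high
      refine hF' h0 d hd k ?_ hk
      -- The walk has arrived at node `0`, so every ancestor with a positive number has been
      -- visited.
      by_contra hjk
      have : (N + q) / 2 ^ k ≤ (N + q) / 2 ^ j := Nat.div_le_div_left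
          (Nat.pow_le_pow_right (by omega) (by omega)) (by positivity)
      omega
  · refine ⟨stk, 0, b, by simp [hs₁, hN, hx, hq], by simp [hs₁, hN, hx, ← hq]; omega, le_rfl, ?_, by
      simp [hs₁], by simp⟩
    exact hsame₁.stores' (hf₁.nat aHead (by simp)) h

end RealRAM


namespace RealRAM

/-! ### Range queries and the combined search -/

/-- The test that the winner of the subtree of `xV` extends far enough to the right. -/
def Test.winner : Test :=
  .and (.not (.natEq (.load aWin (.var xV)) (.const 0))) (.reaches (.load aWin (.var xV)))

/-- Set the bounds for `canonLoop` to the `y`-interval of the box `xCur`. -/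
def setRange : Prog :=
  .set xLo (.add (.var xLeaf) (.low (.var xCur))) ;;
  .set xHi (.add (.add (.var xLeaf) (.high (.var xCur))) (.const 1))

/-- Test the winner of the subtree of `xV`. -/
def checkWinner : Prog := .ite .winner (.set xD (.load aWin (.var xV))) .skip

/-- Look for a box that is hit by the box `xCur`. -/
def search : Prog := stab ;; setRange ;; canonLoop checkWinner

@[simp] theorem natWrites_setRange : setRange.natWrites = [xLo, xHi] := rfl

@[simp] theorem natWrites_search : search.natWrites =
  [xD, xV, aHead, xD, xV, xLo, xHi, xV, xD, xV, xD, xLo, xHi] := rfl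

@[simp] theorem realWrites_search : search.realWrites = [] := rfl

theorem State.stores_congr {s s' : State} (h : SameStore s s') {N x d : ℕ} :
    s'.Hits N x d ↔ s.Hits N x d := by
  constructor <;> rintro ⟨h1, h2, h3, h4⟩
  · refine ⟨?_, ?_, ?_, ?_⟩
    · simpa only [State.IsAlive, h.yPos, h.win] using h1
    · simpa only [h.yPos, h.trees] using h2
    · simpa only [h.yPos, h.trees] using h3
    · simpa only [h.real] using h4
  · refine ⟨?_, ?_, ?_, ?_⟩
    · simpa only [State.IsAlive, h.yPos, h.win] using h1
    · simpa only [h.yPos, h.trees] using h2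
    · simpa only [h.yPos, h.trees] using h3
    · simpa only [h.real] using h4

/-- The invariant of the inspection of the canonical nodes. -/
structure RangeInv (s₀ : State) (N x : ℕ) (l : List ℕ) (s : State) : Prop where
  same : SameStore s₀ s
  head : s.nat aHead = s₀.nat aHead
  mem : ∀ v ∈ l, v ∈ canon (N + s₀.nat aYPos x) (N + s₀.nat aYPos (s₀.nat aTrees 0 + x) + 1)
  sound : s.nat xD 0 ≠ 0 → s₀.Hits N x (s.nat xD 0)
  complete : s.nat xD 0 = 0 → ∀ d, s₀.Hits N x d → s₀.nat aYPos x < s₀.nat aYPos d ∧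
    ∀ v ∈ canon (N + s₀.nat aYPos x) (N + s₀.nat aYPos (s₀.nat aTrees 0 + x) + 1),
      s₀.nat aWin v ≠ 0 → s₀.real rRight (s₀.nat aWin v) ≤ s₀.real rRight d → v ∈ l

theorem RangeInv.congr {s₀ s s' : State} {N x : ℕ} {l : List ℕ} (h : RangeInv s₀ N x l s)
    (hs : SameStore s s') (hh : s'.nat aHead = s.nat aHead) (hd : s'.nat xD = s.nat xD) :
    RangeInv s₀ N x l s' :=
  ⟨h.same.trans hs, hh.trans h.head, h.mem, by rw [hd]; exact h.sound, by rw [hd]; exact h.complete⟩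

theorem RangeInv.run_checkWinner {s₀ s : State} {N x v : ℕ} {D : ℕ → Prop} {stk : ℕ → List ℕ}
    {l : List ℕ} (hx : s₀.nat xCur 0 = x) (hS : s₀.Stores N D stk)
    (hxN : s₀.nat aYPos (s₀.nat aTrees 0 + x) < N)
    (h : RangeInv s₀ N x (v :: l) s) (hv : s.nat xV 0 = v) :
    RangeInv s₀ N x l (checkWinner.run s) := by
  have hvc := h.mem v (List.mem_cons_self ..)
  have htest : Test.winner.holds s ↔ s₀.nat aWin v ≠ 0 ∧
      s₀.real rRight (s₀.nat aWin v) + s₀.real rLeft x ≤ 0 := by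
    simp [Test.winner, Test.reaches, hv, h.same.win, h.same.real, h.same.cur, hx]
  by_cases ht : s₀.nat aWin v ≠ 0 ∧ s₀.real rRight (s₀.nat aWin v) + s₀.real rLeft x ≤ 0
  · rw [checkWinner, Prog.run_ite_pos (htest.2 ht)]
    obtain ⟨h1, h2, h3⟩ := hS.range_sound hxN hvc ht.1
    simp only [Prog.run_set, NExp.eval, NExp.eval_var, hv, h.same.win]
    refine ⟨h.same.trans (by constructor <;> simp), by simp [h.head],
      fun u hu => h.mem u (List.mem_cons_of_mem _ hu), fun _ => ?_, fun h0 => ?_⟩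
    · simpa using ⟨h1, h3, h2.trans (hS.mem _ h1).2.1, ht.2⟩
    · simp at h0
      exact absurd h0 ht.1
  · rw [checkWinner, Prog.run_ite_neg (htest.not.2 ht)]
    refine ⟨h.same, h.head, fun u hu => h.mem u (List.mem_cons_of_mem _ hu), h.sound,
      fun h0 d hd => ⟨(h.complete h0 d hd).1, fun u hu hu0 hud => ?_⟩⟩
    refine (List.mem_cons.1 ((h.complete h0 d hd).2 u hu hu0 hud)).resolve_left ?_
    rintro rfl
    exact ht ⟨hu0, by linarith [hd.reaches]⟩

/-- Of two intervals that meet, one contains the lower end of the other. The stabbing query covers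
one case, and the inspection of the canonical nodes of the interval of `x` the other. -/
theorem runs_search {s₀ : State} {N b x r : ℕ} {D : ℕ → Prop} {stk : ℕ → List ℕ}
    (hN : s₀.nat xLeaf 0 = N) (hx : s₀.nat xCur 0 = x) (hb : 2 * N ≤ 2 ^ b)
    (hD : ∀ d, D d → d ≠ 0 ∧ s₀.nat aYPos d < N) (h : s₀.Stores N D stk)
    (hxE : s₀.nat aYPos x ≤ s₀.nat aYPos (s₀.nat aTrees 0 + x))
    (hxN : s₀.nat aYPos (s₀.nat aTrees 0 + x) < N) :
    Runs search s₀ (60 * stackSize N stk + 500 * b + 400 + r) fun s k => ∃ stk',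
      60 * stackSize N stk' + r ≤ k ∧ s.Stores N D stk' ∧
      (s.nat xD 0 ≠ 0 → s₀.Hits N x (s.nat xD 0)) ∧
      (s.nat xD 0 = 0 → ∀ d, ¬ s₀.Hits N x d) := by
  refine .seq ((runs_stab (r := r + (300 * b + 370)) hN hx hb hD h hxE (by omega)).mono (by omega))
      ?_
  rintro s₁ k₁ hf₁ ⟨stk', hk₁, hS₁, hF, hF'⟩
  have hsame₁ : SameStore s₀ s₁ := hf₁.sameStore (by simp) rfl
  refine .step (by simp [setRange]) (k := 60 * stackSize N stk' + r + (300 * b + 340))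
    (by have : setRange.time = 21 := rfl
        linarith) fun s₂ hf₂ hs₂ => ?_
  have hsame₂ : SameStore s₁ s₂ := hf₂.sameStore (by simp) rfl
  have hlo : s₂.nat xLo 0 = N + s₀.nat aYPos x := by
    simp [hs₂, setRange, hsame₁.leaf, hsame₁.yPos, hsame₁.cur, hN, hx]
  have hhi : s₂.nat xHi 0 = N + s₀.nat aYPos (s₀.nat aTrees 0 + x) + 1 := by
    simp [hs₂, setRange, hsame₁.leaf, hsame₁.yPos, hsame₁.cur, hsame₁.trees, hN, hx]
  have hd₂ : s₂.nat xD = s₁.nat xD := hf₂.nat xD (by simp)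
  have hS₂ : s₂.Stores N D stk' := hsame₂.stores' (hf₂.nat aHead (by simp)) hS₁
  have key := runs_canonLoop (body := checkWinner) (s₀ := s₂) (k := b + 1) (by simp [checkWinner])
    (by simp [checkWinner]) (by simp [checkWinner]) (RangeInv s₂ N x)
    (fun l s a y ha hI => hI.congr (by rcases ha with rfl | rfl | rfl <;> constructor <;> simp)
      (by rcases ha with rfl | rfl | rfl <;> simp) (by rcases ha with rfl | rfl | rfl <;> simp))
    (fun v l s hI hv => hI.run_checkWinner (by rw [hsame₂.cur, hsame₁.cur, hx]) hS₂
      (by rw [hsame₂.yPos, hsame₁.yPos, hsame₂.trees, hsame₁.trees]; exact hxN) hv)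
    (by
      have hst := fun d => State.stores_congr (N := N) (x := x) (d := d) (hsame₁.trans hsame₂)
      have e1 : s₂.nat aYPos = s₀.nat aYPos := by rw [hsame₂.yPos, hsame₁.yPos]
      have e2 : s₂.nat aTrees = s₀.nat aTrees := by rw [hsame₂.trees, hsame₁.trees]
      rw [hlo, hhi]
      refine ⟨.refl _, rfl, fun v hv => by rwa [e1, e2], fun h0 => ?_, fun h0 d hd => ⟨?_, ?_⟩⟩
      · rw [hst, hd₂]
        rw [hd₂] at h0
        exact hF h0
      · rw [hst] at hd
        rw [hd₂] at h0
        rw [e1]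
        exact hF' h0 d hd
      · intro v hv _ _
        rwa [e1, e2] at hv)
    (by rw [hhi, pow_succ]; omega)
  have hbudget : (2 * checkWinner.time + 150) * (b + 1) + 20 ≤ 300 * b + 340 := by
    simp [checkWinner, Test.winner, Test.reaches]; omega
  refine ((key.mono hbudget).left_over (k := 60 * stackSize N stk' + r)
    (Q' := fun s k => ∃ stk', 60 * stackSize N stk' + r ≤ k ∧ s.Stores N D stk' ∧
      (s.nat xD 0 ≠ 0 → s₀.Hits N x (s.nat xD 0)) ∧
      (s.nat xD 0 = 0 → ∀ d, ¬ s₀.Hits N x d)) fun s hf hI => ?_).mono (by omega)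
  have hst := fun d => State.stores_congr (N := N) (x := x) (d := d) (hsame₁.trans hsame₂)
  refine ⟨stk', le_rfl, hI.same.stores' hI.head hS₂, fun h0 => (hst _).1 (hI.sound h0),
    fun h0 d hd => ?_⟩
  rw [← hst] at hd
  obtain ⟨h1, h2⟩ := hI.complete h0 d hd
  -- A hit `d` that the stabbing query missed has its lower end in the interval of `x`. Some winner
  -- reaches at least as far as `d`, so its node would still have to be in the empty list of nodes
  -- to be visited.
  obtain ⟨v, hv, hv0, hvd⟩ := hS₂.range_complete
    (by rw [hsame₂.yPos, hsame₁.yPos, hsame₂.trees, hsame₁.trees]; exact hxN) hd.alive h1.le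
    hd.low_le
  exact absurd (h2 v hv hv0 hvd) (by simp)

/-! ### Removal and insertion of boxes -/

/-- Remove the box `xD`. -/
def remove : Prog :=
  (.set xV (.add (.var xLeaf) (.low (.var xD))) ;; .set xC (.const 0)) ;; updateTree rRight

@[simp] theorem natWrites_remove : remove.natWrites = [xV, xC, aWin, xV, xC, xE, aWin, aWin] := rfl

@[simp] theorem realWrites_remove : remove.realWrites = [] := rfl

/-- Only the tournament tree changes. The entries of `d` stay on the stacks, where they no longer
count because `d` is not alive. -/
theorem runs_remove {s : State} {N b d : ℕ} {D : ℕ → Prop} {stk : ℕ → List ℕ}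
    (hN : s.nat xLeaf 0 = N) (hd : s.nat xD 0 = d) (hb : 2 * N ≤ 2 ^ b) (h : s.Stores N D stk)
    (hA : s.IsAlive N d) :
    Runs remove s (200 * b + 40) fun s' _ => s'.Stores N D stk ∧
      ∀ e, s'.IsAlive N e ↔ s.IsAlive N e ∧ e ≠ d := by
  refine .step (by simp) (k := 200 * b + 20) (by simp; omega) fun s₁ hf₁ hs₁ => ?_
  refine (runs_updateTree (N := N) (b := b) ?_ ?_ ?_ hb).imp fun s₂ k hf₂ hs₂ => ?_
  · rw [hs₁]
    simpa using h.tournament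
  · simp [hs₁, hN]
  · have := hA.2.1
    simp [hs₁, hN, hd]
    omega
  · have hw : ∀ u, N ≤ u → s₂.nat aWin u =
        Function.update (s.nat aWin) (N + s.nat aYPos d) 0 u := fun u hu => by
      rw [hs₂.2 u hu]
      simp [hs₁, hN, hd]
    have hT : IsTournament N (s.real rRight) (s₂.nat aWin) := by
      have := hs₂.1
      rw [hs₁] at this
      simpa using this
    have e1 : s₂.nat aYPos = s.nat aYPos := by rw [hf₂.nat _ (by simp), hf₁.nat _ (by simp)]
    have e2 : s₂.nat aTrees = s.nat aTrees := by rw [hf₂.nat _ (by simp), hf₁.nat _ (by simp)]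
    have e3 : s₂.real = s.real := by
      funext a; rw [hf₂.real _ (by simp), hf₁.real _ (by simp)]
    have e4 : s₂.nat aHead = s.nat aHead := by rw [hf₂.nat _ (by simp), hf₁.nat _ (by simp)]
    have e5 : s₂.nat aNext = s.nat aNext := by rw [hf₂.nat _ (by simp), hf₁.nat _ (by simp)]
    have e6 : s₂.nat aItem = s.nat aItem := by rw [hf₂.nat _ (by simp), hf₁.nat _ (by simp)]
    have e7 : s₂.nat xFresh = s.nat xFresh := by rw [hf₂.nat _ (by simp), hf₁.nat _ (by simp)]
    refine ⟨?_, fun e => ?_⟩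
    · have := h.erase hA hT hw
      unfold State.Stores
      rwa [e1, e2, e3, e4, e5, e6, e7]
    · unfold State.IsAlive
      rw [e1]
      exact alive_erase_iff hA hw e

/-- Push the box `xCur` on the stack of `xV`. -/
def pushCur : Prog :=
  .set xFresh (.add (.var xFresh) (.const 1)) ;;
  .setNat aNext (.var xFresh) (.load aHead (.var xV)) ;;
  .setNat aItem (.var xFresh) (.var xCur) ;;
  .setNat aHead (.var xV) (.var xFresh)

/-- Insert the box `xCur`. -/
def insertCur : Prog :=
  setRange ;; canonLoop pushCur ;;
  (.set xV (.add (.var xLeaf) (.low (.var xCur))) ;; .set xC (.var xCur)) ;; updateTree rRight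

@[simp] theorem natWrites_insertCur : insertCur.natWrites = [xLo, xHi, xV, xFresh, aNext, aItem,
    aHead,
  xV, xFresh, aNext, aItem, aHead, xLo, xHi, xV, xC, aWin, xV, xC, xE, aWin, aWin] := rfl

@[simp] theorem realWrites_insertCur : insertCur.realWrites = [] := rfl

/-- The invariant of the insertion into stacks. -/
structure InsertInv (s₀ : State) (N x b : ℕ) (D : ℕ → Prop) (l : List ℕ) (s : State) : Prop where
  leaf : s.nat xLeaf = s₀.nat xLeaf
  cur : s.nat xCur = s₀.nat xCur
  yPos : s.nat aYPos = s₀.nat aYPos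
  win : s.nat aWin = s₀.nat aWin
  real : s.real = s₀.real
  pushing : ∃ stk, stackSize N stk + l.length ≤ b ∧
    Pushing N D (s₀.nat aYPos) (fun d => s₀.nat aYPos (s₀.nat aTrees 0 + d)) (s₀.real rRight)
      (s₀.nat aWin) x (s.nat aHead) (s.nat aNext) (s.nat aItem) (s.nat xFresh 0) stk l

/-- The hypothesis `hnr` keeps the stacks sorted, and `hinj` says that the leaf of `x` is free. The
interval has at most `2 * (b + 1)` canonical nodes, which limits the growth of the potential. -/
theorem runs_insertCur {s₀ : State} {N b x : ℕ} {D : ℕ → Prop} {stk : ℕ → List ℕ}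
    (hN : s₀.nat xLeaf 0 = N) (hx : s₀.nat xCur 0 = x) (hb : 2 * N ≤ 2 ^ b)
    (h : s₀.Stores N D stk) (hxD : ¬ D x) (hx0 : x ≠ 0)
    (hxE : s₀.nat aYPos x ≤ s₀.nat aYPos (s₀.nat aTrees 0 + x))
    (hxN : s₀.nat aYPos (s₀.nat aTrees 0 + x) < N)
    (hnr : ∀ d, s₀.IsAlive N d → s₀.nat aYPos d ≤ s₀.nat aYPos (s₀.nat aTrees 0 + x) →
      s₀.nat aYPos x ≤ s₀.nat aYPos (s₀.nat aTrees 0 + d) → s₀.real rRight x ≤ s₀.real rRight d)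
    (hinj : ∀ d, s₀.IsAlive N d → s₀.nat aYPos d ≠ s₀.nat aYPos x) :
    Runs insertCur s₀ (500 * b + 500) fun s _ => ∃ stk',
      stackSize N stk' ≤ stackSize N stk + 2 * (b + 1) ∧ s.Stores N (fun d => D d ∨ d = x) stk' ∧
      ∀ e, s.IsAlive N e ↔ s₀.IsAlive N e ∨ e = x := by
  refine .step (by simp [setRange]) (k := 500 * b + 470)
    (by have : setRange.time = 21 := rfl
        omega) fun s₁ hf₁ hs₁ => ?_
  have hlo : s₁.nat xLo 0 = N + s₀.nat aYPos x := by simp [hs₁, setRange, hN, hx]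
  have hhi : s₁.nat xHi 0 = N + s₀.nat aYPos (s₀.nat aTrees 0 + x) + 1 := by
    simp [hs₁, setRange, hN, hx]
  have hlt : N + s₀.nat aYPos (s₀.nat aTrees 0 + x) + 1 < 2 ^ (b + 1) := by rw [pow_succ]; omega
  have key := runs_canonLoop (body := pushCur) (s₀ := s₁) (k := b + 1) (by simp [pushCur])
    (by simp [pushCur]) (by simp [pushCur])
    -- Each push turns a node still to be visited into a stack entry, so the sum of both counts does
    -- not grow.
    (InsertInv s₀ N x (stackSize N stk + 2 * (b + 1)) D)
    (fun l s a y ha hI => by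
      obtain ⟨h1, h2, h3, h4, h5, h6⟩ := hI
      rcases ha with rfl | rfl | rfl <;> refine ⟨?_, ?_, ?_, ?_, ?_, ?_⟩ <;> simpa)
    (fun v l s hI hv => by
      obtain ⟨h1, h2, h3, h4, h5, stk', h6, h7⟩ := hI
      have hpush := h7.push (fun d hd => (h.mem d hd).2.2) hxN hnr
      have hv2 := ((h7.rest v (List.mem_cons_self ..)).pos hxN).2
      refine ⟨by simp [pushCur, h1], by simp [pushCur, h2], by simp [pushCur, h3],
        by simp [pushCur, h4], by simp [pushCur, h5], Function.update stk' v (x :: stk' v), ?_, ?_⟩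
      · have := stackSize_update hv2 stk' (x :: stk' v)
        simp only [List.length_cons] at this h6
        omega
      · simpa [pushCur, hv, h2, hx] using hpush)
    (by
      rw [hlo, hhi]
      refine ⟨hf₁.nat _ (by simp), hf₁.nat _ (by simp), hf₁.nat _ (by simp), hf₁.nat _ (by simp),
        funext fun a => hf₁.real _ (by simp [setRange]), stk, ?_, ?_⟩
      · have := length_canon_le (lo := N + s₀.nat aYPos x) hlt
        omega
      · rw [hf₁.nat aHead (by simp), hf₁.nat aNext (by simp), hf₁.nat aItem (by simp),
          hf₁.nat xFresh (by simp)]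
        exact Store.pushing h hxD)
    (by rw [hhi]; exact hlt)
  have hbudget : (2 * pushCur.time + 150) * (b + 1) + 20 ≤ 300 * b + 340 := by
    simp [pushCur]; omega
  refine .call (key.mono hbudget) (k := 200 * b + 40) (by omega) fun s₂ hf₂ hI => ?_
  obtain ⟨h1, h2, h3, h4, h5, stk', h6, h7⟩ := hI
  have ht₂ : s₂.nat aTrees = s₀.nat aTrees := by
    rw [hf₂.nat _ (by simp [canonLoop, pushCur]), hf₁.nat _ (by simp)]
  refine .step (by simp) (k := 200 * b + 20) (by simp; omega) fun s₃ hf₃ hs₃ => ?_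
  refine (runs_updateTree (N := N) (b := b) ?_ ?_ ?_ hb).imp fun s₄ k hf₄ hs₄ => ?_
  · rw [hs₃]
    simpa [h5, h4] using h.tournament
  · simp [hs₃, h1, hN]
  · simp [hs₃, h1, hN, h2, hx, h3]
    omega
  · have hw : ∀ u, N ≤ u → s₄.nat aWin u =
        Function.update (s₀.nat aWin) (N + s₀.nat aYPos x) x u := fun u hu => by
      rw [hs₄.2 u hu]
      simp [hs₃, h1, hN, h2, hx, h3, h4]
    have hT : IsTournament N (s₀.real rRight) (s₄.nat aWin) := by
      have := hs₄.1
      rw [hs₃] at this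
      simpa [h5] using this
    have hst := h7.store (w' := s₄.nat aWin) h.leaf h.mem hx0 hxE hxN hinj hT hw
    refine ⟨stk', by simpa using h6, ?_, fun e => ?_⟩
    · unfold State.Stores
      have e0 : s₄.real = s₀.real := by
        funext a; rw [hf₄.real _ (by simp), hf₃.real _ (by simp), h5]
      rw [e0, hf₄.nat aYPos (by simp), hf₃.nat aYPos (by simp), h3, hf₄.nat aTrees (by simp),
        hf₃.nat aTrees (by simp), ht₂, hf₄.nat aHead (by simp), hf₃.nat aHead (by simp),
        hf₄.nat aNext (by simp), hf₃.nat aNext (by simp), hf₄.nat aItem (by simp),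
        hf₃.nat aItem (by simp), hf₄.nat xFresh (by simp), hf₃.nat xFresh (by simp)]
      exact hst
    · unfold State.IsAlive
      rw [hf₄.nat aYPos (by simp), hf₃.nat aYPos (by simp), h3]
      exact alive_insert_iff hx0 (by omega) hinj hw e

end RealRAM


/-! ### Families of boxes during the sweep -/

/-- Left ends, negated right ends, and the positions of the lower and upper ends of boxes. -/
structure BoxData where
  left : ℕ → ℝ
  right : ℕ → ℝ
  low : ℕ → ℕ
  high : ℕ → ℕ

/-- The box with number `d`, where `K (P p)` is the `y`-coordinate with position `p`. -/
def BoxData.box (B : BoxData) (K : ℕ → ℝ) (P : ℕ → ℕ) (d : ℕ) : Set (ℝ × ℝ) :=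
  Set.Icc (B.left d, K (P (B.low d))) (-B.right d, K (P (B.high d)))

/-- The positions `p < 2 * m` list the lower ends `1, …, m` and the upper ends `m + 1, …, 2 * m` of
boxes in the order of their coordinates. -/
structure Ranking (m : ℕ) (K : ℕ → ℝ) (P : ℕ → ℕ) : Prop where
  mono : ∀ p q, p ≤ q → q < 2 * m → K (P p) ≤ K (P q)
  le : ∀ p q, p < 2 * m → q < 2 * m → P p ≤ m → m < P q → K (P p) ≤ K (P q) → p ≤ q

/-- Ties are broken by number, and lower ends have smaller numbers than upper ends. So a lower end
precedes an upper end at the same height, as is right for closed intervals that touch. -/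
theorem IsSorting.ranking {m : ℕ} {K : ℕ → ℝ} {P J : ℕ → ℕ} (h : IsSorting K (2 * m) P J) :
    Ranking m K P := by
  refine ⟨fun p q hpq hq => (h.lexLE p q hpq hq).key_le, fun p q hp hq hpm hqm hK => ?_⟩
  by_contra hlt
  rcases h.lexLE q p (by omega) hp with h1 | h1
  · linarith
  · omega

/-- The box `d` is well-formed. -/
structure BoxData.Valid (B : BoxData) (m : ℕ) (P : ℕ → ℕ) (d : ℕ) : Prop where
  pos : 1 ≤ d
  le : d ≤ m
  left_le : B.left d ≤ -B.right d
  low_le : B.low d ≤ B.high d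
  high_lt : B.high d < 2 * m
  lower : P (B.low d) ≤ m
  upper : m < P (B.high d)

/-- The boxes `d` and `x` meet, provided that `d` does not start to the right of `x`. -/
def BoxData.Hits (B : BoxData) (x d : ℕ) : Prop :=
  B.low d ≤ B.high x ∧ B.low x ≤ B.high d ∧ B.right d + B.left x ≤ 0

section

variable {m : ℕ} {K : ℕ → ℝ} {P : ℕ → ℕ} {B B' : BoxData} {d x : ℕ}

theorem BoxData.Valid.le_corner (hR : Ranking m K P) (h : B.Valid m P d) :
    (B.left d, K (P (B.low d))) ≤ (-B.right d, K (P (B.high d))) :=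
  ⟨h.left_le, hR.mono _ _ h.low_le h.high_lt⟩

/-- A common point puts each lower end at or below the other upper end, which `Ranking.le` transfers
to positions. It also lies between the left end of `x` and the right end of `d`. -/
theorem BoxData.disjoint_box (hR : Ranking m K P) (hd : B.Valid m P d) (hx : B.Valid m P x)
    (h : ¬ B.Hits x d) : Disjoint (B.box K P d) (B.box K P x) := by
  rw [Set.disjoint_left]
  rintro p ⟨⟨h1, h2⟩, ⟨h3, h4⟩⟩ ⟨⟨h5, h6⟩, ⟨h7, h8⟩⟩
  dsimp only at h1 h2 h3 h4 h5 h6 h7 h8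
  refine h ⟨hR.le _ _ (hd.low_le.trans_lt hd.high_lt) hx.high_lt hd.lower hx.upper (h2.trans h8),
    hR.le _ _ (hx.low_le.trans_lt hx.high_lt) hd.high_lt hx.lower hd.upper (h6.trans h4), ?_⟩
  linarith

/-- The hypothesis `hl` is the one inequality that `Hits` does not test. The coordinatewise maximum
of the two lower left corners is then a common point. -/
theorem BoxData.inter_nonempty (hR : Ranking m K P) (hd : B.Valid m P d) (hx : B.Valid m P x)
    (h : B.Hits x d) (hl : B.left d ≤ -B.right x) : (B.box K P d ∩ B.box K P x).Nonempty := by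
  obtain ⟨h1, h2, h3⟩ := h
  have e1 := hR.mono _ _ h1 hx.high_lt
  have e2 := hR.mono _ _ h2 hd.high_lt
  have e3 := (hd.le_corner hR).2
  have e4 := (hx.le_corner hR).2
  dsimp only at e3 e4
  have := hd.left_le
  have := hx.left_le
  refine ⟨(max (B.left d) (B.left x), max (K (P (B.low d))) (K (P (B.low x)))),
    ⟨⟨le_max_left _ _, le_max_left _ _⟩, ⟨max_le ?_ ?_, max_le ?_ ?_⟩⟩,
    ⟨⟨le_max_right _ _, le_max_right _ _⟩, ⟨max_le ?_ ?_, max_le ?_ ?_⟩⟩⟩ <;> dsimp only <;>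
    linarith

/-- The boxes `B'` arise from `B` by absorbing the box `d` into the box `x`. -/
structure BoxData.IsMerge (m : ℕ) (B B' : BoxData) (d x : ℕ) : Prop where
  left : B'.left x = min (B.left d) (B.left x)
  right : B'.right x = min (B.right d) (B.right x)
  low : B'.low x = min (B.low d) (B.low x)
  high : B'.high x = max (B.high d) (B.high x)
  left_of_ne : ∀ e, e ≠ x → B'.left e = B.left e
  right_of_ne : ∀ e, e ≠ x → B'.right e = B.right e
  low_of_ne : ∀ e ≤ m, e ≠ x → B'.low e = B.low e
  high_of_ne : ∀ e, 1 ≤ e → e ≠ x → B'.high e = B.high e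

theorem BoxData.IsMerge.valid (h : B.IsMerge m B' d x) (hd : B.Valid m P d) (hx : B.Valid m P x) :
    B'.Valid m P x := by
  refine ⟨hx.pos, hx.le, ?_, ?_, ?_, ?_, ?_⟩
  · rw [h.left, h.right]
    have := hx.left_le
    linarith [min_le_right (B.left d) (B.left x), min_le_right (B.right d) (B.right x)]
  · rw [h.low, h.high]
    exact (min_le_right _ _).trans (hx.low_le.trans (le_max_right _ _))
  · rw [h.high]
    exact max_lt hd.high_lt hx.high_lt
  · rw [h.low]
    rcases min_choice (B.low d) (B.low x) with e | e <;> rw [e]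
    exacts [hd.lower, hx.lower]
  · rw [h.high]
    rcases max_choice (B.high d) (B.high x) with e | e <;> rw [e]
    exacts [hd.upper, hx.upper]

theorem BoxData.IsMerge.valid_of_ne (h : B.IsMerge m B' d x) {e : ℕ} (he : B.Valid m P e)
    (hex : e ≠ x) :
    B'.Valid m P e := by
  obtain ⟨h1, h2, h3, h4, h5, h6, h7⟩ := he
  refine ⟨h1, h2, ?_, ?_, ?_, ?_, ?_⟩
  · rwa [h.left_of_ne e hex, h.right_of_ne e hex]
  · rwa [h.low_of_ne e h2 hex, h.high_of_ne e h1 hex]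
  · rwa [h.high_of_ne e h1 hex]
  · rwa [h.low_of_ne e h2 hex]
  · rwa [h.high_of_ne e h1 hex]

theorem BoxData.IsMerge.box_of_ne (h : B.IsMerge m B' d x) {e : ℕ} (he : B.Valid m P e)
    (hex : e ≠ x) :
    B'.box K P e = B.box K P e := by
  unfold BoxData.box
  rw [h.left_of_ne e hex, h.right_of_ne e hex, h.low_of_ne e he.le hex, h.high_of_ne e he.pos hex]

theorem Ranking.map_min (hR : Ranking m K P) {p q : ℕ} (hp : p < 2 * m) (hq : q < 2 * m) :
    K (P (min p q)) = min (K (P p)) (K (P q)) := by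
  rcases le_total p q with h | h
  · rw [min_eq_left h, min_eq_left (hR.mono _ _ h hq)]
  · rw [min_eq_right h, min_eq_right (hR.mono _ _ h hp)]

theorem Ranking.map_max (hR : Ranking m K P) {p q : ℕ} (hp : p < 2 * m) (hq : q < 2 * m) :
    K (P (max p q)) = max (K (P p)) (K (P q)) := by
  rcases le_total p q with h | h
  · rw [max_eq_right h, max_eq_right (hR.mono _ _ h hq)]
  · rw [max_eq_left h, max_eq_left (hR.mono _ _ h hp)]

theorem BoxData.IsMerge.box (hR : Ranking m K P) (h : B.IsMerge m B' d x) (hd : B.Valid m P d)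
    (hx : B.Valid m P x) :
    boundingBox (B.box K P d ∪ B.box K P x) = B'.box K P x := by
  unfold BoxData.box
  rw [boundingBox_union_Icc (hd.le_corner hR) (hx.le_corner hR), h.left, h.right, h.low, h.high,
    hR.map_min (hd.low_le.trans_lt hd.high_lt) (hx.low_le.trans_lt hx.high_lt),
    hR.map_max hd.high_lt hx.high_lt]
  congr 1
  ext
  · exact max_neg_neg _ _
  · rfl

/-- The invariant of the sweep: `A` are the boxes in the store, which are pairwise disjoint, and
`X` are the other ones. -/
structure Sweep (ℬ : Set (Set (ℝ × ℝ))) (m : ℕ) (K : ℕ → ℝ) (P : ℕ → ℕ) (B : BoxData)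
    (A X : ℕ → Prop) : Prop where
  cover : LowerCover ℬ {C | ∃ d, (A d ∨ X d) ∧ C = B.box K P d}
  valid : ∀ d, A d ∨ X d → B.Valid m P d
  inj : ∀ d e, A d ∨ X d → A e ∨ X e → B.low d = B.low e → d = e
  disjoint : ∀ d e, A d → A e → d ≠ e → Disjoint (B.box K P d) (B.box K P e)
  sep : ∀ d, A d → ¬ X d

variable {ℬ : Set (Set (ℝ × ℝ))} {A A' X X' : ℕ → Prop}

/-- The box `x` is outside the store, so the disjointness of the stored boxes is not affected by its
growth; that the family remains a lower cover is `LowerCover.merge`. -/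
theorem Sweep.merge (hR : Ranking m K P) (h : Sweep ℬ m K P B A X) (hd : A d) (hx : X x)
    (hdx : B.Hits x d) (hl : B.left d ≤ -B.right x) (hM : B.IsMerge m B' d x)
    (hA : ∀ e, A' e ↔ A e ∧ e ≠ d) : Sweep ℬ m K P B' A' X := by
  have hne : d ≠ x := fun e => h.sep d hd (e ▸ hx)
  have hvd := h.valid d (.inl hd)
  have hvx := h.valid x (.inr hx)
  have hAx : ∀ e, A' e → e ≠ x := fun e he hex => h.sep e ((hA e).1 he).1 (hex ▸ hx)
  have hact : ∀ e, A' e ∨ X e → (A e ∨ X e) ∧ e ≠ d := fun e he => by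
    rcases he with he | he
    · exact ⟨.inl ((hA e).1 he).1, ((hA e).1 he).2⟩
    · exact ⟨.inr he, fun hed => h.sep d hd (hed ▸ he)⟩
  refine ⟨?_, fun e he => ?_, fun e e' he he' hee' => ?_, fun e e' he he' hee' => ?_, fun e he =>
    h.sep e ((hA e).1 he).1⟩
  -- Different numbers may denote the same box, so the new family can still contain the old boxes of
  -- `d` and `x`. The hypotheses of `LowerCover.merge` allow for this.
  · refine h.cover.merge (A := B.box K P d) (B := B.box K P x) ⟨d, .inl hd, rfl⟩ ⟨x, .inr hx, rfl⟩
      (BoxData.inter_nonempty hR hvd hvx hdx hl) ⟨x, .inr hx, hM.box hR hvd hvx⟩ ?_ ?_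
    · rintro C ⟨e, he, rfl⟩
      by_cases hed : e = d
      · exact .inr (.inl (by rw [hed]))
      by_cases hex : e = x
      · exact .inr (.inr (by rw [hex]))
      refine .inl ⟨e, he.imp_left fun he => (hA e).2 ⟨he, hed⟩, ?_⟩
      rw [hM.box_of_ne (h.valid e he) hex]
    · rintro C ⟨e, he, rfl⟩
      by_cases hex : e = x
      · subst hex
        exact .inr (hM.box hR hvd hvx).symm
      · exact .inl ⟨e, (hact e he).1, hM.box_of_ne (h.valid e (hact e he).1) hex⟩
  · by_cases hex : e = x
    · subst hex
      exact hM.valid hvd hvx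
    · exact hM.valid_of_ne (h.valid e (hact e he).1) hex
  · obtain ⟨h1, h2⟩ := hact e he
    obtain ⟨h3, h4⟩ := hact e' he'
    -- The enlarged box takes over the lower position of `d` or keeps its own. As `d` is no longer
    -- active, the position remains unique.
    have key : ∀ f, (A f ∨ X f) → f ≠ d → f ≠ x → B'.low f ≠ B'.low x := fun f hf hfd hfx => by
      rw [hM.low_of_ne f (h.valid f hf).le hfx, hM.low]
      rcases min_choice (B.low d) (B.low x) with e | e <;> rw [e]
      · exact fun h' => hfd (h.inj f d hf (.inl hd) h')
      · exact fun h' => hfx (h.inj f x hf (.inr hx) h')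
    by_cases hex : e = x
    · by_cases hex' : e' = x
      · rw [hex, hex']
      · subst hex
        exact absurd hee'.symm (key e' h3 h4 hex')
    · by_cases hex' : e' = x
      · subst hex'
        exact absurd hee' (key e h1 h2 hex)
      · rw [hM.low_of_ne e (h.valid e h1).le hex, hM.low_of_ne e' (h.valid e' h3).le hex'] at hee'
        exact h.inj e e' h1 h3 hee'
  · have h1 := (hA e).1 he
    have h2 := (hA e').1 he'
    rw [hM.box_of_ne (h.valid e (.inl h1.1)) (hAx e he),
      hM.box_of_ne (h.valid e' (.inl h2.1)) (hAx e' he')]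
    exact h.disjoint e e' h1.1 h2.1 hee'

theorem Sweep.insert (hR : Ranking m K P) (h : Sweep ℬ m K P B A X) (hx : X x)
    (hdx : ∀ d, A d → ¬ B.Hits x d) (hA : ∀ e, A' e ↔ A e ∨ e = x)
    (hX : ∀ e, X' e ↔ X e ∧ e ≠ x) : Sweep ℬ m K P B A' X' := by
  have hact : ∀ e, A' e ∨ X' e ↔ A e ∨ X e := fun e => by
    rw [hA, hX]
    by_cases hex : e = x
    · subst hex; simp [hx]
    · simp [hex]
  refine ⟨by simpa only [hact] using h.cover, fun d hd => h.valid d ((hact d).1 hd),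
    fun d e hd he => h.inj d e ((hact d).1 hd) ((hact e).1 he), fun d e hd he hde => ?_,
    fun d hd hd' => ?_⟩
  · rcases (hA d).1 hd with hd | rfl <;> rcases (hA e).1 he with he | rfl
    · exact h.disjoint d e hd he hde
    · exact BoxData.disjoint_box hR (h.valid d (.inl hd)) (h.valid e (.inr hx)) (hdx d hd)
    · exact (BoxData.disjoint_box hR (h.valid e (.inl he)) (h.valid d (.inr hx)) (hdx e he)).symm
    · exact absurd rfl hde
  · rw [hX] at hd'
    rcases (hA d).1 hd with hd | rfl
    · exact h.sep d hd hd'.1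
    · exact hd'.2 rfl

end


namespace RealRAM

/-! ### The sweep -/

/-- The boxes in the memory. -/
def State.boxes (s : State) : BoxData :=
  ⟨s.real rLeft, s.real rRight, s.nat aYPos, fun d => s.nat aYPos (s.nat aTrees 0 + d)⟩

/-- Enlarge the box `xCur` so that it contains the box `xD`. -/
def enlarge : Prog :=
  .ite (.realLe (.load rLeft (.var xD)) (.load rLeft (.var xCur)))
    (.setReal rLeft (.var xCur) (.load rLeft (.var xD))) .skip ;;
  .ite (.realLe (.load rRight (.var xD)) (.load rRight (.var xCur)))
    (.setReal rRight (.var xCur) (.load rRight (.var xD))) .skip ;;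
  .ite (.natLe (.low (.var xD)) (.low (.var xCur)))
    (.setNat aYPos (.var xCur) (.low (.var xD))) .skip ;;
  .ite (.natLe (.high (.var xCur)) (.high (.var xD)))
    (.setNat aYPos (.add (.var aTrees) (.var xCur)) (.high (.var xD))) .skip

@[simp] theorem natWrites_enlarge : enlarge.natWrites = [aYPos, aYPos] := rfl

@[simp] theorem realWrites_enlarge : enlarge.realWrites = [rLeft, rRight] := rfl

theorem update_min {α β : Type*} [LinearOrder α] [DecidableEq β] (f : β → α) (d x : β)
    [Decidable (f d ≤ f x)] :
    (if f d ≤ f x then Function.update f x (f d) else f) = Function.update f x (min (f d) (f x)) :=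
    by
  split_ifs with h
  · rw [min_eq_left h]
  · rw [min_eq_right (not_le.1 h).le, Function.update_eq_self]

theorem runs_enlarge {s : State} {m d x : ℕ} (hm : s.nat aTrees 0 = m) (hd : s.nat xD 0 = d)
    (hx : s.nat xCur 0 = x) (hdm : d ≤ m) (hxm : x ≤ m) (hx0 : 1 ≤ x) (hd0 : 1 ≤ d) :
    Runs enlarge s 150 fun s' _ => s.boxes.IsMerge m s'.boxes d x := by
  refine .step (by simp) (k := 120) (by simp) fun s₁ hf₁ hs₁ => ?_
  have h1 : s₁.real rLeft = Function.update (s.real rLeft) x (min (s.real rLeft d) (s.real rLeft x))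
      := by
    rw [hs₁, ← update_min, Prog.run]
    simp only [Test.holds, RExp.eval, NExp.eval_var, hd, hx]
    split_ifs <;> simp [hd, hx]
  refine .step (by simp) (k := 90) (by simp) fun s₂ hf₂ hs₂ => ?_
  have h2 : s₂.real rRight =
      Function.update (s.real rRight) x (min (s.real rRight d) (s.real rRight x)) := by
    have e1 : s₁.real rRight = s.real rRight := hf₁.real _ (by simp)
    have e2 : s₁.nat = s.nat := funext fun a => hf₁.nat a (by simp)
    rw [hs₂, ← update_min, Prog.run]
    simp only [Test.holds, RExp.eval, NExp.eval_var, hd, hx, e1, e2]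
    split_ifs <;> simp [hd, hx, e1, e2]
  refine .step (by simp) (k := 60) (by simp) fun s₃ hf₃ hs₃ => ?_
  have e2 : s₂.nat = s.nat :=
    funext fun a => (hf₂.nat a (by simp)).trans (hf₁.nat a (by simp))
  have h3 : s₃.nat aYPos =
      Function.update (s.nat aYPos) x (min (s.nat aYPos d) (s.nat aYPos x)) := by
    rw [hs₃, ← update_min, Prog.run]
    simp only [Test.holds, NExp.eval_low, NExp.eval_var, hd, hx, e2]
    split_ifs <;> simp [hd, hx, e2]
  have e3 : ∀ a, a ≠ aYPos → s₃.nat a = s.nat a := fun a ha => by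
    rw [hf₃.nat a (by simpa using ha), e2]
  refine .loopFree (by simp) (k := 0) (by simp) ?_
  generalize hs₄ : Prog.run _ s₃ = s₄
  have h4 : s₄.nat aYPos = Function.update (s₃.nat aYPos) (m + x)
      (max (s.nat aYPos (m + d)) (s.nat aYPos (m + x))) := by
    -- Lower positions are stored in the cells `1, …, m` and upper ones in the cells `m + 1, …, 2 *
    -- m`, so the update of cell `x` does not interfere.
    have e4 : s₃.nat aYPos (m + d) = s.nat aYPos (m + d) := by
      rw [h3, Function.update_of_ne (by omega)]
    have e5 : s₃.nat aYPos (m + x) = s.nat aYPos (m + x) := by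
      rw [h3, Function.update_of_ne (by omega)]
    rw [← e4, ← e5, ← hs₄]
    by_cases hle : s₃.nat aYPos (m + x) ≤ s₃.nat aYPos (m + d)
    · rw [Prog.run_ite_pos (by simpa [e3, hd, hx, hm] using hle), max_eq_left hle]
      simp [e3, hd, hx, hm]
    · rw [Prog.run_ite_neg (by simpa [e3, hd, hx, hm] using hle), max_eq_right (not_le.1 hle).le,
        Function.update_eq_self]
      rfl
  have hf₄ : Frame enlarge s s₄ := by
    obtain ⟨t, -, h⟩ := Prog.LoopFree.exec (p := enlarge) (by simp [enlarge]) s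
    have : enlarge.run s = s₄ := by
      rw [← hs₄, hs₃, hs₂, hs₁]; rfl
    rw [← this]
    exact h.frame
  have hr : s₄.real = s₃.real := by
    rw [← hs₄]
    exact funext fun a => (Prog.LoopFree.frame_run (by simp) s₃).real a (by simp)
  have hL : s₄.real rLeft = s₁.real rLeft := by
    rw [hr, hf₃.real _ (by simp), hf₂.real _ (by simp)]
  have hR : s₄.real rRight = s₂.real rRight := by rw [hr, hf₃.real _ (by simp)]
  have ht : s₄.nat aTrees 0 = m := by rw [hf₄.nat _ (by simp), hm]
  constructor
  · simp [State.boxes, hL, h1]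
  · simp [State.boxes, hR, h2]
  · simp only [State.boxes, h4, h3]
    rw [Function.update_of_ne (by omega), Function.update_self]
  · simp [State.boxes, h4, ht, hm]
  · intro e he
    simp [State.boxes, hL, h1, he]
  · intro e he
    simp [State.boxes, hR, h2, he]
  · intro e he hex
    simp only [State.boxes, h4, h3]
    rw [Function.update_of_ne (by omega), Function.update_of_ne hex]
  · intro e he hex
    simp only [State.boxes, h4, h3, ht, hm]
    rw [Function.update_of_ne (by omega), Function.update_of_ne (by omega)]

/-! ### Absorbing stored boxes -/

/-- Absorb boxes into the box `xCur` as long as there is one that it hits. -/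
def absorb : Prog :=
  .while (.not (.natEq (.var xD) (.const 0)))
    (search ;; .ite (.natEq (.var xD) (.const 0)) .skip (remove ;; enlarge))

@[simp] theorem natWrites_absorb : absorb.natWrites =
    search.natWrites ++ (remove.natWrites ++ enlarge.natWrites) := rfl

@[simp] theorem realWrites_absorb : absorb.realWrites = [rLeft, rRight] := rfl

/-- The invariant of the sweep in terms of the memory. The boxes in `F` are in the store, those in
`D` have been there, and those in `X` have not. -/
structure SweepInv (ℬ : Set (Set (ℝ × ℝ))) (m N : ℕ) (K : ℕ → ℝ) (P : ℕ → ℕ) (D X : ℕ → Prop)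
    (s : State) (stk : ℕ → List ℕ) (F : Finset ℕ) : Prop where
  stores : s.Stores N D stk
  alive : ∀ e, s.IsAlive N e ↔ e ∈ F
  sweep : Sweep ℬ m K P s.boxes (· ∈ F) X
  low_lt : ∀ d, 1 ≤ d → d ≤ m → s.nat aYPos d < N

theorem SweepInv.congr {ℬ : Set (Set (ℝ × ℝ))} {m N : ℕ} {K : ℕ → ℝ} {P : ℕ → ℕ} {D X : ℕ → Prop}
    {s s' : State} {stk stk' : ℕ → List ℕ} {F : Finset ℕ} (h : SweepInv ℬ m N K P D X s stk F)
    (hy : s'.nat aYPos = s.nat aYPos) (ht : s'.nat aTrees = s.nat aTrees)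
    (hw : s'.nat aWin = s.nat aWin) (hr : s'.real = s.real) (hS : s'.Stores N D stk') :
    SweepInv ℬ m N K P D X s' stk' F := by
  refine ⟨hS, fun e => ?_, ?_, ?_⟩
  · rw [← h.alive, State.IsAlive, State.IsAlive, hy, hw]
  · have : s'.boxes = s.boxes := by simp only [State.boxes, hr, hy, ht]
    rw [this]
    exact h.sweep
  · rw [hy]
    exact h.low_lt

theorem SweepInv.hits_iff {ℬ : Set (Set (ℝ × ℝ))} {m N : ℕ} {K : ℕ → ℝ} {P : ℕ → ℕ} {D X : ℕ → Prop}
    {s : State} {stk : ℕ → List ℕ} {F : Finset ℕ} (h : SweepInv ℬ m N K P D X s stk F) {x d : ℕ} :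
    s.Hits N x d ↔ d ∈ F ∧ s.boxes.Hits x d := by
  rw [← h.alive]
  exact ⟨fun h => ⟨h.1, h.2, h.3, h.4⟩, fun h => ⟨h.1, h.2.1, h.2.2.1, h.2.2.2⟩⟩

/-- One round of absorption. -/
theorem runs_absorb_found {ℬ : Set (Set (ℝ × ℝ))} {m N b d x : ℕ} {K : ℕ → ℝ} {P : ℕ → ℕ}
    {D X : ℕ → Prop} {s : State} {stk : ℕ → List ℕ} {F : Finset ℕ}
    (hR : Ranking m K P) (h : SweepInv ℬ m N K P D X s stk F)
    (hN : s.nat xLeaf 0 = N) (hm : s.nat aTrees 0 = m) (hx : s.nat xCur 0 = x) (hd : s.nat xD 0 = d)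
    (hb : 2 * N ≤ 2 ^ b) (hD : ∀ d, D d → 1 ≤ d ∧ d ≤ m) (hxD : ¬ D x) (hxX : X x)
    (hhit : s.Hits N x d) (hl : s.real rLeft d ≤ -s.real rRight x) :
    Runs (remove ;; enlarge) s (200 * b + 200) fun s' _ =>
      SweepInv ℬ m N K P D X s' stk (F.erase d) ∧ s.boxes.IsMerge m s'.boxes d x := by
  have hdF := (h.alive d).1 hhit.alive
  have hvd := h.sweep.valid d (.inl hdF)
  have hvx := h.sweep.valid x (.inr hxX)
  refine .call (runs_remove hN hd hb h.stores hhit.alive) (k := 150) (by omega)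
    fun s₁ hf₁ ⟨hS₁, hA₁⟩ => ?_
  have hB : s₁.boxes = s.boxes := by
    simp only [State.boxes, hf₁.real rLeft (by simp), hf₁.real rRight (by simp),
      hf₁.nat aYPos (by simp), hf₁.nat aTrees (by simp)]
  refine (runs_enlarge (m := m) (d := d) (x := x) (by rw [hf₁.nat _ (by simp), hm])
    (by rw [hf₁.nat _ (by simp), hd]) (by rw [hf₁.nat _ (by simp), hx]) hvd.le hvx.le hvx.pos
    hvd.pos).imp fun s₂ k hf₂ hM => ?_
  have hDx : ∀ e, D e → e ≠ x := fun e he hex => hxD (hex ▸ he)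
  have ht₂ : s₂.nat aTrees 0 = s₁.nat aTrees 0 := by rw [hf₂.nat _ (by simp)]
  -- Enlarging changes the data of `x` only, and `x` has never been in the store, so even the dead
  -- entries on the stacks keep their data.
  obtain ⟨h1, h2⟩ := Store.congr hS₁ (S' := s₂.nat aYPos)
    (E' := fun d => s₂.nat aYPos (s₂.nat aTrees 0 + d)) (nr' := s₂.real rRight)
    (fun e he => hM.low_of_ne e (hD e he).2 (hDx e he))
    (fun e he => hM.high_of_ne e (hD e he).1 (hDx e he))
    (fun e he => hM.right_of_ne e (hDx e he))
  have hA₂ : ∀ e, s₂.IsAlive N e ↔ e ∈ F.erase d := fun e => by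
    have := h1 e
    rw [State.IsAlive, hf₂.nat aWin (by simp), this]
    refine (hA₁ e).trans ?_
    rw [h.alive, Finset.mem_erase, and_comm]
  refine ⟨⟨?_, hA₂, ?_, fun e he he' => ?_⟩, hB ▸ hM⟩
  · unfold State.Stores
    rwa [hf₂.nat aWin (by simp), hf₂.nat aHead (by simp), hf₂.nat aNext (by simp),
      hf₂.nat aItem (by simp), hf₂.nat xFresh (by simp)]
  · rw [hB] at hM
    exact h.sweep.merge hR hdF hxX (h.hits_iff.1 hhit).2 hl hM fun e => by
      rw [Finset.mem_erase, and_comm]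
  · have e1 : s₁.nat aYPos = s.nat aYPos := hf₁.nat _ (by simp)
    by_cases hex : e = x
    · subst hex
      have := hM.low
      simp only [State.boxes, e1] at this
      rw [this]
      exact (min_le_right _ _).trans_lt (h.low_lt e he he')
    · have := hM.low_of_ne e he' hex
      simp only [State.boxes, e1] at this
      rw [this]
      exact h.low_lt e he he'

/-- The number `ℓ` separates: every stored box starts at or before `ℓ`, and `x` always extends at
least to `ℓ`, so a hit is a true intersection even after `x` has grown. The initial value `1` of
`xD` only makes the loop start. -/
theorem runs_absorb {ℬ : Set (Set (ℝ × ℝ))} {m N b x r : ℕ} {K : ℕ → ℝ} {P : ℕ → ℕ}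
    {D X : ℕ → Prop} {s₀ : State} {stk : ℕ → List ℕ} {F : Finset ℕ} {ℓ : ℝ}
    (hR : Ranking m K P) (h : SweepInv ℬ m N K P D X s₀ stk F)
    (hN : s₀.nat xLeaf 0 = N) (hm : s₀.nat aTrees 0 = m) (hx : s₀.nat xCur 0 = x)
    (hd : s₀.nat xD 0 = 1) (hNm : 2 * m < N)
    (hb : 2 * N ≤ 2 ^ b) (hD : ∀ d, D d → 1 ≤ d ∧ d ≤ m) (hxD : ¬ D x) (hxX : X x)
    (hℓ : ∀ d ∈ F, s₀.real rLeft d ≤ ℓ) (hxℓ : s₀.real rLeft x ≤ ℓ) (hℓx : ℓ ≤ -s₀.real rRight x) :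
    Runs absorb s₀ (60 * stackSize N stk + (700 * b + 700) * F.card + 500 * b + 500 + r) fun s k =>
      ∃ stk' F', 60 * stackSize N stk' + (700 * b + 700) * F'.card + r ≤ k ∧
      SweepInv ℬ m N K P D X s stk' F' ∧ (∀ d ∈ F', ¬ s.boxes.Hits x d) ∧ F' ⊆ F ∧
      s.real rLeft x ≤ ℓ ∧ ∀ e, e ≠ x → s.real rLeft e = s₀.real rLeft e := by
  -- Each stored box holds `700 * b + 700` units, which pay for the search that finds it and for its
  -- absorption. The extra `500 * b + 500` pay for the final search, which finds nothing.
  refine Runs.while (fun s k => ∃ stk' F', 60 * stackSize N stk' + (700 * b + 700) * F'.card + r +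
    (if s.nat xD 0 = 0 then 10 else 500 * b + 500) ≤ k ∧
    SweepInv ℬ m N K P D X s stk' F' ∧ (s.nat xD 0 = 0 → ∀ d ∈ F', ¬ s.boxes.Hits x d) ∧ F' ⊆ F ∧
    s.real rLeft x ≤ ℓ ∧ ℓ ≤ -s.real rRight x ∧ ∀ e, e ≠ x → s.real rLeft e = s₀.real rLeft e) ?_
    ⟨stk, F, by rw [hd, if_neg (by simp)]; linarith, h, by simp [hd], subset_rfl, hxℓ, hℓx,
      fun _ _ => rfl⟩
  rintro s n hf ⟨stk, F', hn, hI, hno, hFF, hxℓ, hℓx, hL⟩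
  have hm' : s.nat aTrees 0 = m := by rw [hf.nat _ (by simp), hm]
  have hN' : s.nat xLeaf 0 = N := by rw [hf.nat _ (by simp), hN]
  have hx' : s.nat xCur 0 = x := by rw [hf.nat _ (by simp), hx]
  by_cases h0 : s.nat xD 0 = 0
  · rw [if_pos h0] at hn
    refine ⟨60 * stackSize N stk + (700 * b + 700) * F'.card + r, by simp; omega, fun hb => ?_,
      fun hb => ⟨stk, F', le_rfl, hI, hno h0, hFF, hxℓ, hL⟩⟩
    simp [h0] at hb
  · rw [if_neg h0] at hn
    refine ⟨60 * stackSize N stk + 500 * b + 400 + ((700 * b + 700) * F'.card + r + 40),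
      by simp; omega, fun _ => ?_, fun hb => ?_⟩
    · have hvx := hI.sweep.valid x (.inr hxX)
      have e1 := hvx.low_le
      have e2 := hvx.high_lt
      simp only [State.boxes] at e1 e2
      refine .seq (runs_search hN' hx' hb (fun d hd => ?_) hI.stores e1 (by omega)) ?_
      · have := hD d hd
        exact ⟨by omega, hI.low_lt d this.1 this.2⟩
      rintro s₁ k₁ hf₁ ⟨stk₁, hk₁, hS₁, hF₁, hF₁'⟩
      have hsame : SameStore s s₁ := ⟨hf₁.nat _ (by simp), hf₁.nat _ (by simp), hf₁.nat _ (by simp),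
        hf₁.nat _ (by simp), hf₁.nat _ (by simp), hf₁.nat _ (by simp), hf₁.nat _ (by simp),
        hf₁.nat _ (by simp), funext fun a => hf₁.real a (by simp)⟩
      have hI₁ := hI.congr hsame.yPos hsame.trees hsame.win hsame.real hS₁
      have hB₁ : s₁.boxes = s.boxes := by
        simp only [State.boxes, hsame.real, hsame.yPos, hsame.trees]
      refine (Runs.ite (n := 60 * stackSize N stk₁ + ((700 * b + 700) * F'.card + r + 30))
        (fun ht => ?_) fun ht => ?_).mono (by simp; omega)
      · simp at ht
        refine .loopFree (by simp) (k := 60 * stackSize N stk₁ + (700 * b + 700) * F'.card + r + 10)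
          (by simp; omega) ⟨stk₁, F', ?_, hI₁, fun _ d hd hh => ?_, hFF, ?_, ?_, ?_⟩
        · simp [ht]
        · refine hF₁' ht d (hI.hits_iff.2 ⟨hd, ?_⟩)
          rw [← hB₁]
          exact hh
        · simpa [hsame.real] using hxℓ
        · simpa [hsame.real] using hℓx
        · simpa [hsame.real] using hL
      · simp at ht
        have hh := hF₁ ht
        rw [← State.stores_congr hsame] at hh
        have hdF := (hI₁.hits_iff.1 hh).1
        obtain ⟨c, hc⟩ : ∃ c, F'.card = c + 1 :=
          ⟨F'.card - 1, by have := Finset.card_pos.2 ⟨_, hdF⟩; omega⟩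
        have hne : s₁.nat xD 0 ≠ x := fun e => hI.sweep.sep _ hdF (e ▸ hxX)
        have hlx : s₁.real rLeft (s₁.nat xD 0) ≤ ℓ := by
          rw [hsame.real, hL _ hne]
          exact hℓ _ (hFF hdF)
        refine ((runs_absorb_found hR hI₁ (by rw [hsame.leaf, hN']) (by rw [hsame.trees, hm'])
          (by rw [hsame.cur, hx']) rfl hb hD hxD hxX hh
          (hlx.trans (by rw [hsame.real]; exact hℓx))).left_over
          (k := 60 * stackSize N stk₁ + (700 * b + 700) * c + r + 500 * b + 500)
          fun s₂ hf₂ hs₂ => ⟨stk₁, F'.erase (s₁.nat xD 0), ?_, hs₂.1, fun h0 => ?_,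
            (Finset.erase_subset _ _).trans hFF, ?_, ?_, fun e he => ?_⟩).mono
              (by rw [hc]; linarith)
        · rw [Finset.card_erase_of_mem hdF, hc, if_neg]
          · simp; linarith
          · rw [hf₂.nat xD (by simp)]
            exact ht
        · rw [hf₂.nat xD (by simp)] at h0
          exact absurd h0 ht
        · have := hs₂.2.left
          simp only [State.boxes] at this
          rw [this]
          exact (min_le_left _ _).trans hlx
        · have := hs₂.2.right
          simp only [State.boxes] at this
          rw [this]
          have : min (s₁.real rRight (s₁.nat xD 0)) (s₁.real rRight x) ≤ s₁.real rRight x :=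
            min_le_right _ _
          rw [hsame.real] at this ⊢
          linarith
        · have := hs₂.2.left_of_ne e he
          simp only [State.boxes] at this
          rw [this, hsame.real]
          exact hL e he
    · simp [h0] at hb

end RealRAM


namespace RealRAM

/-! ### The main loop of the sweep -/

/-- Insert all boxes from left to right. -/
def sweepLoop : Prog :=
  .set xI (.const 0) ;;
  .while (.natLt (.var xI) (.var aTrees))
    ((.set xCur (.load aXKey (.var xI)) ;; .set xD (.const 1)) ;; absorb ;; insertCur ;;
      .set xI (.add (.var xI) (.const 1)))

@[simp] theorem natWrites_sweepLoop : sweepLoop.natWrites =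
    xI :: (xCur :: xD :: (absorb.natWrites ++ (insertCur.natWrites ++ [xI]))) := rfl

@[simp] theorem realWrites_sweepLoop : sweepLoop.realWrites = [rLeft, rRight] := rfl

theorem store_empty {N : ℕ} {S E : ℕ → ℕ} {nr : ℕ → ℝ} {w head next item : ℕ → ℕ} {f : ℕ}
    (hw : ∀ u, 0 < u → w u = 0) (hh : ∀ u, head u = 0) :
    (∀ d, ¬ Alive N S w d) ∧ Store N (fun _ => False) S E nr w head next item f fun _ => [] := by
  have hA : ∀ d, ¬ Alive N S w d := fun d ⟨h1, h2, h3⟩ => by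
    rw [hw _ (by omega)] at h3
    exact h1 h3.symm
  refine ⟨hA, fun v hv _ => ?_, fun p hp h => absurd (hw _ (by omega)) h, ⟨hh, by simp, by simp⟩,
    fun d hd => absurd hd (hA d), fun d hd => absurd hd (hA d), by simp⟩
  rw [hw v hv, hw _ (by omega), hw _ (by omega)]
  simp [better]

/-- Besides the sweep invariant, no stored box starts to the right of a box not yet processed. A
round costs two `O(b)` operations and adds at most one stored box and `2 * (b + 1)` stack entries to
the potential; `2000 * b + 3000` units cover all of this. -/
theorem runs_sweepLoop {ℬ : Set (Set (ℝ × ℝ))} {m N b : ℕ} {K : ℕ → ℝ} {P Q : ℕ → ℕ}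
    {J : ℕ → ℕ} {s₀ : State} (hR : Ranking m K P) (hN : s₀.nat xLeaf 0 = N)
    (hm : s₀.nat aTrees 0 = m) (hNm : 2 * m < N) (hb : 2 * N ≤ 2 ^ b) (hQ : s₀.nat aXKey = Q)
    (hsort : IsSorting (s₀.real rLeft) m Q J)
    (hw : ∀ u, 0 < u → s₀.nat aWin u = 0) (hh : ∀ u, s₀.nat aHead u = 0)
    (hlow : ∀ d, 1 ≤ d → d ≤ m → s₀.nat aYPos d < N)
    (hS : Sweep ℬ m K P s₀.boxes (fun _ => False) fun d => 1 ≤ d ∧ d ≤ m) :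
    Runs sweepLoop s₀ ((2000 * b + 3000) * m + 20) fun s _ => ∃ F : Finset ℕ,
      (∀ e, s.IsAlive N e ↔ e ∈ F) ∧ Sweep ℬ m K P s.boxes (· ∈ F) (fun _ => False) ∧
      ∀ d, 1 ≤ d → d ≤ m → s.nat aYPos d < N := by
  have hinj : ∀ i j, i < m → j < m → Q i = Q j → i = j := fun i j hi hj h => by
    rw [← (hsort.key i hi).2.2, ← (hsort.key j hj).2.2, h]
  refine .step (by simp) (k := (2000 * b + 3000) * m + 15) (by simp; omega) fun s₁ hf₁ hs₁ => ?_
  refine Runs.while (fun s k => ∃ i stk F, s.nat xI 0 = i ∧ i ≤ m ∧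
    60 * stackSize N stk + (700 * b + 700) * F.card + (2000 * b + 3000) * (m - i) + 15 ≤ k ∧
    SweepInv ℬ m N K P (fun d => ∃ j < i, Q j = d) (fun d => ∃ j, i ≤ j ∧ j < m ∧ Q j = d) s stk F ∧
    (∀ d ∈ F, ∀ j, i ≤ j → j < m → s.real rLeft d ≤ s.real rLeft (Q j)) ∧
    ∀ j k, i ≤ j → j ≤ k → k < m → s.real rLeft (Q j) ≤ s.real rLeft (Q k)) ?_ ?_
  · rintro s n hf ⟨i, stk, F, hi, him, hn, hI, hF, hL⟩
    have hN' : s.nat xLeaf 0 = N := by rw [hf.nat _ (by simp), hf₁.nat _ (by simp), hN]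
    have hm' : s.nat aTrees 0 = m := by rw [hf.nat _ (by simp), hf₁.nat _ (by simp), hm]
    have hQ' : s.nat aXKey = Q := by rw [hf.nat _ (by simp), hf₁.nat _ (by simp), hQ]
    refine ⟨60 * stackSize N stk + (700 * b + 700) * F.card + (2000 * b + 3000) * (m - i) + 5,
      by simp; omega, fun ht => ?_, fun ht => ?_⟩
    · simp [hi, hm'] at ht
      set x := Q i with hxdef
      obtain ⟨c, hc⟩ : ∃ c, m - i = c + 1 := ⟨m - i - 1, by omega⟩
      rw [hc]
      refine .step (by simp) (k := 60 * stackSize N stk + (700 * b + 700) * F.card +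
        (2000 * b + 3000) * c + 2000 * b + 2900) (by simp; linarith) fun s₂ hf₂ hs₂ => ?_
      have hr₂ : s₂.real = s.real := funext fun a => hf₂.real a (by simp)
      have hx₂ : s₂.nat xCur 0 = x := by simp [hs₂, hQ', hi, hxdef]
      have hI₂ : SweepInv ℬ m N K P (fun d => ∃ j < i, Q j = d)
          (fun d => ∃ j, i ≤ j ∧ j < m ∧ Q j = d) s₂ stk F := by
        refine hI.congr (hf₂.nat _ (by simp)) (hf₂.nat _ (by simp)) (hf₂.nat _ (by simp)) hr₂ ?_
        unfold State.Stores
        rw [hr₂, hf₂.nat aYPos (by simp), hf₂.nat aTrees (by simp), hf₂.nat aWin (by simp),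
          hf₂.nat aHead (by simp), hf₂.nat aNext (by simp), hf₂.nat aItem (by simp),
          hf₂.nat xFresh (by simp)]
        exact hI.stores
      have hxX : ∃ j, i ≤ j ∧ j < m ∧ Q j = x := ⟨i, le_rfl, ht, rfl⟩
      have hxD : ¬ ∃ j < i, Q j = x := by
        rintro ⟨j, hj, hjx⟩
        have := hinj j i (by omega) ht hjx
        omega
      have hvx := hI₂.sweep.valid x (.inr hxX)
      have hN₂ : s₂.nat xLeaf 0 = N := by rw [hf₂.nat _ (by simp), hN']
      have hm₂ : s₂.nat aTrees 0 = m := by rw [hf₂.nat _ (by simp), hm']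
      refine .seq ((runs_absorb (r := (2000 * b + 3000) * c + 1500 * b + 2400) hR hI₂ hN₂ hm₂ hx₂
        (by simp [hs₂]) hNm hb ?_ hxD hxX (fun d hd => ?_) le_rfl hvx.left_le).mono (by linarith))
        ?_
      · rintro d ⟨j, hj, rfl⟩
        have := hsort.key j (by omega)
        exact ⟨this.1, this.2.1⟩
      · rw [hr₂]
        exact hF d hd i le_rfl ht
      rintro s₃ k₃ hf₃ ⟨stk₃, F₃, hk₃, hI₃, hno, hFF, hLx₃, hL₃⟩
      have hv₃ := hI₃.sweep.valid x (.inr hxX)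
      have hx₃ : s₃.nat xCur 0 = x := by rw [hf₃.nat _ (by simp), hx₂]
      have hk₃' : 500 * b + 600 ≤ k₃ := by
        refine le_trans ?_ hk₃
        have h1 := Nat.zero_le ((700 * b + 700) * F₃.card)
        have h2 := Nat.zero_le ((2000 * b + 3000) * c)
        linarith
      refine .seq (((runs_insertCur (s₀ := s₃) (x := x) (N := N) (b := b)
        (by rw [hf₃.nat _ (by simp), hN₂]) hx₃ hb hI₃.stores hxD (Nat.one_le_iff_ne_zero.1 hv₃.pos)
        hv₃.low_le (hv₃.high_lt.trans hNm) (fun d hd h1 h2 => ?_) fun d hd h1 => ?_).left_over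
        (k := k₃ - (500 * b + 500)) (Q' := fun s k => k = k₃ - (500 * b + 500) ∧ ∃ stk',
          stackSize N stk' ≤ stackSize N stk₃ + 2 * (b + 1) ∧
          s.Stores N (fun d => (∃ j < i, Q j = d) ∨ d = x) stk' ∧
          ∀ e, s.IsAlive N e ↔ s₃.IsAlive N e ∨ e = x)
        fun s _ hs => ⟨rfl, hs⟩).mono (by clear hk₃; omega)) ?_
      -- A stored box with overlapping `y`-interval that is not hit ends to the left of the left end
      -- of `x`, hence before the right end of `x`.
      · have hd := (hI₃.alive d).1 hd
        have h3 := hno d hd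
        have h4 := hv₃.left_le
        simp only [BoxData.Hits, State.boxes, not_and] at h3 h4
        have := h3 h1 h2
        linarith
      · have hd := (hI₃.alive d).1 hd
        have := hI₃.sweep.inj d x (.inl hd) (.inr hxX) h1
        subst this
        exact hI₃.sweep.sep _ hd hxX
      rintro s₄ k₄ hf₄ ⟨hk₄, stk₄, hΦ, hS₄, hA₄⟩
      have hF₄ : ∀ e, s₄.IsAlive N e ↔ e ∈ insert x F₃ := fun e => by
        rw [hA₄, hI₃.alive, Finset.mem_insert, or_comm]
      have hB₄ : s₄.boxes = s₃.boxes := by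
        simp only [State.boxes, hf₄.real rLeft (by simp), hf₄.real rRight (by simp),
          hf₄.nat aYPos (by simp), hf₄.nat aTrees (by simp)]
      have hi₄ : s₄.nat xI 0 = i := by
        rw [hf₄.nat _ (by simp), hf₃.nat _ (by simp), hf₂.nat _ (by simp), hi]
      have hL₄ : ∀ e, e ≠ x → s₄.real rLeft e = s.real rLeft e := fun e he => by
        rw [hf₄.real _ (by simp), hL₃ e he, hr₂]
      have hLx₄ : s₄.real rLeft x ≤ s.real rLeft x := by
        rw [hf₄.real _ (by simp), ← hr₂]
        exact hLx₃
      have hcard := Finset.card_insert_le x F₃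
      have hmul : (700 * b + 700) * (insert x F₃).card ≤ (700 * b + 700) * (F₃.card + 1) := by
          gcongr
      refine .loopFree (by simp) (k := k₄ - 6) (by simp; omega) ⟨i + 1, stk₄,
        insert x F₃, by simp [hi₄], by omega, ?_, ?_, ?_, ?_⟩
      · rw [show m - (i + 1) = c by omega]
        have : 60 * stackSize N stk₄ + (700 * b + 700) * (insert x F₃).card + (2000 * b + 3000) * c
          + 15 + (500 * b + 506) ≤ k₃ := by linarith
        omega
      · have hD' : (fun d => ∃ j < i + 1, Q j = d) = fun d => (∃ j < i, Q j = d) ∨ d = x := by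
          funext d
          refine propext ⟨?_, ?_⟩
          · rintro ⟨j, hj, rfl⟩
            rcases Nat.lt_succ_iff_lt_or_eq.1 hj with hj | rfl
            · exact .inl ⟨j, hj, rfl⟩
            · exact .inr rfl
          · rintro (⟨j, hj, rfl⟩ | rfl)
            · exact ⟨j, by omega, rfl⟩
            · exact ⟨i, by omega, rfl⟩
        rw [hD']
        refine SweepInv.congr (s := s₄) ⟨hS₄, hF₄, ?_, ?_⟩ (by simp) (by simp) (by simp) (by simp)
            ?_
        · rw [hB₄]
          refine hI₃.sweep.insert hR hxX hno (fun e => by rw [Finset.mem_insert, or_comm])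
            fun d => ⟨?_, ?_⟩
          · rintro ⟨j, hj, hjm, rfl⟩
            refine ⟨⟨j, by omega, hjm, rfl⟩, fun hjx => ?_⟩
            have := hinj j i hjm ht hjx
            omega
          · rintro ⟨⟨j, hj, hjm, rfl⟩, hjx⟩
            refine ⟨j, ?_, hjm, rfl⟩
            by_contra hlt
            obtain rfl : j = i := by omega
            exact hjx rfl
        · rw [hf₄.nat _ (by simp)]
          exact hI₃.low_lt
        · simpa [State.Stores] using hS₄
      -- The left end of `x` can only have decreased, and those of the boxes still to come are
      -- unchanged, so the sorted order computed at the start remains valid for them.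
      · intro d hd j hj hjm
        have hjx : Q j ≠ x := fun h => by have := hinj j i hjm ht h; omega
        simp only [Prog.run_set, State.putNat_real]
        rw [hL₄ _ hjx]
        rcases Finset.mem_insert.1 hd with rfl | hd
        · exact hLx₄.trans (hL i j le_rfl (by omega) hjm)
        · rw [hL₄ d fun h => hI₃.sweep.sep d hd (h ▸ hxX)]
          exact hF d (hFF hd) j (by omega) hjm
      · intro j k hj hjk hk
        have hjx : Q j ≠ x := fun h => by have := hinj j i (by omega) ht h; omega
        have hkx : Q k ≠ x := fun h => by have := hinj k i (by omega) ht h; omega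
        simp only [Prog.run_set, State.putNat_real]
        rw [hL₄ _ hjx, hL₄ _ hkx]
        exact hL j k (by omega) hjk hk
    · simp [hi, hm'] at ht
      obtain rfl : i = m := by omega
      refine ⟨F, hI.alive, ?_, hI.low_lt⟩
      have : (fun d => ∃ j, i ≤ j ∧ j < i ∧ Q j = d) = fun _ => False := by
        funext d
        simp only [eq_iff_iff, iff_false]
        rintro ⟨j, h1, h2, -⟩
        omega
      rw [← this]
      exact hI.sweep
  · have hr₁ : s₁.real = s₀.real := funext fun a => hf₁.real a (by simp)
    obtain ⟨hA, hSt⟩ := store_empty (S := s₁.nat aYPos)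
      (E := fun d => s₁.nat aYPos (s₁.nat aTrees 0 + d)) (nr := s₁.real rRight)
      (w := s₁.nat aWin) (head := s₁.nat aHead) (next := s₁.nat aNext) (item := s₁.nat aItem)
      (f := s₁.nat xFresh 0) (N := N) (by rw [hf₁.nat _ (by simp)]; exact hw)
      (by rw [hf₁.nat _ (by simp)]; exact hh)
    have hkey : ∀ j < m, 1 ≤ Q j ∧ Q j ≤ m := fun j hj => ⟨(hsort.key j hj).1, (hsort.key j hj).2.1⟩
    have hX : (fun d => ∃ j, 0 ≤ j ∧ j < m ∧ Q j = d) = fun d => 1 ≤ d ∧ d ≤ m := by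
      funext d
      refine propext ⟨?_, fun h => ?_⟩
      · rintro ⟨j, -, hj, rfl⟩
        exact hkey j hj
      · obtain ⟨h1, h2⟩ := hsort.pos d h.1 h.2
        exact ⟨_, Nat.zero_le _, h1, h2⟩
    have hD : (fun d => ∃ j < 0, Q j = d) = fun _ => False := by funext d; simp
    refine ⟨0, fun _ => [], ∅, by simp [hs₁], Nat.zero_le _, by simp [stackSize], ?_, by simp,
      fun j k _ hjk hk => ?_⟩
    · rw [hX, hD]
      refine ⟨hSt, fun e => by simpa [State.IsAlive] using hA e, ?_, ?_⟩
      · have : s₁.boxes = s₀.boxes := by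
          simp only [State.boxes, hr₁, hf₁.nat aYPos (by simp), hf₁.nat aTrees (by simp)]
        rw [this]
        simpa using hS
      · rw [hf₁.nat _ (by simp)]
        exact hlow
    · rw [hr₁]
      exact (hsort.lexLE j k hjk hk).key_le

end RealRAM


/-! ### Extents of point sets -/

/-- `v` is the value of `f` at some point between `a` and `c`, and a lower bound of the values from
`a` to `e`. -/
def IsLow (f : ℕ → ℝ) (a e c : ℕ) (v : ℝ) : Prop :=
  (∀ u, a ≤ u → u < e → v ≤ f u) ∧ ∃ u, a ≤ u ∧ u < c ∧ f u = v

theorem IsLow.min {f : ℕ → ℝ} {a e c : ℕ} {v : ℝ} (h : IsLow f a e c v) (hae : a ≤ e) (hec : e < c)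
    :
    IsLow f a (e + 1) c (min (f e) v) := by
  refine ⟨fun u hau hu => ?_, ?_⟩
  · rcases Nat.lt_succ_iff_lt_or_eq.1 hu with hu | rfl
    · exact (min_le_right _ _).trans (h.1 u hau hu)
    · exact min_le_left _ _
  · rcases min_choice (f e) v with hm | hm <;> rw [hm]
    · exact ⟨e, hae, hec, rfl⟩
    · exact h.2

/-- The range `a ≤ u < a` for the lower bound is empty, while the witness `a` lies in the full
range; hence the separate bounds `e` and `c` in `IsLow`. -/
theorem isLow_start {f : ℕ → ℝ} {a c : ℕ} (hac : a < c) : IsLow f a a c (f a) :=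
  ⟨fun u h1 h2 => by omega, a, le_rfl, hac, rfl⟩

/-- The left end, the negated right end, the lower and the upper end of the set of points with
numbers from `a` to `e`, or of a larger set of points with numbers from `a` to `c`. -/
structure Extent (x y : ℕ → ℝ) (a e c : ℕ) (left right low high : ℝ) : Prop where
  left : IsLow x a e c left
  right : IsLow (fun u => -x u) a e c right
  low : IsLow y a e c low
  high : IsLow (fun u => -y u) a e c (-high)

/-! ### Computing the bounding boxes -/

namespace RealRAM

theorem State.putReal_self (s : State) (a i : ℕ) : s.putReal a i (s.real a i) = s := by
  unfold State.putReal
  rw [Function.update_eq_self, Function.update_eq_self]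

/-- Replace the value of a cell by a smaller one. -/
def lowerCell (a : ℕ) (i : NExp) (x : RExp) : Prog :=
  .ite (.realLe x (.load a i)) (.setReal a i x) .skip

/-- Replace the value of a cell by a larger one. -/
def raiseCell (a : ℕ) (i : NExp) (x : RExp) : Prog :=
  .ite (.realLe (.load a i) x) (.setReal a i x) .skip

theorem run_lowerCell (a : ℕ) (i : NExp) (x : RExp) (s : State) : (lowerCell a i x).run s =
    s.putReal a (i.eval s) (min (x.eval s) (s.real a (i.eval s))) := by
  by_cases h : x.eval s ≤ s.real a (i.eval s)
  · rw [lowerCell, Prog.run_ite_pos (by simpa using h), min_eq_left h, Prog.run]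
  · rw [lowerCell, Prog.run_ite_neg (by simpa using h), min_eq_right (not_le.1 h).le,
      State.putReal_self, Prog.run]

theorem run_raiseCell (a : ℕ) (i : NExp) (x : RExp) (s : State) : (raiseCell a i x).run s =
    s.putReal a (i.eval s) (max (x.eval s) (s.real a (i.eval s))) := by
  by_cases h : s.real a (i.eval s) ≤ x.eval s
  · rw [raiseCell, Prog.run_ite_pos (by simpa using h), max_eq_left h, Prog.run]
  · rw [raiseCell, Prog.run_ite_neg (by simpa using h), max_eq_right (not_le.1 h).le,
      State.putReal_self, Prog.run]

@[simp] theorem loopFree_lowerCell (a : ℕ) (i : NExp) (x : RExp) : (lowerCell a i x).LoopFree :=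
  ⟨trivial, trivial⟩

@[simp] theorem loopFree_raiseCell (a : ℕ) (i : NExp) (x : RExp) : (raiseCell a i x).LoopFree :=
  ⟨trivial, trivial⟩

/-- Include the point `xOff` into the box `xI`, whose upper end has the number `xCnt`. -/
def includePoint : Prog :=
  lowerCell rLeft (.var xI) (.load 0 (.var xOff)) ;;
  lowerCell rRight (.var xI) (.sub (.const 0) (.load 0 (.var xOff))) ;;
  lowerCell rY (.var xI) (.load 1 (.var xOff)) ;;
  raiseCell rY (.var xCnt) (.load 1 (.var xOff)) ;;
  .set xOff (.add (.var xOff) (.const 1))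

/-- Start the next box, with the point `xOff`. -/
def startBox : Prog :=
  .set xLim (.add (.var xOff) (.load aSizes (.var xI))) ;;
  .set xI (.add (.var xI) (.const 1)) ;;
  .set xCnt (.add (.var aTrees) (.var xI)) ;;
  .setReal rLeft (.var xI) (.load 0 (.var xOff)) ;;
  .setReal rRight (.var xI) (.sub (.const 0) (.load 0 (.var xOff))) ;;
  .setReal rY (.var xI) (.load 1 (.var xOff)) ;;
  .setReal rY (.var xCnt) (.load 1 (.var xOff))

/-- Compute the bounding boxes of the trees. -/
def computeBoxes : Prog :=
  (.set xLeaf (.add (.add (.var aTrees) (.var aTrees)) (.const 1)) ;; .set xOff (.const 0) ;;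
    .set xI (.const 0)) ;;
  .while (.natLt (.var xI) (.var aTrees))
    (startBox ;; .while (.natLt (.var xOff) (.var xLim)) includePoint)

@[simp] theorem natWrites_includePoint : includePoint.natWrites = [xOff] := rfl

@[simp] theorem realWrites_includePoint : includePoint.realWrites = [rLeft, rRight, rY, rY] := rfl

@[simp] theorem natWrites_computeBoxes : computeBoxes.natWrites =
  [xLeaf, xOff, xI, xLim, xI, xCnt, xOff] := rfl

@[simp] theorem realWrites_computeBoxes : computeBoxes.realWrites =
  [rLeft, rRight, rY, rY, rLeft, rRight, rY, rY] := rfl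

/-- The extent of the box with number `i` in the memory. -/
def State.HasExtent (s : State) (x y : ℕ → ℝ) (m a e c i : ℕ) : Prop :=
  Extent x y a e c (s.real rLeft i) (s.real rRight i) (s.real rY i) (s.real rY (m + i))

theorem run_includePoint {s : State} {x y : ℕ → ℝ} {m a c i o : ℕ} (hx : s.real 0 = x)
    (hy : s.real 1 = y) (hi : s.nat xI 0 = i) (hc : s.nat xCnt 0 = m + i) (hm : 0 < m)
    (hi1 : 1 ≤ i) (ho : s.nat xOff 0 = o) (hao : a ≤ o) (hoc : o < c)
    (h : s.HasExtent x y m a o c i) :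
    (includePoint.run s).HasExtent x y m a (o + 1) c i ∧ (includePoint.run s).nat xOff 0 = o + 1 ∧
    ∀ j, j ≠ i → 1 ≤ j → j ≤ m → i ≤ m → (includePoint.run s).real rLeft j = s.real rLeft j ∧
      (includePoint.run s).real rRight j = s.real rRight j ∧
      (includePoint.run s).real rY j = s.real rY j ∧
      (includePoint.run s).real rY (m + j) = s.real rY (m + j) := by
  have hm0 : m ≠ 0 := hm.ne'
  refine ⟨⟨?_, ?_, ?_, ?_⟩, ?_, fun j hj hj1 hjm him => ?_⟩
  · simpa [includePoint, run_lowerCell, run_raiseCell, hx, hy, hi, hc, ho] using h.left.min hao hoc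
  · simpa [includePoint, run_lowerCell, run_raiseCell, hx, hy, hi, hc, ho] using h.right.min hao hoc
  · simpa [includePoint, run_lowerCell, run_raiseCell, hx, hy, hi, hc, ho, hm0] using
      h.low.min hao hoc
  · have := h.high.min hao hoc
    rw [min_neg_neg] at this
    simpa [includePoint, run_lowerCell, run_raiseCell, hx, hy, hi, hc, ho, hm0] using this
  · simp [includePoint, run_lowerCell, run_raiseCell, ho]
  · have h1 : j ≠ m + i := by omega
    have h2 : m + j ≠ i := by omega
    simp [includePoint, run_lowerCell, run_raiseCell, hi, hc, hj, h1, h2]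

theorem run_startBox {s : State} {x y : ℕ → ℝ} {m c i o : ℕ} (hx : s.real 0 = x)
    (hy : s.real 1 = y) (hi : s.nat xI 0 = i) (hm : s.nat aTrees 0 = m) (him : i < m)
    (ho : s.nat xOff 0 = o) (hc : s.nat aSizes i = c) (hc0 : 0 < c) :
    (startBox.run s).HasExtent x y m o o (o + c) (i + 1) ∧ (startBox.run s).nat xOff 0 = o ∧
    (startBox.run s).nat xI 0 = i + 1 ∧ (startBox.run s).nat xCnt 0 = m + (i + 1) ∧
    (startBox.run s).nat xLim 0 = o + c ∧
    ∀ j, 1 ≤ j → j ≤ i → (startBox.run s).real rLeft j = s.real rLeft j ∧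
      (startBox.run s).real rRight j = s.real rRight j ∧
      (startBox.run s).real rY j = s.real rY j ∧
      (startBox.run s).real rY (m + j) = s.real rY (m + j) := by
  have hm0 : m ≠ 0 := by omega
  have hoc : o < o + c := by omega
  refine ⟨⟨?_, ?_, ?_, ?_⟩, ?_, ?_, ?_, ?_, fun j hj hji => ?_⟩
  · simpa [startBox, hx, hy, hi, hm, ho] using isLow_start hoc
  · simpa [startBox, hx, hy, hi, hm, ho] using isLow_start (f := fun u => -x u) hoc
  · simpa [startBox, hx, hy, hi, hm, ho, hm0] using isLow_start hoc
  · simpa [startBox, hx, hy, hi, hm, ho, hm0] using isLow_start (f := fun u => -y u) hoc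
  · simp [startBox, ho]
  · simp [startBox, hi]
  · simp [startBox, hi, hm]
  · simp [startBox, ho, hi, hc]
  · have h1 : j ≠ i + 1 := by omega
    have h2 : j ≠ m + (i + 1) := by omega
    have h3 : m + j ≠ i + 1 := by omega
    simp [startBox, hi, hm, h1, h2, h3]

theorem runs_computeBoxes {s₀ : State} {x y : ℕ → ℝ} {sz : ℕ → ℕ} {m : ℕ} (hx : s₀.real 0 = x)
    (hy : s₀.real 1 = y) (hm : s₀.nat aTrees 0 = m) (hsz : s₀.nat aSizes = sz)
    (hpos : ∀ i < m, 0 < sz i) :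
    Runs computeBoxes s₀ (100 * (∑ i ∈ Finset.range m, sz i) + 100 * m + 50) fun s _ =>
      s.nat xLeaf 0 = 2 * m + 1 ∧ ∀ i < m, s.HasExtent x y m (∑ j ∈ Finset.range i, sz j)
        (∑ j ∈ Finset.range (i + 1), sz j) (∑ j ∈ Finset.range (i + 1), sz j) (i + 1) := by
  set off := fun i => ∑ j ∈ Finset.range i, sz j with hoff
  have hoff1 : ∀ i, off (i + 1) = off i + sz i := fun i => Finset.sum_range_succ _ _
  have hmono : ∀ i j, i ≤ j → off i ≤ off j := fun i j hij => by
    induction j, hij using Nat.le_induction with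
    | base => exact le_rfl
    | succ j _ ih => rw [hoff1]; omega
  have hoffm : off m = ∑ i ∈ Finset.range m, sz i := rfl
  refine .step (by simp) (k := 100 * off m + 100 * m + 20) (by simp; omega) fun s₁ hf₁ hs₁ => ?_
  refine Runs.while (fun s k => ∃ i, s.nat xI 0 = i ∧ i ≤ m ∧ s.nat xOff 0 = off i ∧
    100 * (off m - off i) + 100 * (m - i) + 20 ≤ k ∧
    ∀ j < i, s.HasExtent x y m (off j) (off (j + 1)) (off (j + 1)) (j + 1)) ?_ ?_
  · rintro s n hf ⟨i, hi, him, ho, hn, hE⟩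
    have hx' : s.real 0 = x := by rw [hf.real _ (by simp [startBox]), hf₁.real _ (by simp), hx]
    have hy' : s.real 1 = y := by rw [hf.real _ (by simp [startBox]), hf₁.real _ (by simp), hy]
    have hm' : s.nat aTrees 0 = m := by
      rw [hf.nat _ (by simp [startBox]), hf₁.nat _ (by simp), hm]
    have hsz' : s.nat aSizes = sz := by
      rw [hf.nat _ (by simp [startBox]), hf₁.nat _ (by simp), hsz]
    refine ⟨100 * (off m - off i) + 100 * (m - i) + 10, by simp; omega, fun ht => ?_, fun ht => ?_⟩
    · simp [hi, hm'] at ht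
      have h1 := hoff1 i
      have h2 := hmono (i + 1) m ht
      refine .step (by simp [startBox]) (k := 100 * (off m - off i) + 100 * (m - (i + 1)) + 50)
        (by simp [startBox]; omega) fun s₂ hf₂ hs₂ => ?_
      obtain ⟨hE₂, ho₂, hi₂, hc₂, hl₂, hr₂⟩ := run_startBox hx' hy' hi hm' ht ho
        (by rw [hsz']) (hpos i ht)
      rw [← hs₂] at hE₂ ho₂ hi₂ hc₂ hl₂ hr₂
      rw [← h1] at hE₂ hl₂
      -- The point `off i` that started the box is included a second time, which does no harm;
      -- positivity of the tree size guarantees that it belongs to this tree.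
      refine Runs.while (fun s k => ∃ o, s.nat xOff 0 = o ∧ off i ≤ o ∧ o ≤ off (i + 1) ∧
        100 * (off m - o) + 100 * (m - (i + 1)) + 50 ≤ k ∧
        s.HasExtent x y m (off i) o (off (i + 1)) (i + 1) ∧
        ∀ j < i, s.HasExtent x y m (off j) (off (j + 1)) (off (j + 1)) (j + 1)) ?_
        ⟨off i, ho₂, le_rfl, by omega, le_rfl, hE₂, fun j hj => ?_⟩
      · rintro s₃ n₃ hf₃ ⟨o, ho₃, ho1, ho2, hn₃, hE₃, hE₃'⟩
        have hl₃ : s₃.nat xLim 0 = off (i + 1) := by rw [hf₃.nat _ (by simp), hl₂]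
        refine ⟨100 * (off m - o) + 100 * (m - (i + 1)) + 40, by simp; omega, fun ht₃ => ?_,
          fun ht₃ => ?_⟩
        · simp [ho₃, hl₃] at ht₃
          obtain ⟨h3, h4, h5⟩ := run_includePoint (s := s₃) (x := x) (y := y) (m := m)
            (by rw [hf₃.real _ (by simp), hf₂.real _ (by simp [startBox]), hx'])
            (by rw [hf₃.real _ (by simp), hf₂.real _ (by simp [startBox]), hy'])
            (by rw [hf₃.nat _ (by simp), hi₂]) (by rw [hf₃.nat _ (by simp), hc₂]) (by omega)
            (by omega) ho₃ ho1 ht₃ hE₃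
          refine .loopFree (by simp [includePoint])
            (k := 100 * (off m - (o + 1)) + 100 * (m - (i + 1)) + 50)
            (by simp [includePoint, lowerCell, raiseCell]; omega)
            ⟨o + 1, h4, by omega, ht₃, le_rfl, h3, fun j hj => ?_⟩
          obtain ⟨e1, e2, e3, e4⟩ := h5 (j + 1) (by omega) (by omega) (by omega) (by omega)
          unfold State.HasExtent
          rw [e1, e2, e3, e4]
          exact hE₃' j hj
        · simp [ho₃, hl₃] at ht₃
          obtain rfl : o = off (i + 1) := by omega
          refine ⟨i + 1, by rw [hf₃.nat _ (by simp), hi₂], ht, ho₃, by omega, fun j hj => ?_⟩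
          rcases Nat.lt_succ_iff_lt_or_eq.1 hj with hj | rfl
          · exact hE₃' j hj
          · exact hE₃
      · obtain ⟨e1, e2, e3, e4⟩ := hr₂ (j + 1) (by omega) (by omega)
        unfold State.HasExtent
        rw [e1, e2, e3, e4]
        exact hE j hj
    · simp [hi, hm'] at ht
      obtain rfl : i = m := by omega
      refine ⟨?_, hE⟩
      rw [hf.nat _ (by simp [startBox]), hs₁]
      simp [hm]
      omega
  · exact ⟨0, by simp [hs₁], Nat.zero_le _, by simp [hs₁, hoff], by simp [hoff], by simp⟩

end RealRAM


/-! ### Reporting the boxes -/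

namespace RealRAM

/-- Report the box `xI` if it is in the store. -/
def reportBox : Prog :=
  .ite (.alive (.var xI))
    (.setReal 0 (.var xCnt) (.load rLeft (.var xI)) ;;
      .setReal 1 (.var xCnt) (.load rY (.load aYKey (.low (.var xI)))) ;;
      .setReal 2 (.var xCnt) (.sub (.const 0) (.load rRight (.var xI))) ;;
      .setReal 3 (.var xCnt) (.load rY (.load aYKey (.high (.var xI)))) ;;
      .set xCnt (.add (.var xCnt) (.const 1))) .skip ;;
  .set xI (.add (.var xI) (.const 1))

/-- Report the boxes in the store. -/
def report : Prog :=
  (.set xCnt (.const 0) ;; .set xI (.const 1)) ;;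
  .while (.natLe (.var xI) (.var aTrees)) reportBox ;;
  .set 0 (.var xCnt)

theorem run_reportBox {s : State} {N i c : ℕ} (hN : s.nat xLeaf 0 = N) (hi : s.nat xI 0 = i)
    (hi0 : 1 ≤ i) (hiN : s.nat aYPos i < N) (hc : s.nat xCnt 0 = c) :
    (reportBox.run s).nat xI 0 = i + 1 ∧
    (s.IsAlive N i → (reportBox.run s).nat xCnt 0 = c + 1 ∧
      outputBox (reportBox.run s) c = s.boxes.box (s.real rY) (s.nat aYKey) i ∧
      ∀ j < c, outputBox (reportBox.run s) j = outputBox s j) ∧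
    (¬ s.IsAlive N i → (reportBox.run s).nat xCnt 0 = c ∧
      ∀ j < c, outputBox (reportBox.run s) j = outputBox s j) := by
  have hA : (Test.alive (.var xI)).holds s ↔ s.IsAlive N i := by
    simp only [Test.alive, Test.holds_natEq, NExp.eval, NExp.eval_var, NExp.eval_low, hN, hi,
      State.IsAlive, Alive]
    exact ⟨fun h => ⟨by omega, hiN, h⟩, fun h => h.2.2⟩
  by_cases h : s.IsAlive N i
  · refine ⟨?_, fun _ => ⟨?_, ?_, fun j hj => ?_⟩, fun h' => absurd h h'⟩ <;>
      rw [reportBox, Prog.run, Prog.run_ite_pos (hA.2 h)]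
    · simp [hi]
    · simp [hc]
    · simp [outputBox, BoxData.box, State.boxes, hc, hi]
    · have : j ≠ c := by omega
      simp [outputBox, hc, this]
  · refine ⟨?_, fun h' => absurd h' h, fun _ => ⟨?_, fun j hj => ?_⟩⟩ <;>
      rw [reportBox, Prog.run, Prog.run_ite_neg fun h' => h (hA.1 h')]
    · simp [hi]
    · simp [hc]
    · simp [outputBox]

theorem runs_report {s₀ : State} {N m : ℕ} {F : Finset ℕ} (hN : s₀.nat xLeaf 0 = N)
    (hm : s₀.nat aTrees 0 = m) (hF : ∀ e, s₀.IsAlive N e ↔ e ∈ F) (hFm : ∀ e ∈ F, 1 ≤ e ∧ e ≤ m)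
    (hlow : ∀ e, 1 ≤ e → e ≤ m → s₀.nat aYPos e < N)
    (hinj : Set.InjOn (s₀.boxes.box (s₀.real rY) (s₀.nat aYKey)) F) :
    Runs report s₀ (200 * m + 100) fun s _ =>
      Outputs s (s₀.boxes.box (s₀.real rY) (s₀.nat aYKey) '' F) := by
  set box := s₀.boxes.box (s₀.real rY) (s₀.nat aYKey) with hbox
  refine .step (by simp) (k := 200 * m + 50) (by simp; omega) fun s₁ hf₁ hs₁ => ?_
  refine .seq (R := fun s k => 10 ≤ k ∧ Set.BijOn (outputBox s) (Set.Iio (s.nat xCnt 0)) (box '' F))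
    (Runs.while (fun s k => ∃ i, s.nat xI 0 = i ∧ 1 ≤ i ∧ i ≤ m + 1 ∧ 200 * (m + 1 - i) + 50 ≤ k ∧
      Set.BijOn (outputBox s) (Set.Iio (s.nat xCnt 0)) (box '' {d | d ∈ F ∧ d < i})) ?_ ?_) ?_
  · rintro s n hf ⟨i, hi, hi0, him, hn, hB⟩
    have e1 : ∀ a, a ≠ xI → a ≠ xCnt → s.nat a = s₀.nat a := fun a h1 h2 => by
      rw [hf.nat a (by simp [reportBox, h1, h2]), hf₁.nat a (by simp [h1, h2])]
    -- The output goes to the real arrays `0` to `3`, overwriting the input coordinates. Everything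
    -- that is still read is in arrays with larger numbers.
    have e2 : ∀ a, 4 ≤ a → s.real a = s₀.real a := fun a h1 => by
      rw [hf.real a (by simp [reportBox]; omega), hf₁.real a (by simp)]
    have e3 : s.boxes = s₀.boxes := by simp [State.boxes, e1, e2]
    have e4 : ∀ e, s.IsAlive N e ↔ e ∈ F := fun e => by rw [← hF e]; simp [State.IsAlive, e1]
    refine ⟨200 * (m + 1 - i) + 40, by simp; omega, fun ht => ?_, fun ht => ?_⟩
    · simp [hi, e1, hm] at ht
      obtain ⟨h1, h2, h3⟩ := run_reportBox (s := s) (N := N) (by rw [e1 _ (by simp) (by simp), hN])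
        hi hi0 (by rw [e1 _ (by simp) (by simp)]; exact hlow i hi0 ht) rfl
      refine .loopFree (by simp [reportBox]) (k := 200 * (m + 1 - (i + 1)) + 50)
        (by simp [reportBox, Test.alive, NExp.low, NExp.high]; omega)
        ⟨i + 1, h1, by omega, by omega, le_rfl, ?_⟩
      by_cases hA : s.IsAlive N i
      · obtain ⟨h4, h5, h6⟩ := h2 hA
        have hiF := (e4 i).1 hA
        have hset : {d | d ∈ F ∧ d < i + 1} = insert i {d | d ∈ F ∧ d < i} := by
          ext d
          simp only [Set.mem_ofPred_eq, Set.mem_insert_iff]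
          constructor
          · rintro ⟨h, h'⟩
            by_cases hd : d = i
            · exact .inl hd
            · exact .inr ⟨h, by omega⟩
          · rintro (rfl | ⟨h, h'⟩)
            · exact ⟨hiF, by omega⟩
            · exact ⟨h, by omega⟩
        have hIio : Set.Iio (s.nat xCnt 0 + 1) = insert (s.nat xCnt 0) (Set.Iio (s.nat xCnt 0)) :=
            by
          ext j; simp only [Set.mem_Iio, Set.mem_insert_iff]; omega
        rw [h4, hset, Set.image_insert_eq, hIio]
        have h7 : outputBox (reportBox.run s) (s.nat xCnt 0) = box i := by
          rw [h5, hbox, e3, e2 _ (by simp), e1 _ (by simp) (by simp)]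
        rw [← h7]
        refine Set.BijOn.insert (hB.congr fun j hj => (h6 j hj).symm) ?_
        rw [h7]
        rintro ⟨d, ⟨hd, hdi⟩, hdb⟩
        have := hinj (Finset.mem_coe.2 hd) (Finset.mem_coe.2 hiF) hdb
        omega
      · obtain ⟨h4, h6⟩ := h3 hA
        have hset : {d | d ∈ F ∧ d < i + 1} = {d | d ∈ F ∧ d < i} := by
          ext d
          simp only [Set.mem_ofPred_eq]
          refine and_congr_right fun hd => ?_
          have : d ≠ i := fun h => hA ((e4 i).2 (h ▸ hd))
          omega
        rw [h4, hset]
        exact hB.congr fun j hj => (h6 j hj).symm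
    · simp [hi, e1, hm] at ht
      have hset : {d | d ∈ F ∧ d < i} = F := by
        ext d
        simp only [Set.mem_ofPred_eq, Finset.mem_coe]
        exact ⟨fun h => h.1, fun h => ⟨h, by have := hFm d h; omega⟩⟩
      rw [hset] at hB
      exact ⟨by omega, hB⟩
  · refine ⟨1, by simp [hs₁], le_rfl, by omega, by omega, ?_⟩
    have hset : {d | d ∈ F ∧ d < 1} = ∅ := by
      ext d
      simp only [Set.mem_ofPred_eq, Set.mem_empty_iff_false, iff_false]
      exact fun h => by have := hFm d h.1; omega
    have : s₁.nat xCnt 0 = 0 := by simp [hs₁]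
    rw [this, hset]
    simp
  · rintro s k - ⟨hk, hB⟩
    -- The count is moved to its final place only now, because that cell held the number of trees,
    -- which the loop needed.
    refine .loopFree (by simp) (k := 0) (by simp; omega) ?_
    have h1 : outputCount ((Prog.set 0 (.var xCnt)).run s) = s.nat xCnt 0 := by simp [outputCount]
    rw [Outputs, h1]
    exact hB.congr fun j _ => by simp [outputBox]

end RealRAM


/-! ### The box-cover of a list of geometric trees -/


/-- Each of the four bounds is attained at a vertex, so every rectangle that contains the tree
contains the box given by the bounds. -/
theorem GeomTree.boundingBox_carrier {S : GeomTree} {x y : ℕ → ℝ} {a e : ℕ}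
    {left right low high : ℝ} (hx : ∀ v : Fin S.k, x (a + v) = (S.pos v).1)
    (hy : ∀ v : Fin S.k, y (a + v) = (S.pos v).2) (he : e = a + S.k)
    (h : Extent x y a e e left right low high) :
    left ≤ -right ∧ low ≤ high ∧ boundingBox S.carrier = Set.Icc (left, low) (-right, high) := by
  have hv : ∀ u, a ≤ u → u < e → ∃ v : Fin S.k, x u = (S.pos v).1 ∧ y u = (S.pos v).2 :=
    fun u h1 h2 => by
      refine ⟨⟨u - a, by omega⟩, ?_, ?_⟩
      · rw [← hx, Nat.add_sub_cancel' h1]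
      · rw [← hy, Nat.add_sub_cancel' h1]
  obtain ⟨⟨l1, ul, l2, l3, l4⟩, ⟨r1, ur, r2, r3, r4⟩, ⟨b1, ub, b2, b3, b4⟩, ⟨t1, ut, t2, t3, t4⟩⟩ :=
      h
  dsimp only at r1 r4 t1 t4
  refine ⟨?_, ?_, boundingBox_eq (GeomTree.carrier_subset_Icc.2 fun v => ?_) fun c d hcd => ?_⟩
  · linarith [l1 ur r2 r3]
  · linarith [b1 ut t2 t3]
  · have h1 := l1 (a + v) (by omega) (by omega)
    have h2 := r1 (a + v) (by omega) (by omega)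
    have h3 := b1 (a + v) (by omega) (by omega)
    have h4 := t1 (a + v) (by omega) (by omega)
    rw [hx] at h1 h2
    rw [hy] at h3 h4
    exact ⟨⟨h1, h3⟩, ⟨by dsimp only; linarith, by dsimp only; linarith⟩⟩
  · rw [GeomTree.carrier_subset_Icc] at hcd
    obtain ⟨vl, el, -⟩ := hv ul l2 l3
    obtain ⟨vr, er, -⟩ := hv ur r2 r3
    obtain ⟨vb, -, eb⟩ := hv ub b2 b3
    obtain ⟨vt, -, et⟩ := hv ut t2 t3
    have h1 := (hcd vl).1.1
    have h2 := (hcd vr).2.1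
    have h3 := (hcd vb).1.2
    have h4 := (hcd vt).2.2
    exact ⟨⟨by dsimp only; linarith, by dsimp only; linarith⟩,
      ⟨by dsimp only; linarith, by dsimp only; linarith⟩⟩

theorem sum_range_getD_map_k (T : List GeomTree) :
    ∑ i ∈ Finset.range T.length, (T.map GeomTree.k).getD i 0 = totalVertices T := by
  induction T with
  | nil => simp [totalVertices]
  | cons S T ih =>
    rw [List.length_cons, Finset.sum_range_succ']
    simp only [List.map_cons, List.getD_cons_succ, List.getD_cons_zero, ih]
    simp [totalVertices, add_comm]

theorem getD_flatMap_ofFn_pos (f : ℝ × ℝ → ℝ) (T : List GeomTree) (i : ℕ) (hi : i < T.length)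
    (v : Fin T[i].k) : (T.flatMap fun S => List.ofFn fun v => f (S.pos v)).getD
      (∑ j ∈ Finset.range i, (T.map GeomTree.k).getD j 0 + v) 0 = f (T[i].pos v) := by
  induction T generalizing i with
  | nil => simp at hi
  | cons S T ih =>
    rw [List.flatMap_cons]
    cases i with
    | zero =>
      have hv : (v : ℕ) < S.k := v.2
      rw [List.getD_append _ _ _ _ (by simp), List.getD_eq_getElem _ _ (by simp)]
      simp
    | succ i =>
      rw [Finset.sum_range_succ']
      simp only [List.map_cons, List.getD_cons_succ, List.getD_cons_zero]
      rw [List.getD_append_right _ _ _ _ (by simp; omega), List.length_ofFn,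
        Nat.add_right_comm, Nat.add_sub_cancel]
      exact ih i (by simpa using hi) v

theorem carriers_eq_image (T : List GeomTree) :
    carriers T = GeomTree.carrier '' {S | S ∈ T} := by
  ext A
  simp [carriers, eq_comm]

theorem length_le_totalVertices (T : List GeomTree) : T.length ≤ totalVertices T := by
  induction T with
  | nil => simp
  | cons S T ih =>
    have := S.k_pos
    simp only [totalVertices, List.map_cons, List.sum_cons, List.length_cons] at ih ⊢
    omega

/-! ### The whole program -/

namespace RealRAM

/-- Compute the box-cover of a list of geometric trees. -/
def boxCover : Prog :=
  computeBoxes ;; .set xCnt (.add (.var aTrees) (.var aTrees)) ;; sortKeys rY aYKey aYPos ;;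
  .set xCnt (.var aTrees) ;; sortKeys rLeft aXKey aXPos ;; sweepLoop ;; report

/-- Initially each number from `1` to `m` denotes the bounding box of a tree, so the family is the
set of initial boxes, a lower cover of itself. Positions determine their numbers, so different boxes
have different lower positions, even at equal heights. -/
theorem sweep_start {T : List GeomTree} {m : ℕ} (hm : T.length = m) {s : State}
    (hms : s.nat aTrees 0 = m)
    (hsort : IsSorting (s.real rY) (2 * m) (s.nat aYKey) (s.nat aYPos))
    (hbox : ∀ i (hi : i < T.length), s.real rLeft (i + 1) ≤ -s.real rRight (i + 1) ∧
      s.real rY (i + 1) ≤ s.real rY (m + (i + 1)) ∧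
      boundingBox T[i].carrier = Set.Icc (s.real rLeft (i + 1), s.real rY (i + 1))
        (-s.real rRight (i + 1), s.real rY (m + (i + 1)))) :
    Sweep (boundingBox '' carriers T) m (s.real rY) (s.nat aYKey) s.boxes (fun _ => False)
      fun d => 1 ≤ d ∧ d ≤ m := by
  have hlow : ∀ d, 1 ≤ d → d ≤ m → s.boxes.low d < 2 * m ∧ s.nat aYKey (s.boxes.low d) = d :=
    fun d h1 h2 => hsort.pos d h1 (by omega)
  have hhigh : ∀ d, 1 ≤ d → d ≤ m →
      s.boxes.high d < 2 * m ∧ s.nat aYKey (s.boxes.high d) = m + d := fun d h1 h2 => by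
    have := hsort.pos (m + d) (by omega) (by omega)
    simpa only [State.boxes, hms] using this
  have hb : ∀ i (hi : i < T.length),
      s.boxes.box (s.real rY) (s.nat aYKey) (i + 1) = boundingBox T[i].carrier := fun i hi => by
    rw [(hbox i hi).2.2, BoxData.box, (hlow _ (by omega) (by omega)).2,
      (hhigh _ (by omega) (by omega)).2]
    rfl
  have hset : boundingBox '' carriers T =
      {C | ∃ d, (False ∨ 1 ≤ d ∧ d ≤ m) ∧ C = s.boxes.box (s.real rY) (s.nat aYKey) d} := by
    ext C
    constructor
    · rintro ⟨_, ⟨S, hS, rfl⟩, rfl⟩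
      obtain ⟨i, hi, rfl⟩ := List.getElem_of_mem hS
      exact ⟨i + 1, .inr ⟨by omega, by omega⟩, (hb i hi).symm⟩
    · rintro ⟨d, (h | ⟨h1, h2⟩), rfl⟩
      · exact h.elim
      · obtain ⟨i, rfl⟩ : ∃ i, d = i + 1 := ⟨d - 1, by omega⟩
        exact ⟨_, ⟨T[i], List.getElem_mem _, rfl⟩, (hb i (by omega)).symm⟩
  refine ⟨?_, ?_, ?_, fun d e h => h.elim, fun d h => h.elim⟩
  · rw [← hset]
    refine .refl ?_
    rintro _ ⟨_, ⟨S, hS, rfl⟩, rfl⟩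
    obtain ⟨i, hi, rfl⟩ := List.getElem_of_mem hS
    obtain ⟨h1, h2, h3⟩ := hbox i hi
    exact ⟨_, _, ⟨h1, h2⟩, h3⟩
  · rintro d (h | ⟨h1, h2⟩)
    · exact h.elim
    obtain ⟨i, rfl⟩ : ∃ i, d = i + 1 := ⟨d - 1, by omega⟩
    obtain ⟨h3, h4, -⟩ := hbox i (by omega)
    obtain ⟨l1, l2⟩ := hlow _ h1 h2
    obtain ⟨u1, u2⟩ := hhigh _ h1 h2
    refine ⟨h1, h2, h3, hsort.ranking.le _ _ l1 u1 (by omega) (by omega) ?_, u1, by omega, by omega⟩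
    rwa [l2, u2]
  · rintro d e (h | ⟨h1, h2⟩) (h' | ⟨h3, h4⟩) hde
    · exact h.elim
    · exact h.elim
    · exact h'.elim
    rw [← (hlow d h1 h2).2, hde, (hlow e h3 h4).2]

/-- The tournament tree has `N = 2 * m + 1` leaves: the sorts need the leaf numbers up to `2 * m`,
and the sweep the positions below `2 * m`. So `hb` is the requirement `2 * N ≤ 2 ^ b`. -/
theorem runs_boxCover (T : List GeomTree) {b : ℕ} (hb : 4 * T.length + 2 ≤ 2 ^ b) :
    Runs boxCover (input T) ((4000 * b + 5000) * totalVertices T + 1000) fun s _ =>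
      ∃ 𝒞, Outputs s 𝒞 ∧ IsCover boundingBox (carriers T) 𝒞 ∧
        ∀ 𝒟, IsCover boundingBox (carriers T) 𝒟 → 𝒟 = 𝒞 := by
  set m := T.length with hmT
  set sz := fun i => (T.map GeomTree.k).getD i 0 with hsz
  set x := fun i => (T.flatMap fun S => List.ofFn fun v => (S.pos v).1).getD i 0 with hx
  set y := fun i => (T.flatMap fun S => List.ofFn fun v => (S.pos v).2).getD i 0 with hy
  have hsum : ∑ i ∈ Finset.range m, sz i = totalVertices T := sum_range_getD_map_k T
  have hmn : m ≤ totalVertices T := length_le_totalVertices T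
  have hszk : ∀ i (hi : i < T.length), sz i = T[i].k := fun i hi => by
    simp [hsz, hi]
  have hbm : b * m ≤ b * totalVertices T := Nat.mul_le_mul_left _ hmn
  set n := totalVertices T with hn
  have hzero : ∀ a u, 4 ≤ a → (input T).nat a u = 0 := fun a u ha => by
    obtain ⟨c, rfl⟩ := Nat.exists_eq_add_of_le' ha
    rfl
  refine .call (runs_computeBoxes (s₀ := input T) (x := x) (y := y) (sz := sz) (m := m) rfl rfl rfl
    rfl fun i hi => by rw [hszk i hi]; exact T[i].k_pos)
    (k := (3500 * b + 4500) * m + 700) (by rw [hsum]; linarith [Nat.zero_le (b * n)]) fun s₁ hf₁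
    ⟨hN₁, hE₁⟩ => ?_
  have hm₁ : s₁.nat aTrees 0 = m := by rw [hf₁.nat _ (by simp)]; rfl
  refine .step (by simp) (k := (3500 * b + 4500) * m + 680) (by simp; omega) fun s₂ hf₂ hs₂ => ?_
  have hw₂ : ∀ u, 0 < u → s₂.nat aWin u = 0 := fun u _ => by
    rw [hf₂.nat _ (by simp), hf₁.nat _ (by simp), hzero _ _ (by simp)]
  have hN₂ : s₂.nat xLeaf 0 = 2 * m + 1 := by rw [hf₂.nat _ (by simp), hN₁]
  refine .call (runs_sortKeys (key := rY) (P := aYKey) (J := aYPos) (N := 2 * m + 1) (b := b)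
    (c := 2 * m) (by simp) (by simp) (by simp) hw₂ hN₂ (by simp [hs₂, hm₁]; omega) (by omega)
    (by omega)) (k := (2400 * b + 4000) * m + 600) (by linarith [Nat.zero_le (b * m)]) fun s₃ hf₃
    ⟨hw₃, hsort₃⟩ => ?_
  refine .step (by simp) (k := (2400 * b + 4000) * m + 580) (by simp; omega) fun s₄ hf₄ hs₄ => ?_
  have hm₄ : s₄.nat aTrees 0 = m := by
    rw [hf₄.nat _ (by simp), hf₃.nat _ (by simp), hf₂.nat _ (by simp), hm₁]
  refine .call (runs_sortKeys (key := rLeft) (P := aXKey) (J := aXPos) (N := 2 * m + 1) (b := b)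
    (c := m) (s := s₄) (by simp) (by simp) (by simp) (by rwa [hf₄.nat _ (by simp)])
    (by rw [hf₄.nat _ (by simp), hf₃.nat _ (by simp), hN₂])
    (by rw [← hm₄, hf₄.nat aTrees (by simp)]; simp [hs₄]) (by omega) (by omega))
    (k := (2000 * b + 3500) * m + 500) (by linarith) fun s₅ hf₅ ⟨hw₅, hsort₅⟩ => ?_
  have hr₅ : s₅.real = s₁.real := funext fun a => by
    rw [hf₅.real a (by simp), hf₄.real a (by simp), hf₃.real a (by simp), hf₂.real a (by simp)]
  have hm₅ : s₅.nat aTrees 0 = m := by rw [hf₅.nat _ (by simp), hm₄]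
  have hN₅ : s₅.nat xLeaf 0 = 2 * m + 1 := by
    rw [hf₅.nat _ (by simp), hf₄.nat _ (by simp), hf₃.nat _ (by simp), hN₂]
  have hsort : IsSorting (s₅.real rY) (2 * m) (s₅.nat aYKey) (s₅.nat aYPos) := by
    rw [hf₅.nat aYKey (by simp), hf₅.nat aYPos (by simp), hf₄.nat aYKey (by simp),
      hf₄.nat aYPos (by simp), hr₅, ← hf₂.real rY (by simp)]
    exact hsort₃
  have hbox : ∀ i (hi : i < T.length), s₅.real rLeft (i + 1) ≤ -s₅.real rRight (i + 1) ∧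
      s₅.real rY (i + 1) ≤ s₅.real rY (m + (i + 1)) ∧
      boundingBox T[i].carrier = Set.Icc (s₅.real rLeft (i + 1), s₅.real rY (i + 1))
        (-s₅.real rRight (i + 1), s₅.real rY (m + (i + 1))) := fun i hi => by
    rw [hr₅]
    refine GeomTree.boundingBox_carrier (getD_flatMap_ofFn_pos Prod.fst T i hi)
      (getD_flatMap_ofFn_pos Prod.snd T i hi) ?_ (hE₁ i hi)
    rw [Finset.sum_range_succ, hszk i hi]
  have hS := sweep_start hmT.symm hm₅ hsort hbox
  have hisBox : ∀ B ∈ boundingBox '' carriers T, IsBox B := by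
    rintro _ ⟨_, ⟨S, hS, rfl⟩, rfl⟩
    obtain ⟨i, hi, rfl⟩ := List.getElem_of_mem hS
    obtain ⟨h1, h2, h3⟩ := hbox i hi
    exact ⟨_, _, ⟨h1, h2⟩, h3⟩
  refine .call (runs_sweepLoop (s₀ := s₅) (b := b) hsort.ranking hN₅ hm₅ (by omega) (by omega) rfl
    (J := s₅.nat aXPos) (by rwa [hf₅.real rLeft (by simp)]) hw₅ (fun u => ?_) (fun d h1 h2 => ?_)
    hS)
    (k := 200 * m + 100) (by linarith) fun s₆ hf₆ ⟨F, hA, hS₆, hlow₆⟩ => ?_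
  · rw [hf₅.nat _ (by simp), hf₄.nat _ (by simp), hf₃.nat _ (by simp), hf₂.nat _ (by simp),
      hf₁.nat _ (by simp), hzero _ _ (by simp)]
  · have := (hsort.pos d h1 (by omega)).1
    omega
  have hY₆ : s₆.real rY = s₅.real rY := hf₆.real _ (by simp)
  have hK₆ : s₆.nat aYKey = s₅.nat aYKey := hf₆.nat _ (by simp)
  rw [← hY₆, ← hK₆] at hS₆
  have hR := hsort.ranking
  rw [← hY₆, ← hK₆] at hR
  -- Stored boxes are nonempty and pairwise disjoint, so different numbers denote different boxes
  -- and nothing is reported twice.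
  have hinj : Set.InjOn (s₆.boxes.box (s₆.real rY) (s₆.nat aYKey)) F := fun d hd e he hde => by
    by_contra hne
    have h1 := hS₆.disjoint d e hd he hne
    rw [← hde, disjoint_self] at h1
    exact (Set.nonempty_Icc.2 ((hS₆.valid d (.inl hd)).le_corner hR)).ne_empty h1
  refine (runs_report (s₀ := s₆) (by rw [hf₆.nat _ (by simp), hN₅])
      (by rw [hf₆.nat _ (by simp), hm₅])
    hA (fun e he => ⟨(hS₆.valid e (.inl he)).pos, (hS₆.valid e (.inl he)).le⟩) hlow₆ hinj).imp
    fun s k _ hO => ⟨_, hO, ?_⟩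
  refine LowerCover.isCover ?_ hisBox ?_ ?_
  · rw [carriers_eq_image]
    exact T.finite_toSet.image _
  · convert hS₆.cover using 1
    ext C
    simp [eq_comm]
  · rintro _ ⟨d, hd, rfl⟩ _ ⟨e, he, rfl⟩ hne
    exact hS₆.disjoint d e hd he fun h => hne (h ▸ rfl)

end RealRAM

/-! ### The time bound in terms of the natural logarithm -/

/-- A bound in terms of the binary logarithm in terms of the natural logarithm. -/
theorem mul_natLog_le (n : ℕ) : (((4000 * (Nat.log 2 n + 3) + 5000) * n + 1000 : ℕ) : ℝ) ≤
    100000 * ((n : ℝ) * Real.log n ^ 2 + 1) := by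
  rcases Nat.lt_or_ge n 2 with h | h
  · have h0 : Nat.log 2 n = 0 := Nat.log_of_lt h
    have h1 : (n : ℝ) ≤ 1 := by exact_mod_cast Nat.lt_succ_iff.1 h
    have h2 : 0 ≤ (n : ℝ) * Real.log n ^ 2 := by positivity
    rw [h0]
    push_cast
    linarith
  · have h1 : Real.log 2 ≤ Real.log n := Real.log_le_log two_pos (by exact_mod_cast h)
    have h2 := Real.log_two_gt_d9
    have h3 : (Nat.log 2 n : ℝ) * Real.log 2 ≤ Real.log n := by
      have := Real.natLog_le_logb n 2
      rwa [Real.logb, le_div_iff₀ (by push_cast; linarith)] at this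
    set l := Real.log n
    have h4 : (Nat.log 2 n : ℝ) ≤ 2 * l := by
      have := (Nat.cast_nonneg (Nat.log 2 n) : (0 : ℝ) ≤ _)
      nlinarith
    -- For `n ≥ 2` the logarithm is at least `log 2 > 1 / 2`, so constant and linear terms are
    -- absorbed by a multiple of `l ^ 2`.
    have h5 : 1 ≤ 2 * l := by linarith
    have h6 : 4000 * ((Nat.log 2 n : ℝ) + 3) + 5000 ≤ 100000 * l ^ 2 := by nlinarith
    have h7 := mul_le_mul_of_nonneg_right h6 (Nat.cast_nonneg n)
    push_cast
    linarith

/-- There is one real RAM program that, for every list of pairwise non-crossing geometric trees with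
`n` vertices in total, halts within `O(n log² n)` steps and outputs the box-cover of the trees, that
is, the one and only possible outcome of the merging process with bounding boxes. The summand `1`
only matters for `n ≤ 1`, where `n log² n = 0`. -/
theorem theorem3 :
    ∃ (P : RealRAM.Prog) (c : ℝ), ∀ T : List GeomTree, T.Pairwise NonCrossing →
      ∃ (t : ℕ) (s : RealRAM.State) (𝒞 : Set (Set (ℝ × ℝ))),
        RealRAM.Exec P (RealRAM.input T) t s ∧
        (t : ℝ) ≤ c * ((totalVertices T : ℝ) * Real.log (totalVertices T) ^ 2 + 1) ∧
        RealRAM.Outputs s 𝒞 ∧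
        IsCover boundingBox (carriers T) 𝒞 ∧
        ∀ 𝒟, IsCover boundingBox (carriers T) 𝒟 → 𝒟 = 𝒞 := by
  refine ⟨RealRAM.boxCover, 100000, fun T _ => ?_⟩
  -- There are at most as many trees as vertices, and `n < 2 ^ (Nat.log 2 n + 1)`; the factor `4`
  -- accounts for the two additional units in the exponent.
  have hb : 4 * T.length + 2 ≤ 2 ^ (Nat.log 2 (totalVertices T) + 3) := by
    have h1 := Nat.lt_pow_succ_log_self one_lt_two (totalVertices T)
    have h2 := length_le_totalVertices T
    have h3 : 2 ^ (Nat.log 2 (totalVertices T) + 3) =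
        4 * 2 ^ (Nat.log 2 (totalVertices T) + 1) := by ring
    simp only [Nat.succ_eq_add_one] at h1
    omega
  obtain ⟨t, s, k, he, ht, 𝒞, hO, hC⟩ := RealRAM.runs_boxCover T hb
  refine ⟨t, s, 𝒞, he, le_trans ?_ (mul_natLog_le _), hO, hC⟩
  exact_mod_cast (Nat.le_add_right t k).trans ht
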